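/- Let $A=\{f_n : n\in\mathbb N_{>0}\}$, ordered by $f_n<f_m \Leftrightarrow n>m$, let $\mathbf T(A)$ and $\mathbf F(A)$ be the sets of (non-planar) rooted trees and rooted forests with vertices labelled by $A$ (up to isomorphism; $\mathbb I$ is the empty forest, $|u|$ the number of vertices of $u$), and regard a forest as a poset whose minimal elements are the roots. $B^+_a(u)$ is the tree obtained by joining the roots of $u$ to a new root labelled $a$. For $t=B^+_a(v)$ put $t\circ u=B^+_a(vu)$, $t^{\circ 1}=t$ and $t^{\circ (r+1)}=t\circ t^{\circ r}$. **Coefficients.** For a word $w=f_{k_1}\cdots f_{k_n}$ let $\alpha^U_w=\int_{0\le s_1\le\dots\le s_n\le1}s_1^{k_1-1}\cdots s_n^{k_n-1}\,ds_1\cdots ds_n$ (the coefficient of the universal singular frame), with $\alpha^U_1=1$ for the empty word. For $u\in\mathbf F(A)$ let $\alpha^U(u)=\sum\alpha^U_{a_1\cdots a_n}$, the sum over all total orders $x_1>\dots>x_n$ of the vertices of $u$ that extend the partial order, $a_i$ being the label of $x_i$. For $\alpha,\beta:\mathbf F(A)\to\mathbb R$ let $(\alpha\beta)(u)=\sum\alpha(v)\beta(w)$,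 the sum over all splittings of the vertices of $u$ into a lower set $w$ and its complement $v$ (both with the induced order); the unit is $\epsilon$, with $\epsilon(\mathbb I)=1$ and $\epsilon(u)=0$ otherwise. For $u\ne\mathbb I$ put $\exp\alpha(u)=\sum_{k=1}^{|u|}\frac1{k!}\alpha^k(u)$, with $\exp\alpha(\mathbb I)=1$ (if $\alpha(\mathbb I)=0$), and $\log\alpha(u)=\sum_{k=1}^{|u|}\frac{(-1)^{k+1}}{k}(\alpha-\epsilon)^k(u)$, with $\log\alpha(\mathbb I)=0$ (if $\alpha(\mathbb I)=1$). Let $\beta^U=\log\alpha^U$. **Hall trees.** A non-empty word $w$ is Lyndon if $w<v$ alphabetically (proper prefixes are smaller) for every factorization $w=uv$ with $u,v$ non-empty. The set $\mathbf H(\mathbf T(A))_U$ of Hall trees consists of one rooted tree $t_w$ for each Lyndon word $w$. If $w=a$ is a letter, then $t_w=B^+_a(\mathbb I)$. If $|w|\ge2$, write $w=w'w''$ with $w''$ the longest proper Lyndon suffix; then $t_w$ has the standard decomposition $(t_{w'},t_{w''})$. Explicitly, iterating this on the left factor gives $w=a\,w_1\cdots w_k$ with a letter $a$ and Lyndon words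 $w_1\ge\dots\ge w_k$, and $t_w=B^+_a(t_1^{\circ r_1}\cdots t_m^{\circ r_m})$, where $t_1,\dots,t_m$ are the different trees among $t_{w_1},\dots,t_{w_k}$, occurring $r_1,\dots,r_m$ times. Hall trees are ordered by the alphabetical order of their words. The set $\mathbf H(\mathbf F(A))_U$ of Hall forests consists of the forests $u=t_1^{\circ r_1}\cdots t_m^{\circ r_m}$ with $m\ge0$, Hall trees $t_1>\dots>t_m$ and $r_i\ge1$. **Hall polynomials.** Let $K$ be a field of characteristic $0$, and let $L_{\mathbb U}$ be the free Lie algebra over $K$ with one generator in each degree $n>0$, written $f_n$; it lies in the free associative algebra $K\langle A\rangle$, its enveloping algebra, whose underlying vector space is that of the universal Hopf algebra $H_U$. Put $E(B^+_{f_n}(\mathbb I))=f_n$, $E(t)=[E(t''),E(t')]$ for a Hall tree with standard decomposition $(t',t'')$, and $E(u)=E(t_m)^{r_m}\cdots E(t_1)^{r_1}$ for a Hall forest $u=t_1^{\circ r_1}\cdots t_m^{\circ r_m}$, $t_1>\dots>t_m$. **Proposition.** 1. Different Lyndon words give different Hall trees, and different data $(t_1,r_1),\dots,(t_m,r_m)$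 give different Hall forests; so $E(t)$ and $E(u)$ are well defined. 2. $\beta^U(\mathbb I)=0$, $\alpha^U=\exp\beta^U$, and $\beta^U(u)=0$ for all $u\in\mathbf F(A)\setminus\mathbf T(A)$. 3. In the algebra of formal power series over $\mathbb R$ in the noncommuting variables $f_n$, $$\sum_{n\ge0,\ k_j>0}\alpha^U_{f_{k_1}\cdots f_{k_n}}\,f_{k_1}\cdots f_{k_n}=\exp\Big(\sum_{t\in\mathbf H(\mathbf T(A))_U}\beta^U(t)\,E(t)\Big),$$ where for each word only finitely many terms $\beta^U(t)E(t)$ have a non-zero coefficient at that word. 4. $\{E(t):t\in\mathbf H(\mathbf T(A))_U\}$ is a basis of the vector space $L_{\mathbb U}$ (the Hall basis). 5. $\{E(u):u\in\mathbf H(\mathbf F(A))_U\}$ is a basis of the vector space $K\langle A\rangle$ underlying $H_U$ (the PBW basis). -/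

import Mathlib

open scoped BigOperators

namespace HallFrame

noncomputable section

/-! ## Labelled rooted forests -/

/-- Planar representatives of rooted forests with vertices labelled by `A`: the empty forest, or a
first tree (with root label `a` and branches `c`) followed by the other trees `r`. -/
inductive PForest (A : Type) : Type
  | nil : PForest A
  | cons (a : A) (c r : PForest A) : PForest A

namespace PForest

variable {A : Type}

/-- Juxtaposition of forests. -/
def append : PForest A → PForest A → PForest A
  | nil, v => v
  | cons a c r, v => cons a c (append r v)

/-- Two planar forests represent the same (non-planar) labelled forest: one is obtained from the
other by permuting sibling trees, at any level. -/
inductive Rel : PForest A → PForest A → Prop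
  | refl (u : PForest A) : Rel u u
  | symm {u v : PForest A} : Rel u v → Rel v u
  | trans {u v w : PForest A} : Rel u v → Rel v w → Rel u w
  | cons (a : A) {c c' r r' : PForest A} : Rel c c' → Rel r r' → Rel (cons a c r) (cons a c' r')
  | swap (a b : A) (c d r : PForest A) : Rel (cons a c (cons b d r)) (cons b d (cons a c r))

/-- The vertices of a forest; in `cons a c r` the vertex `inl none` is the root of the first tree,
the vertices `inl (some x)` are those above this root, and the `inr x` are in the other trees. -/
def Vert : PForest A → Type
  | nil => Empty
  | cons _ c r => Option (Vert c) ⊕ Vert r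

instance instFintypeVert : (u : PForest A) → Fintype (Vert u)
  | nil => inferInstanceAs (Fintype Empty)
  | cons _ c r =>
    letI := instFintypeVert c
    letI := instFintypeVert r
    inferInstanceAs (Fintype (Option (Vert c) ⊕ Vert r))

instance instDecidableEqVert : (u : PForest A) → DecidableEq (Vert u)
  | nil => inferInstanceAs (DecidableEq Empty)
  | cons _ c r =>
    letI := instDecidableEqVert c
    letI := instDecidableEqVert r
    inferInstanceAs (DecidableEq (Option (Vert c) ⊕ Vert r))

/-- The label of a vertex. -/
def label : (u : PForest A) → Vert u → A
  | cons a _ _, Sum.inl none => a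
  | cons _ c _, Sum.inl (some x) => label c x
  | cons _ _ r, Sum.inr x => label r x

/-- The partial order of a forest: `le u x y` when `x` lies on the path from a root to `y`
(so the roots are the minimal vertices). -/
def le : (u : PForest A) → Vert u → Vert u → Prop
  | cons _ _ _, Sum.inl none, Sum.inl _ => True
  | cons _ c _, Sum.inl (some x), Sum.inl (some y) => le c x y
  | cons _ _ r, Sum.inr x, Sum.inr y => le r x y
  | cons _ _ _, _, _ => False

/-- The labelled forest represented by the set of vertices `S` with the induced order. -/
def restrict : (u : PForest A) → (Vert u → Bool) → PForest A
  | nil, _ => nil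
  | cons a c r, S =>
    let c' := restrict c fun x => S (Sum.inl (some x))
    let r' := restrict r fun x => S (Sum.inr x)
    if S (Sum.inl none) then cons a c' r' else append c' r'

theorem append_assoc (u v w : PForest A) :
    append (append u v) w = append u (append v w) := by
  induction u with
  | nil => rfl
  | cons a c r _ ih => simp [append, ih]

theorem append_nil (u : PForest A) : append u nil = u := by
  induction u with
  | nil => rfl
  | cons a c r _ ih => simp [append, ih]

theorem Rel.append_left (u : PForest A) {v v' : PForest A} (h : Rel v v') :
    Rel (append u v) (append u v') := by
  induction u with
  | nil => exact h
  | cons a c r _ ih => exact Rel.cons a (Rel.refl c) ih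

theorem Rel.append_right {u u' : PForest A} (h : Rel u u') (v : PForest A) :
    Rel (append u v) (append u' v) := by
  induction h with
  | refl u => exact Rel.refl _
  | symm _ ih => exact ih.symm
  | trans _ _ ih₁ ih₂ => exact ih₁.trans ih₂
  | cons a h₁ _ _ ih₂ => exact Rel.cons a h₁ ih₂
  | swap a b c d r => exact Rel.swap a b c d _

theorem Rel.append {u u' v v' : PForest A} (h : Rel u u') (h' : Rel v v') :
    Rel (append u v) (append u' v') :=
  (h.append_right v).trans (Rel.append_left u' h')

theorem Rel.middle (a : A) (c u v : PForest A) :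
    Rel (PForest.append u (PForest.cons a c v)) (PForest.cons a c (PForest.append u v)) := by
  induction u with
  | nil => exact Rel.refl _
  | cons b d r _ ih => exact (Rel.cons b (Rel.refl d) ih).trans (Rel.swap b a d c _)

theorem Rel.comm (u v : PForest A) : Rel (PForest.append u v) (PForest.append v u) := by
  induction u with
  | nil => rw [append_nil]; exact Rel.refl _
  | cons a c r _ ih => exact (Rel.cons a (Rel.refl c) ih).trans (Rel.middle a c v r).symm

/-- Equivalent planar forests have isomorphic labelled posets of vertices, and restrictions to
corresponding sets of vertices are equivalent. -/
theorem Rel.exists_equiv {u v : PForest A} (h : Rel u v) :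
    ∃ e : Vert u ≃ Vert v, (∀ x y, le v (e x) (e y) ↔ le u x y) ∧
      (∀ x, label v (e x) = label u x) ∧
      ∀ S : Vert v → Bool, Rel (restrict u fun x => S (e x)) (restrict v S) := by
  induction h with
  | refl u => exact ⟨Equiv.refl _, fun _ _ => Iff.rfl, fun _ => rfl, fun _ => Rel.refl _⟩
  | symm _ ih =>
    obtain ⟨e, h₁, h₂, h₃⟩ := ih
    refine ⟨e.symm, fun x y => ?_, fun x => ?_, fun S => ?_⟩
    · rw [← h₁]; simp
    · rw [← h₂]; simp
    · have := (h₃ fun x => S (e.symm x)).symm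
      simpa using this
  | trans _ _ ih₁ ih₂ =>
    obtain ⟨e, h₁, h₂, h₃⟩ := ih₁
    obtain ⟨f, k₁, k₂, k₃⟩ := ih₂
    refine ⟨e.trans f, fun x y => ?_, fun x => ?_, fun S => ?_⟩
    · simp [k₁, h₁]
    · simp [k₂, h₂]
    · exact (h₃ fun x => S (f x)).trans (k₃ S)
  | @cons a c c' r r' _ _ ih₁ ih₂ =>
    obtain ⟨e, h₁, h₂, h₃⟩ := ih₁
    obtain ⟨f, k₁, k₂, k₃⟩ := ih₂
    refine ⟨Equiv.sumCongr (Equiv.optionCongr e) f, ?_, ?_, fun S => ?_⟩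
    · rintro ((_ | x) | x) ((_ | y) | y)
      all_goals first | exact Iff.rfl | exact h₁ _ _ | exact k₁ _ _
    · rintro ((_ | x) | x)
      · rfl
      · exact h₂ x
      · exact k₂ x
    · have hc := h₃ fun x => S (Sum.inl (some x))
      have hr := k₃ fun x => S (Sum.inr x)
      change Rel (if S (Sum.inl none) = true then
        PForest.cons a (restrict c fun x => S (Sum.inl (some (e x))))
          (restrict r fun x => S (Sum.inr (f x)))
        else PForest.append (restrict c fun x => S (Sum.inl (some (e x))))
          (restrict r fun x => S (Sum.inr (f x)))) _
      by_cases hS : S (Sum.inl none) = true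
      · simpa [restrict, hS] using Rel.cons a hc hr
      · simpa [restrict, hS] using Rel.append hc hr
  | swap a b c d r =>
    refine ⟨⟨fun x => match x with
        | Sum.inl x => Sum.inr (Sum.inl x)
        | Sum.inr (Sum.inl x) => Sum.inl x
        | Sum.inr (Sum.inr x) => Sum.inr (Sum.inr x),
      fun x => match x with
        | Sum.inl x => Sum.inr (Sum.inl x)
        | Sum.inr (Sum.inl x) => Sum.inl x
        | Sum.inr (Sum.inr x) => Sum.inr (Sum.inr x), ?_, ?_⟩, ?_, ?_, fun S => ?_⟩
    · rintro (_ | _ | _) <;> rfl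
    · rintro (_ | _ | _) <;> rfl
    · rintro ((_ | x) | (_ | x) | x) ((_ | y) | (_ | y) | y) <;> exact Iff.rfl
    · rintro ((_ | x) | (_ | x) | x) <;> rfl
    · generalize hc : (restrict c fun x => S (Sum.inr (Sum.inl (some x)))) = c'
      generalize hd : (restrict d fun x => S (Sum.inl (some x))) = d'
      generalize hr : (restrict r fun x => S (Sum.inr (Sum.inr x))) = r'
      by_cases h₁ : S (Sum.inl none) = true <;>
        by_cases h₂ : S (Sum.inr (Sum.inl none)) = true
      · simpa [restrict, h₁, h₂, hc, hd, hr] using Rel.swap a b c' d' r'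
      · simpa [restrict, h₁, h₂, hc, hd, hr] using Rel.middle b d' c' r'
      · simpa [restrict, h₁, h₂, hc, hd, hr] using (Rel.middle a c' d' r').symm
      · have := Rel.append_right (Rel.comm c' d') r'
        rw [append_assoc, append_assoc] at this
        simpa [restrict, h₁, h₂, hc, hd, hr] using this

instance instSetoid (A : Type) : Setoid (PForest A) :=
  ⟨Rel, ⟨Rel.refl, Rel.symm, Rel.trans⟩⟩

/-- A total order on the vertices extending the order of the forest, given as the decreasing
enumeration `e 0 > e 1 > ...` of all vertices. -/
def IsLinExt (u : PForest A) (e : Fin (Fintype.card (Vert u)) ≃ Vert u) : Prop :=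
  ∀ i j, le u (e j) (e i) → i ≤ j

/-- The word of labels read along a decreasing enumeration of the vertices. -/
def word (u : PForest A) (e : Fin (Fintype.card (Vert u)) ≃ Vert u) : List A :=
  List.ofFn fun i => label u (e i)

/-- A lower set of vertices (it contains with a vertex the path down to the root). -/
def IsLower (u : PForest A) (S : Vert u → Bool) : Prop :=
  ∀ x y, le u y x → S x = true → S y = true

open Classical in
/-- `α(u)`: the sum of the `α_w` over the words `w` of all linear extensions of `u`. -/
def extend (α : List A → ℝ) (u : PForest A) : ℝ :=
  ∑ e : Fin (Fintype.card (Vert u)) ≃ Vert u, if IsLinExt u e then α (word u e) else 0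

end PForest

/-- `𝐅(A)`: the rooted forests labelled by `A`, up to isomorphism. -/
def Forest (A : Type) : Type := Quotient (PForest.instSetoid A)

namespace Forest

variable {A : Type}

/-- Forests multiply by juxtaposition; the unit is the empty forest `𝕀`. -/
instance instCommMonoid : CommMonoid (Forest A) where
  one := Quotient.mk _ PForest.nil
  mul := Quotient.map₂ PForest.append fun _ _ h _ _ h' => PForest.Rel.append h h'
  mul_assoc := by
    rintro ⟨u⟩ ⟨v⟩ ⟨w⟩
    exact congrArg (Quotient.mk _) (PForest.append_assoc u v w)
  one_mul := by
    rintro ⟨u⟩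
    rfl
  mul_one := by
    rintro ⟨u⟩
    exact congrArg (Quotient.mk _) (PForest.append_nil u)
  mul_comm := by
    rintro ⟨u⟩ ⟨v⟩
    exact Quotient.sound (PForest.Rel.comm u v)

/-- `B⁺_a(u)`: the tree obtained by joining the roots of `u` to a new root labelled `a`. -/
def graft (a : A) : Forest A → Forest A :=
  Quotient.map (fun u => PForest.cons a u PForest.nil)
    fun _ _ h => PForest.Rel.cons a h (PForest.Rel.refl _)

/-- `𝐓(A)` inside `𝐅(A)`: the forests that are a single rooted tree. -/
def IsTree (u : Forest A) : Prop := ∃ a v, u = graft a v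

/-- The number `|u|` of vertices. -/
def size : Forest A → ℕ :=
  Quotient.lift (fun u => Fintype.card (PForest.Vert u)) fun _ _ h =>
    let ⟨e, _⟩ := PForest.Rel.exists_equiv h
    Fintype.card_congr e

theorem extend_congr (α : List A → ℝ) {u v : PForest A} (h : PForest.Rel u v) :
    PForest.extend α u = PForest.extend α v := by
  classical
  obtain ⟨e, h₁, h₂, -⟩ := h.exists_equiv
  have hc : Fintype.card (PForest.Vert u) = Fintype.card (PForest.Vert v) := Fintype.card_congr e
  unfold PForest.extend
  refine Fintype.sum_equiv (Equiv.equivCongr (finCongr hc) e) _ _ fun f => ?_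
  have hl : PForest.IsLinExt v (Equiv.equivCongr (finCongr hc) e f) ↔ PForest.IsLinExt u f := by
    constructor
    · intro H i j hij
      have := H (finCongr hc i) (finCongr hc j) (by simpa [h₁] using hij)
      simpa using this
    · intro H i j hij
      have := H ((finCongr hc).symm i) ((finCongr hc).symm j) (by simpa [h₁] using hij)
      simpa using this
  have hw : PForest.word v (Equiv.equivCongr (finCongr hc) e f) = PForest.word u f := by
    unfold PForest.word
    apply List.ext_get
    · simp [hc]
    · intro n k₁ k₂
      simp [h₂]
  simp only [hl, hw]

/-- The map `α : 𝐅(A) → ℝ` attached to coefficients `α_w` of words: the sum of `α_w` over all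
linear extensions of the forest. -/
def extend (α : List A → ℝ) : Forest A → ℝ :=
  Quotient.lift (PForest.extend α) fun _ _ h => extend_congr α h

open Classical in
/-- Convolution of functions on forests on a planar representative. -/
def pconv (f g : Forest A → ℝ) (u : PForest A) : ℝ :=
  ∑ S : PForest.Vert u → Bool, if PForest.IsLower u S then
    f (Quotient.mk _ (PForest.restrict u fun x => !(S x))) *
      g (Quotient.mk _ (PForest.restrict u S)) else 0

theorem pconv_congr (f g : Forest A → ℝ) {u v : PForest A} (h : PForest.Rel u v) :
    pconv f g u = pconv f g v := by
  classical
  obtain ⟨e, h₁, -, h₃⟩ := h.exists_equiv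
  unfold pconv
  refine (Fintype.sum_equiv (Equiv.arrowCongr e.symm (Equiv.refl Bool)) _ _ fun S => ?_).symm
  have hl : PForest.IsLower u (Equiv.arrowCongr e.symm (Equiv.refl Bool) S) ↔
      PForest.IsLower v S := by
    constructor
    · intro H x y hxy hx
      have := H (e.symm x) (e.symm y) (by rw [← h₁]; simpa using hxy) (by simpa using hx)
      simpa using this
    · intro H x y hxy hx
      exact H (e x) (e y) ((h₁ _ _).2 hxy) hx
  have e₁ : (Quotient.mk (PForest.instSetoid A) (PForest.restrict u fun x => !(S (e x)))) =
      Quotient.mk _ (PForest.restrict v fun x => !(S x)) :=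
    Quotient.sound (h₃ fun x => !(S x))
  have e₂ : (Quotient.mk (PForest.instSetoid A) (PForest.restrict u fun x => S (e x))) =
      Quotient.mk _ (PForest.restrict v S) := Quotient.sound (h₃ S)
  simp only [hl, ← e₁, ← e₂]
  rfl

/-- The product `⟨f g, u⟩ = ⟨f ⊗ g, Δ u⟩` dual to the coproduct `Δ u = ∑ v ⊗ w`, the sum over all
splittings of the vertices of `u` into a lower set (giving `w`) and its complement (giving `v`). -/
def conv (f g : Forest A → ℝ) : Forest A → ℝ :=
  Quotient.lift (pconv f g) fun _ _ h => pconv_congr f g h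

open Classical in
/-- The unit `ε` of the convolution product. -/
def counit (u : Forest A) : ℝ := if u = 1 then 1 else 0

/-- Convolution powers. -/
def convPow (f : Forest A → ℝ) : ℕ → Forest A → ℝ
  | 0 => counit
  | k + 1 => conv f (convPow f k)

open Classical in
/-- `exp f (𝕀) = 1` and `exp f (u) = ∑_{k=1}^{|u|} f^k(u) / k!` for `u ≠ 𝕀` (for `f(𝕀) = 0`). -/
def expMap (f : Forest A → ℝ) (u : Forest A) : ℝ :=
  if u = 1 then 1 else ∑ k ∈ Finset.Icc 1 (size u), (1 / (k.factorial : ℝ)) * convPow f k u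

open Classical in
/-- `log f (𝕀) = 0` and `log f (u) = ∑_{k=1}^{|u|} (-1)^(k+1) (f - ε)^k(u) / k` for `u ≠ 𝕀`
(for `f(𝕀) = 1`). -/
def logMap (f : Forest A → ℝ) (u : Forest A) : ℝ :=
  if u = 1 then 0 else
    ∑ k ∈ Finset.Icc 1 (size u), ((-1 : ℝ) ^ (k + 1) / (k : ℝ)) * convPow (f - counit) k u

end Forest

/-! ## The coefficients of the universal singular frame

The alphabet is `{f_n : n > 0}`, and the letter `f_n` is coded by `n : ℕ+`. -/

/-- The function `x ↦ (∫_{k_n} ... ∫_{k_1} 1)(x)`, where `(∫_k g)(x) = ∫₀ˣ g(s) s^(k-1) ds`. -/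
def iterInt (w : List ℕ+) : ℝ → ℝ :=
  w.foldl (fun (g : ℝ → ℝ) (k : ℕ+) (x : ℝ) => ∫ s in (0 : ℝ)..x, g s * s ^ ((k : ℕ) - 1))
    fun _ => 1

/-- `α^U_w = ∫_{0 ≤ s_1 ≤ ... ≤ s_n ≤ 1} s_1^(k_1-1) ... s_n^(k_n-1)` for `w = f_{k_1}...f_{k_n}`. -/
def alphaWord (w : List ℕ+) : ℝ := iterInt w 1

/-- `α^U` on forests. -/
def alphaU : Forest ℕ+ → ℝ := Forest.extend alphaWord

/-- `β^U = log α^U` on forests. -/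
def betaU : Forest ℕ+ → ℝ := Forest.logMap alphaU

/-! ## Lyndon words and Hall trees -/

/-- The alphabetical order on words, where `f_n < f_m` if and only if `n > m`, and a word is larger
than its proper prefixes. -/
def wordLT (u v : List ℕ+) : Prop := List.Lex (fun n m : ℕ+ => m < n) u v

/-- Lyndon words: non-empty, and smaller than each proper non-empty suffix. -/
def IsLyndon (w : List ℕ+) : Prop :=
  w ≠ [] ∧ ∀ u v, u ≠ [] → v ≠ [] → w = u ++ v → wordLT w v

/-- Iterated decompositions `t = (t¹, t²)` into two parts, down to single letters. -/
inductive Bracket : Type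
  | letter (n : ℕ+) : Bracket
  | pair (t₁ t₂ : Bracket) : Bracket
  deriving DecidableEq

namespace Bracket

/-- The foliage `f(t) = f(t¹) f(t²)`. -/
def foliage : Bracket → List ℕ+
  | letter n => [n]
  | pair t₁ t₂ => foliage t₁ ++ foliage t₂

/-- The Hall set of the Lyndon words: the foliage is a Lyndon word `w`, and, if `|w| ≥ 2`, then
`w = f(t¹) f(t²)` is its standard factorization (`f(t²)` is the longest Lyndon proper suffix of
`w`), and `t¹` and `t²` are of this kind themselves. -/
def IsHall : Bracket → Prop
  | letter _ => True
  | pair t₁ t₂ => IsHall t₁ ∧ IsHall t₂ ∧ IsLyndon (foliage t₁ ++ foliage t₂) ∧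
      ∀ u v, u ≠ [] → foliage t₁ ++ foliage t₂ = u ++ v → IsLyndon v →
        v.length ≤ (foliage t₂).length

/-- The label of the root of the rooted tree with the iterated decomposition `t`. -/
def rootLabel : Bracket → ℕ+
  | letter n => n
  | pair t₁ _ => rootLabel t₁

/-- The parts `y_1, ..., y_k` of `t = ((a, y_1), ..., y_k)`, with `a` a letter. -/
def parts : Bracket → List Bracket
  | letter _ => []
  | pair t₁ t₂ => parts t₁ ++ [t₂]

/-- The number of letters. -/
def length : Bracket → ℕ
  | letter _ => 1
  | pair t₁ t₂ => length t₁ + length t₂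

theorem length_pos (t : Bracket) : 0 < t.length := by
  induction t with
  | letter n => exact Nat.one_pos
  | pair t₁ t₂ h₁ _ => simp only [length]; omega

theorem length_lt_of_mem_parts {s t : Bracket} (h : s ∈ t.parts) : s.length < t.length := by
  induction t with
  | letter n => simp [parts] at h
  | pair t₁ t₂ h₁ _ =>
    simp only [parts, List.mem_append, List.mem_singleton] at h
    have := length_pos t₁
    have := length_pos t₂
    simp only [length]
    rcases h with h | h
    · have := h₁ h
      omega
    · subst h
      omega

end Bracket

/-- `t^{∘r} = t ∘ (t ∘ ... (t ∘ t))` (with `r` factors `t`) for the tree `t = B⁺_a(v)`, where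
`t ∘ u = B⁺_a(v u)` grafts the roots of `u` to the root of `t`; it is `𝕀` for `r = 0`. -/
def circPow (a : ℕ+) (v : Forest ℕ+) : ℕ → Forest ℕ+
  | 0 => 1
  | r + 1 => Forest.graft a (v * circPow a v r)

namespace Bracket

/-- The forest `u` above the root of the rooted tree `B⁺_a(u)` with the iterated standard
decomposition `t`: it is `t_1^{∘r_1} ... t_m^{∘r_m}`, if `t = ((a, y_1), ..., y_k)` and the
different trees among `y_1, ..., y_k` are `t_1, ..., t_m` with multiplicities `r_1, ..., r_m`. -/
def branches (t : Bracket) : Forest ℕ+ :=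
  ∏ y ∈ t.parts.toFinset.attach,
    circPow y.1.rootLabel (branches y.1) (t.parts.count y.1)
termination_by t.length
decreasing_by exact length_lt_of_mem_parts (List.mem_toFinset.1 y.2)

theorem branches_eq (t : Bracket) :
    t.branches = ∏ y ∈ t.parts.toFinset, circPow y.rootLabel y.branches (t.parts.count y) := by
  rw [branches]
  exact Finset.prod_attach _ fun y : Bracket =>
    circPow y.rootLabel y.branches (t.parts.count y)

/-- The rooted tree with the iterated standard decomposition `t`. -/
def toTree (t : Bracket) : Forest ℕ+ := Forest.graft t.rootLabel t.branches

/-- The Hall polynomial `E(t)` in the free Lie algebra: `E(f_n)` is the generator of degree `n`,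
and `E(t) = [E(t²), E(t¹)]`. -/
def hallPoly (K : Type*) [CommRing K] : Bracket → FreeLieAlgebra K ℕ+
  | letter n => FreeLieAlgebra.of K n
  | pair t₁ t₂ => ⁅hallPoly K t₂, hallPoly K t₁⁆

end Bracket

/-- The Hall trees of `𝐇(𝐓(A))_U`, each given by its iterated standard decomposition. -/
abbrev HallTree : Type := {t : Bracket // t.IsHall}

/-- The Hall forests `t_1^{∘r_1} ... t_m^{∘r_m}` of `𝐇(𝐅(A))_U`, `t_1 > ... > t_m`, each given by
the decreasing list of Hall trees in which `t_i` occurs `r_i` times. Hall trees are ordered by the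
alphabetical order of their foliages. -/
abbrev HallForest : Type :=
  {l : List HallTree // l.Pairwise fun s t => ¬ wordLT s.1.foliage t.1.foliage}

/-- The rooted forest `t_1^{∘r_1} ... t_m^{∘r_m}`. -/
def HallForest.toForest (u : HallForest) : Forest ℕ+ :=
  ∏ t ∈ u.1.toFinset, circPow t.1.rootLabel t.1.branches (u.1.count t)

attribute [local instance] LieRing.ofAssociativeRing

/-- The inclusion of the free Lie algebra on the `f_n` into the free associative algebra on the
`f_n`, which is its universal enveloping algebra. -/
def lieToAssoc (K : Type*) [CommRing K] : FreeLieAlgebra K ℕ+ →ₗ⁅K⁆ FreeAlgebra K ℕ+ :=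
  FreeLieAlgebra.lift K (FreeAlgebra.ι K)

/-- `E(u) = E(t_m)^{r_m} ... E(t_1)^{r_1}`, that is `E(𝕀) = 1` and `E(u) = E(u²) E(u¹)`, where `u²`
is the smallest tree of `u` and `u¹` is the rest. -/
def HallForest.poly (K : Type*) [CommRing K] (u : HallForest) : FreeAlgebra K ℕ+ :=
  (u.1.reverse.map fun t => lieToAssoc K (t.1.hallPoly K)).prod

/-! ## Formal series in the noncommuting variables `f_n`, given by their coefficients -/

/-- The coefficient of a word in a noncommutative polynomial. -/
def coeff {K : Type*} [CommRing K] (w : List ℕ+) (p : FreeAlgebra K ℕ+) : K :=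
  (FreeAlgebra.basisFreeMonoid K ℕ+).repr p (FreeMonoid.ofList w)

/-- The product of formal series (concatenation of words). -/
def seriesMul (S T : List ℕ+ → ℝ) (w : List ℕ+) : ℝ :=
  ∑ i ∈ Finset.range (w.length + 1), S (w.take i) * T (w.drop i)

/-- Powers of a formal series. -/
def seriesPow (S : List ℕ+ → ℝ) : ℕ → List ℕ+ → ℝ
  | 0 => fun w => if w = [] then 1 else 0
  | k + 1 => seriesMul S (seriesPow S k)

/-- The exponential `∑_k S^k / k!` of a formal series without constant term; the powers with
`k > |w|` do not contribute to the coefficient of `w`. -/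
def seriesExp (S : List ℕ+ → ℝ) (w : List ℕ+) : ℝ :=
  ∑ k ∈ Finset.range (w.length + 1), (1 / (k.factorial : ℝ)) * seriesPow S k w

/-- The term `β^U(t) E(t)` of the Hall tree `t`, as a formal series. -/
def hallTerm (t : HallTree) (w : List ℕ+) : ℝ :=
  betaU t.1.toTree * coeff w (lieToAssoc ℝ (t.1.hallPoly ℝ))

/-- The formal series `∑ β^U(t) E(t)` over all Hall trees, with coefficientwise summation. -/
def hallSeries (w : List ℕ+) : ℝ := ∑ᶠ t : HallTree, hallTerm t w

end

end HallFrame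

/-! Forests enter only through the words of their linear extensions. Read from the roots upwards,
these words form a multiset `lin u`. Juxtaposition becomes the shuffle product, `B⁺_a` puts the
letter `a` in front, and splitting off a lower set becomes cutting words in two. So the passage from
series to functions on forests turns concatenation into convolution (`conv_extend`) and commutes
with exp and log. Thus `β^U` comes from the series `betaWord = log α^U` on words, and `α^U = exp
β^U` reduces to the identity exp(log(1 + X)) = 1 + X. The iterated integrals are multiplicative
under shuffles (`isShuffleChar_alphaRev`). The logarithm of such a character `f` is the derivative
at `m = 0` of `f ^ m`, which is polynomial in `m`, and so vanishes on proper shuffles. Therefore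
`β^U` vanishes on products of non-empty forests.

For the bases, polynomials are paired with words. The shuffle product is dual to the coproduct with
primitive generators, and every `E(t)` is primitive. Hence a product of Hall trees can be paired
factor by factor with a sorted product of the `E(t)` (`pairing_mul_polyL`), as soon as each Hall
tree `T` pairs to 1 with `E(T)` and to 0 with all other sorted products. The factorials that arise
are absorbed by `t^{∘r}`, which behaves like the divided power `t^r / r!` (`lin_mul_circPow`). The
duality for a single tree (`treeDual`) is an induction on size: the root of `T` prescribes the last
letter of the polynomial, brackets are opened until that letter is isolated, and what remains is
paired with the branches, which consist of smaller Hall trees.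

So Hall forests and the `E(u)` are dual families, which gives linear independence of both kinds of
polynomials and the faithfulness of the coding. Spanning is straightening: a Jacobi argument in the
Lie algebra (`lie_mem_spanLT`), then sorting of products (`polyL_mem_spanSorted`). Finally
`betaWord` is expanded in the `E(u)`. By duality the coefficients are the `β^U(u)`, and these vanish
unless `u` is a single Hall tree. -/

namespace HallFrame

noncomputable section

/-! ## Shuffles of words -/

section Shuffle

variable {A : Type*}

/-- The shuffles of two words. -/
def shuffle : List A → List A → Multiset (List A)
  | [], y => {y}
  | a :: x, [] => {a :: x}
  | a :: x, b :: y => (shuffle x (b :: y)).map (a :: ·) + (shuffle (a :: x) y).map (b :: ·)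

@[simp] theorem shuffle_nil_left (y : List A) : shuffle [] y = {y} := by
  rw [shuffle]

@[simp] theorem shuffle_nil_right (x : List A) : shuffle x [] = {x} := by
  cases x <;> rw [shuffle]

theorem shuffle_cons_cons (a b : A) (x y : List A) :
    shuffle (a :: x) (b :: y) =
      (shuffle x (b :: y)).map (a :: ·) + (shuffle (a :: x) y).map (b :: ·) := by
  rw [shuffle]

theorem shuffle_perm {x y w : List A} (h : w ∈ shuffle x y) : w.Perm (x ++ y) := by
  induction x generalizing y w with
  | nil => simp_all
  | cons a x ihx =>
    induction y generalizing w with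
    | nil => simp_all
    | cons b y ihy =>
      rw [shuffle_cons_cons, Multiset.mem_add, Multiset.mem_map, Multiset.mem_map] at h
      rcases h with ⟨w, hw, rfl⟩ | ⟨w, hw, rfl⟩
      · exact (ihx hw).cons a
      · exact ((ihy hw).cons b).trans (List.perm_middle (l₁ := a :: x)).symm

theorem bind_singleton_self (M : Multiset (List A)) : (M.bind fun x => {x}) = M :=
  (Multiset.bind_singleton M fun x => x).trans (Multiset.map_id' M)

/-- Both sides are sorted by which of the three words supplies the first letter; the three cases are
the three induction hypotheses. -/
theorem shuffle_assoc (x y z : List A) :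
    (shuffle x y).bind (fun w => shuffle w z) = (shuffle y z).bind fun w => shuffle x w := by
  induction x generalizing y z with
  | nil => simp [bind_singleton_self]
  | cons a x ihx =>
    induction y generalizing z with
    | nil => simp
    | cons b y ihy =>
      induction z with
      | nil => simp [bind_singleton_self]
      | cons c z ihz =>
        have h₁ := congrArg (Multiset.map (a :: ·)) (ihx (b :: y) (c :: z))
        have h₂ := congrArg (Multiset.map (b :: ·)) (ihy (c :: z))
        have h₃ := congrArg (Multiset.map (c :: ·)) ihz
        simp only [shuffle_cons_cons, Multiset.map_bind, Multiset.add_bind, Multiset.bind_map,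
          Multiset.map_add, Multiset.bind_add] at h₁ h₂ h₃ ⊢
        rw [← h₃, ← add_assoc, h₁, h₂]
        abel

/-- The bilinear extension of the shuffle product. -/
def shuffleM (M N : Multiset (List A)) : Multiset (List A) :=
  M.bind fun x => N.bind fun y => shuffle x y

theorem shuffleM_add_left (M M' N : Multiset (List A)) :
    shuffleM (M + M') N = shuffleM M N + shuffleM M' N := Multiset.add_bind _ _ _

theorem shuffleM_add_right (M N N' : Multiset (List A)) :
    shuffleM M (N + N') = shuffleM M N + shuffleM M N' := by
  simp only [shuffleM, Multiset.add_bind, Multiset.bind_add]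

theorem shuffleM_nsmul_left (n : ℕ) (M N : Multiset (List A)) :
    shuffleM (n • M) N = n • shuffleM M N := by
  induction n with
  | zero => simp [shuffleM]
  | succ n ih => rw [succ_nsmul, succ_nsmul, shuffleM_add_left, ih]

theorem shuffleM_nsmul_right (n : ℕ) (M N : Multiset (List A)) :
    shuffleM M (n • N) = n • shuffleM M N := by
  induction n with
  | zero => simp [shuffleM]
  | succ n ih => rw [succ_nsmul, succ_nsmul, shuffleM_add_right, ih]

@[simp] theorem shuffleM_one_left (M : Multiset (List A)) : shuffleM {[]} M = M := by
  simp [shuffleM, bind_singleton_self]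

@[simp] theorem shuffleM_one_right (M : Multiset (List A)) : shuffleM M {[]} = M := by
  simp [shuffleM, bind_singleton_self]

theorem shuffleM_assoc (L M N : Multiset (List A)) :
    shuffleM (shuffleM L M) N = shuffleM L (shuffleM M N) := by
  simp only [shuffleM, Multiset.bind_assoc]
  refine Multiset.bind_congr fun x _ => Multiset.bind_congr fun y _ => ?_
  rw [Multiset.bind_bind]
  simp only [shuffle_assoc]

theorem shuffleM_cons_cons (a b : A) (M N : Multiset (List A)) :
    shuffleM (M.map (a :: ·)) (N.map (b :: ·)) =
      (shuffleM M (N.map (b :: ·))).map (a :: ·) + (shuffleM (M.map (a :: ·)) N).map (b :: ·) := by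
  simp only [shuffleM, Multiset.bind_map, shuffle_cons_cons, Multiset.bind_add, Multiset.map_bind]

end Shuffle

/-! ### Words of the linear extensions of a planar forest -/

namespace PForest

variable {A : Type}

/-- The words of the linear extensions of a forest, read increasingly (roots first). -/
def lin : PForest A → Multiset (List A)
  | nil => {[]}
  | cons a c r => shuffleM ((lin c).map (a :: ·)) (lin r)

theorem lin_append (u v : PForest A) : lin (append u v) = shuffleM (lin u) (lin v) := by
  induction u with
  | nil => simp [append, lin]
  | cons a c r _ ih => simp only [append, lin, ih, shuffleM_assoc]

end PForest

end

end HallFrame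

namespace HallFrame

noncomputable section

/-! ## Linear extensions as lists of vertices -/

theorem shuffleM_sum_left {A ι : Type*} (s : Finset ι) (f : ι → Multiset (List A))
    (N : Multiset (List A)) : shuffleM (∑ i ∈ s, f i) N = ∑ i ∈ s, shuffleM (f i) N := by
  classical
  induction s using Finset.induction_on with
  | empty => simp [shuffleM]
  | insert i s hi ih => rw [Finset.sum_insert hi, Finset.sum_insert hi, shuffleM_add_left, ih]

theorem shuffleM_sum_right {A ι : Type*} (s : Finset ι) (f : ι → Multiset (List A))
    (M : Multiset (List A)) : shuffleM M (∑ i ∈ s, f i) = ∑ i ∈ s, shuffleM M (f i) := by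
  classical
  induction s using Finset.induction_on with
  | empty => simp [shuffleM]
  | insert i s hi ih => rw [Finset.sum_insert hi, Finset.sum_insert hi, shuffleM_add_right, ih]

theorem multiset_map_sum {α β ι : Type*} (g : α → β) (s : Finset ι) (f : ι → Multiset α) :
    (∑ i ∈ s, f i).map g = ∑ i ∈ s, (f i).map g :=
  map_sum (Multiset.mapAddMonoidHom g) f s

section LinExt

open Classical

variable {V W A : Type*} (le : V → V → Prop) (lab : V → A)

/-- The increasing enumerations of the finite set `s` compatible with the relation `le`. -/
def linExts (s : Finset V) : Finset (List V) :=
  {l ∈ (⟨Multiset.lists s.val, Multiset.lists_nodup_finset s⟩ : Finset (List V)) |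
    l.Pairwise fun x y => ¬ le y x}

variable {le}

theorem mem_linExts {s : Finset V} {l : List V} :
    l ∈ linExts le s ↔ (l : Multiset V) = s.val ∧ l.Pairwise fun x y => ¬ le y x := by
  simp [linExts, eq_comm]

theorem nodup_of_mem_linExts {s : Finset V} {l : List V} (h : l ∈ linExts le s) : l.Nodup := by
  rw [← Multiset.coe_nodup, (mem_linExts.1 h).1]
  exact s.nodup

theorem mem_of_mem_linExts {s : Finset V} {l : List V} (h : l ∈ linExts le s) {x : V} :
    x ∈ l ↔ x ∈ s := by
  rw [← Multiset.mem_coe, (mem_linExts.1 h).1, Finset.mem_val]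

theorem length_of_mem_linExts {s : Finset V} {l : List V} (h : l ∈ linExts le s) :
    l.length = s.card := by
  rw [← Multiset.coe_card, (mem_linExts.1 h).1, Finset.card_val]

theorem mem_linExts_iff {s : Finset V} {l : List V} :
    l ∈ linExts le s ↔ l.Nodup ∧ (∀ x, x ∈ l ↔ x ∈ s) ∧ l.Pairwise fun x y => ¬ le y x := by
  refine ⟨fun h => ⟨nodup_of_mem_linExts h, fun _ => mem_of_mem_linExts h, (mem_linExts.1 h).2⟩,
    fun ⟨h₁, h₂, h₃⟩ => mem_linExts.2 ⟨?_, h₃⟩⟩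
  exact (Multiset.Nodup.ext (Multiset.coe_nodup.2 h₁) s.nodup).2 h₂

variable (le)

/-- The minimal elements of a finite set. -/
def minimals (s : Finset V) : Finset V := {x ∈ s | ∀ y ∈ s, y ≠ x → ¬ le y x}

/-- An enumeration starts with an arbitrary minimal element and continues with an enumeration of the
rest. The later computations of `linWords` rest on this recursion. -/
theorem sum_linExts {M : Type*} [AddCommMonoid M] {s : Finset V} (hs : s.Nonempty)
    (F : List V → M) :
    ∑ l ∈ linExts le s, F l =
      ∑ x ∈ minimals le s, ∑ l ∈ linExts le (s.erase x), F (x :: l) := by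
  rw [Finset.sum_sigma']
  symm
  refine Finset.sum_bij (fun p _ => p.1 :: p.2) ?_ ?_ ?_ ?_
  · rintro ⟨x, l⟩ h
    simp only [Finset.mem_sigma, minimals, Finset.mem_filter, mem_linExts_iff] at h
    obtain ⟨⟨hx, hm⟩, hn, hl, hp⟩ := h
    simp only [mem_linExts_iff, List.nodup_cons, List.pairwise_cons, List.mem_cons, hl,
      Finset.mem_erase]
    refine ⟨⟨by simp, hn⟩, fun y => ?_, fun y hy => hm y hy.2 hy.1, hp⟩
    by_cases h : y = x <;> simp [h, hx]
  · rintro ⟨x, l⟩ - ⟨y, m⟩ - h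
    simp_all
  · intro l hl
    rw [mem_linExts_iff] at hl
    obtain ⟨hn, hl, hp⟩ := hl
    cases l with
    | nil => obtain ⟨x, hx⟩ := hs; simp at hl; exact absurd hx (hl x)
    | cons x l =>
      rw [List.nodup_cons] at hn
      rw [List.pairwise_cons] at hp
      refine ⟨⟨x, l⟩, ?_, rfl⟩
      simp only [Finset.mem_sigma, minimals, Finset.mem_filter, mem_linExts_iff, ← hl]
      refine ⟨⟨by simp, fun y hy hyx => hp.1 y ?_⟩, hn.2, fun y => ?_, hp.2⟩
      · simpa [hyx] using hy
      · rw [Finset.mem_erase, ← hl, List.mem_cons]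
        by_cases h : y = x <;> simp [h, hn.1]
  · intros; rfl

/-- The label words of the increasing enumerations of `s`. -/
def linWords (s : Finset V) : Multiset (List A) := ∑ l ∈ linExts le s, {l.map lab}

@[simp] theorem linWords_empty : linWords le lab ∅ = {[]} := by
  have : linExts le ∅ = {[]} := by
    ext l
    rw [mem_linExts]
    simp +contextual
  simp [linWords, this]

theorem linWords_of_nonempty {s : Finset V} (hs : s.Nonempty) :
    linWords le lab s =
      ∑ x ∈ minimals le s, (linWords le lab (s.erase x)).map (lab x :: ·) := by
  rw [linWords, sum_linExts le hs]
  refine Finset.sum_congr rfl fun x _ => ?_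
  rw [linWords, multiset_map_sum]
  simp

theorem linWords_map (le' : W → W → Prop) (lab' : W → A) (e : V ↪ W)
    (h₁ : ∀ x y, le' (e x) (e y) ↔ le x y) (h₂ : ∀ x, lab' (e x) = lab x) (s : Finset V) :
    linWords le' lab' (s.map e) = linWords le lab s := by
  induction hn : s.card generalizing s with
  | zero => rw [Finset.card_eq_zero] at hn; simp [hn]
  | succ n ih =>
    have hs : s.Nonempty := Finset.card_pos.1 (by omega)
    rw [linWords_of_nonempty _ _ hs, linWords_of_nonempty _ _ (hs.map)]
    have : minimals le' (s.map e) = (minimals le s).map e := by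
      ext x
      simp only [minimals, Finset.mem_filter, Finset.mem_map]
      constructor
      · rintro ⟨⟨x, hx, rfl⟩, h⟩
        refine ⟨x, ⟨hx, fun y hy hyx => ?_⟩, rfl⟩
        rw [← h₁]
        exact h _ ⟨y, hy, rfl⟩ (by simpa using hyx)
      · rintro ⟨x, ⟨hx, h⟩, rfl⟩
        refine ⟨⟨x, hx, rfl⟩, ?_⟩
        rintro _ ⟨y, hy, rfl⟩ hyx
        rw [h₁]
        exact h y hy (by simpa using hyx)
    rw [this, Finset.sum_map]
    refine Finset.sum_congr rfl fun x hx => ?_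
    have hx : x ∈ s := (Finset.mem_filter.1 hx).1
    rw [← Finset.map_erase, ih _ (by rw [Finset.card_erase_of_mem hx]; omega), h₂]

theorem linWords_insert_bot {x : V} {s : Finset V} (hx : x ∉ s) (h₁ : ∀ y ∈ s, ¬ le y x)
    (h₂ : ∀ y ∈ s, le x y) :
    linWords le lab (insert x s) = (linWords le lab s).map (lab x :: ·) := by
  rw [linWords_of_nonempty _ _ (Finset.insert_nonempty x s)]
  have : minimals le (insert x s) = {x} := by
    ext y
    simp only [minimals, Finset.mem_filter, Finset.mem_insert, Finset.mem_singleton]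
    constructor
    · rintro ⟨rfl | hy, h⟩
      · rfl
      · exact absurd (h₂ y hy) (h x (Or.inl rfl) (by rintro rfl; exact hx hy))
    · rintro rfl
      refine ⟨Or.inl rfl, ?_⟩
      rintro z (rfl | hz) hzy
      · exact absurd rfl hzy
      · exact h₁ z hz
  rw [this, Finset.sum_singleton, Finset.erase_insert hx]

/-- A minimal element of the union of two unrelated sets is minimal in exactly one of them. This is
the recursion of the shuffle by its first letter. -/
theorem linWords_union (s t : Finset V) (hd : Disjoint s t)
    (h : ∀ x ∈ s, ∀ y ∈ t, ¬ le x y ∧ ¬ le y x) :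
    linWords le lab (s ∪ t) = shuffleM (linWords le lab s) (linWords le lab t) := by
  induction hn : s.card + t.card generalizing s t with
  | zero =>
    obtain rfl : s = ∅ := Finset.card_eq_zero.1 (by omega)
    obtain rfl : t = ∅ := Finset.card_eq_zero.1 (by omega)
    simp
  | succ n ih =>
    rcases s.eq_empty_or_nonempty with rfl | hs
    · simp
    rcases t.eq_empty_or_nonempty with rfl | ht
    · simp
    rw [linWords_of_nonempty _ _ (hs.mono Finset.subset_union_left)]
    have hm : minimals le (s ∪ t) = minimals le s ∪ minimals le t := by
      ext x
      simp only [minimals, Finset.mem_filter, Finset.mem_union]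
      constructor
      · rintro ⟨hx | hx, hm⟩
        · exact Or.inl ⟨hx, fun y hy => hm y (Or.inl hy)⟩
        · exact Or.inr ⟨hx, fun y hy => hm y (Or.inr hy)⟩
      · rintro (⟨hx, hm⟩ | ⟨hx, hm⟩)
        · refine ⟨Or.inl hx, ?_⟩
          rintro y (hy | hy) hyx
          exacts [hm y hy hyx, (h x hx y hy).2]
        · refine ⟨Or.inr hx, ?_⟩
          rintro y (hy | hy) hyx
          exacts [(h y hy x hx).1, hm y hy hyx]
    have hd' : Disjoint (minimals le s) (minimals le t) :=
      Finset.disjoint_of_subset_left (Finset.filter_subset _ _)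
        (Finset.disjoint_of_subset_right (Finset.filter_subset _ _) hd)
    rw [hm, Finset.sum_union hd']
    have e₁ : ∀ x ∈ minimals le s, (linWords le lab ((s ∪ t).erase x)).map (lab x :: ·) =
        (shuffleM (linWords le lab (s.erase x)) (linWords le lab t)).map (lab x :: ·) := by
      intro x hx
      have hx : x ∈ s := (Finset.mem_filter.1 hx).1
      have hxt : x ∉ t := Finset.disjoint_left.1 hd hx
      rw [Finset.erase_union_distrib, Finset.erase_eq_of_notMem hxt,
        ih (s.erase x) t (Finset.disjoint_of_subset_left (Finset.erase_subset _ _) hd)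
          (fun y hy z hz => h y (Finset.mem_of_mem_erase hy) z hz)
          (by rw [Finset.card_erase_of_mem hx]; have := Finset.card_pos.2 hs; omega)]
    have e₂ : ∀ x ∈ minimals le t, (linWords le lab ((s ∪ t).erase x)).map (lab x :: ·) =
        (shuffleM (linWords le lab s) (linWords le lab (t.erase x))).map (lab x :: ·) := by
      intro x hx
      have hx : x ∈ t := (Finset.mem_filter.1 hx).1
      have hxs : x ∉ s := Finset.disjoint_right.1 hd hx
      rw [Finset.erase_union_distrib, Finset.erase_eq_of_notMem hxs,
        ih s (t.erase x) (Finset.disjoint_of_subset_right (Finset.erase_subset _ _) hd)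
          (fun y hy z hz => h y hy z (Finset.mem_of_mem_erase hz))
          (by rw [Finset.card_erase_of_mem hx]; have := Finset.card_pos.2 ht; omega)]
    rw [Finset.sum_congr rfl e₁, Finset.sum_congr rfl e₂]
    conv_rhs => rw [linWords_of_nonempty le lab hs, linWords_of_nonempty le lab ht]
    rw [shuffleM_sum_left]
    simp only [shuffleM_sum_right, shuffleM_cons_cons, Finset.sum_add_distrib]
    congr 1
    · refine Finset.sum_congr rfl fun x _ => ?_
      rw [← multiset_map_sum, ← shuffleM_sum_right, ← linWords_of_nonempty le lab ht]
    · rw [Finset.sum_comm]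
      refine Finset.sum_congr rfl fun x _ => ?_
      rw [← multiset_map_sum, ← shuffleM_sum_left, ← linWords_of_nonempty le lab hs]

/-- The step of the recursion over planar forests, for an abstract vertex set consisting of a root
`x₀`, the vertices above it and an unrelated rest. If `S` omits the root, the part above it merely
joins the rest, as in `restrict`. -/
theorem linWords_filter_of_cover {V₁ V₂ : Type*} [Fintype V] [Fintype V₁] [Fintype V₂]
    (le₁ : V₁ → V₁ → Prop) (lab₁ : V₁ → A) (le₂ : V₂ → V₂ → Prop) (lab₂ : V₂ → A)
    (e₁ : V₁ ↪ V) (e₂ : V₂ ↪ V) (x₀ : V)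
    (hcov : ∀ x, x = x₀ ∨ (∃ y, e₁ y = x) ∨ ∃ z, e₂ z = x)
    (h₁₀ : ∀ y, e₁ y ≠ x₀) (h₂₀ : ∀ z, e₂ z ≠ x₀) (h₁₂ : ∀ y z, e₁ y ≠ e₂ z)
    (l₁ : ∀ x y, le (e₁ x) (e₁ y) ↔ le₁ x y) (l₂ : ∀ x y, le (e₂ x) (e₂ y) ↔ le₂ x y)
    (b₁ : ∀ x, lab (e₁ x) = lab₁ x) (b₂ : ∀ x, lab (e₂ x) = lab₂ x)
    (l₀₁ : ∀ y, le x₀ (e₁ y) ∧ ¬ le (e₁ y) x₀) (l₀₂ : ∀ z, ¬ le x₀ (e₂ z) ∧ ¬ le (e₂ z) x₀)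
    (l₁₂ : ∀ y z, ¬ le (e₁ y) (e₂ z) ∧ ¬ le (e₂ z) (e₁ y)) (S : V → Bool) :
    linWords le lab {x | S x = true} =
      shuffleM
        (if S x₀ = true then (linWords le₁ lab₁ {x | S (e₁ x) = true}).map (lab x₀ :: ·)
          else linWords le₁ lab₁ {x | S (e₁ x) = true})
        (linWords le₂ lab₂ {x | S (e₂ x) = true}) := by
  rw [← linWords_map le₁ lab₁ le lab e₁ l₁ b₁, ← linWords_map le₂ lab₂ le lab e₂ l₂ b₂]
  set s₁ : Finset V := ({x | S (e₁ x) = true} : Finset V₁).map e₁ with hs₁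
  set s₂ : Finset V := ({x | S (e₂ x) = true} : Finset V₂).map e₂ with hs₂
  have m₁ : ∀ x, x ∈ s₁ → ∃ y, e₁ y = x := fun x hx => by
    obtain ⟨y, -, h⟩ := Finset.mem_map.1 hx
    exact ⟨y, h⟩
  have m₂ : ∀ x, x ∈ s₂ → ∃ y, e₂ y = x := fun x hx => by
    obtain ⟨y, -, h⟩ := Finset.mem_map.1 hx
    exact ⟨y, h⟩
  have hd : Disjoint s₁ s₂ := Finset.disjoint_left.2 fun x h h' => by
    obtain ⟨y, rfl⟩ := m₁ x h
    obtain ⟨z, hz⟩ := m₂ _ h'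
    exact h₁₂ y z hz.symm
  have h₀ : x₀ ∉ s₁ := fun h => by
    obtain ⟨y, hy⟩ := m₁ _ h
    exact h₁₀ y hy
  have h₀' : x₀ ∉ s₂ := fun h => by
    obtain ⟨y, hy⟩ := m₂ _ h
    exact h₂₀ y hy
  have hunrel : ∀ x ∈ s₁, ∀ y ∈ s₂, ¬ le x y ∧ ¬ le y x := fun x hx y hy => by
    obtain ⟨x, rfl⟩ := m₁ _ hx
    obtain ⟨y, rfl⟩ := m₂ _ hy
    exact l₁₂ x y
  have k₁ : ∀ y, e₁ y ∈ s₁ ↔ S (e₁ y) = true := by simp [hs₁]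
  have k₂ : ∀ y, e₂ y ∈ s₂ ↔ S (e₂ y) = true := by simp [hs₂]
  have k₁₂ : ∀ y, e₁ y ∉ s₂ := fun y h => by
    obtain ⟨z, hz⟩ := m₂ _ h
    exact h₁₂ y z hz.symm
  have k₂₁ : ∀ y, e₂ y ∉ s₁ := fun y h => by
    obtain ⟨z, hz⟩ := m₁ _ h
    exact h₁₂ z y hz
  split_ifs with hS
  · have : ({x | S x = true} : Finset V) = insert x₀ s₁ ∪ s₂ := by
      ext x
      rcases hcov x with rfl | ⟨y, rfl⟩ | ⟨z, rfl⟩ <;>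
        simp [hS, k₁, k₂, k₁₂, k₂₁, h₁₀, h₂₀]
    rw [this, linWords_union, linWords_insert_bot le lab h₀]
    · intro y hy
      obtain ⟨y, rfl⟩ := m₁ _ hy
      exact (l₀₁ y).2
    · intro y hy
      obtain ⟨y, rfl⟩ := m₁ _ hy
      exact (l₀₁ y).1
    · exact Finset.disjoint_insert_left.2 ⟨h₀', hd⟩
    · intro x hx y hy
      rcases Finset.mem_insert.1 hx with rfl | hx
      · obtain ⟨y, rfl⟩ := m₂ _ hy
        exact l₀₂ y
      · exact hunrel x hx y hy
  · have : ({x | S x = true} : Finset V) = s₁ ∪ s₂ := by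
      ext x
      rcases hcov x with rfl | ⟨y, rfl⟩ | ⟨z, rfl⟩ <;>
        simp [hS, k₁, k₂, k₁₂, k₂₁, h₀, h₀']
    rw [this, linWords_union _ _ _ _ hd hunrel]

end LinExt

/-! ### Linear extensions of restricted forests -/

namespace PForest

variable {A : Type}

open Classical in
theorem linWords_filter (u : PForest A) (S : Vert u → Bool) :
    linWords (le u) (label u) {x | S x = true} = lin (restrict u S) := by
  induction u with
  | nil =>
    have : ({x | S x = true} : Finset (Vert (nil : PForest A))) = ∅ := by
      ext x; cases x
    rw [this]
    simp [restrict, lin]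
  | cons a c r ihc ihr =>
    let e₁ : Vert c ↪ Vert (cons a c r) :=
      ⟨fun x => Sum.inl (some x), fun x y h => Option.some.inj (Sum.inl.inj h)⟩
    let e₂ : Vert r ↪ Vert (cons a c r) := ⟨fun x => Sum.inr x, fun x y h => Sum.inr.inj h⟩
    let x₀ : Vert (cons a c r) := Sum.inl none
    have hc : linWords (le c) (label c) {x | S (e₁ x) = true} =
      lin (restrict c fun x => S (Sum.inl (some x))) := ihc _
    have hr : linWords (le r) (label r) {x | S (e₂ x) = true} =
      lin (restrict r fun x => S (Sum.inr x)) := ihr _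
    have hres : lin (restrict (cons a c r) S) = shuffleM
        (if S x₀ = true then (lin (restrict c fun x => S (Sum.inl (some x)))).map (a :: ·)
          else lin (restrict c fun x => S (Sum.inl (some x))))
        (lin (restrict r fun x => S (Sum.inr x))) := by
      by_cases hS : S (Sum.inl none) = true
      · rw [if_pos hS]
        simp only [restrict, hS, if_true, lin]
      · rw [if_neg hS]
        simp [restrict, hS, lin_append]
    rw [linWords_filter_of_cover (le (cons a c r)) (label (cons a c r)) (le c) (label c) (le r)
      (label r) e₁ e₂ x₀, hc, hr, hres]
    · rfl
    · rintro ((_ | x) | x)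
      · exact Or.inl rfl
      · exact Or.inr (Or.inl ⟨x, rfl⟩)
      · exact Or.inr (Or.inr ⟨x, rfl⟩)
    · exact fun y h => nomatch Sum.inl.inj h
    · exact fun z h => nomatch h
    · exact fun y z h => nomatch h
    · exact fun _ _ => Iff.rfl
    · exact fun _ _ => Iff.rfl
    · exact fun _ => rfl
    · exact fun _ => rfl
    · exact fun _ => ⟨trivial, id⟩
    · exact fun _ => ⟨id, id⟩
    · exact fun _ _ => ⟨id, id⟩

theorem restrict_true (u : PForest A) : restrict u (fun _ => true) = u := by
  induction u with
  | nil => rfl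
  | cons a c r ihc ihr => simp [restrict, ihc, ihr]

theorem linWords_univ (u : PForest A) : linWords (le u) (label u) Finset.univ = lin u := by
  have := linWords_filter u fun _ => true
  rw [restrict_true] at this
  simpa using this

/-- `extend` enumerates vertices from the top, `lin` from the roots. The reversals of words in what
follows come from here. -/
theorem extend_eq (α : List A → ℝ) (u : PForest A) :
    extend α u = ((lin u).map fun w => α w.reverse).sum := by
  classical
  rw [← linWords_univ, linWords, multiset_map_sum, ← Multiset.coe_sumAddMonoidHom, map_sum, extend,
    ← Finset.sum_filter]
  refine Finset.sum_bij (fun e _ => (List.ofFn e).reverse) ?_ ?_ ?_ ?_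
  · intro e he
    rw [mem_linExts_iff]
    refine ⟨by simpa [List.nodup_ofFn] using e.injective, fun x => ?_, ?_⟩
    · simpa using e.surjective x
    · rw [List.pairwise_reverse, List.pairwise_ofFn]
      intro i j hij h
      have he : IsLinExt u e := (Finset.mem_filter.1 he).2
      exact absurd (he _ _ h) (not_le.2 hij)
  · intro e _ f _ h
    have := List.ofFn_injective (List.reverse_injective h)
    exact DFunLike.coe_injective this
  · intro l hl
    rw [mem_linExts_iff] at hl
    obtain ⟨hn, hl, hp⟩ := hl
    have hn' := List.nodup_reverse.2 hn
    let e := hn'.getEquivOfForallMemList l.reverse fun x => by simpa using hl x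
    have hc : l.reverse.length = Fintype.card (Vert u) := by
      simpa using Fintype.card_congr e
    have key : List.ofFn ((finCongr hc.symm).trans e) = l.reverse := by
      apply List.ext_get
      · simp [← hc]
      · intro n h₁ h₂
        simp [e]
    refine ⟨(finCongr hc.symm).trans e, Finset.mem_filter.2 ⟨Finset.mem_univ _, ?_⟩, ?_⟩
    · intro i j hij
      by_contra hlt
      have : (List.ofFn ((finCongr hc.symm).trans e)).Pairwise fun x y => ¬ le u x y := by
        rw [key, List.pairwise_reverse]
        exact hp
      rw [List.pairwise_ofFn] at this
      exact this (not_le.1 hlt) hij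
    · rw [key, List.reverse_reverse]
  · intro e _
    simp [word, List.map_reverse, List.map_ofFn]
    rfl

theorem length_of_mem_lin {u : PForest A} {w : List A} (h : w ∈ lin u) :
    w.length = Fintype.card (Vert u) := by
  classical
  rw [← linWords_univ, linWords, Multiset.mem_sum] at h
  obtain ⟨l, hl, h⟩ := h
  rw [Multiset.mem_singleton.1 h, List.length_map, length_of_mem_linExts hl, Finset.card_univ]

open Classical in
-- The multiplicity of `w` in `lin u` is the value of `extend` at the indicator function of
-- `w.reverse`, and `extend` is already known to be invariant.
theorem Rel.lin_eq {u v : PForest A} (h : Rel u v) : lin u = lin v := by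
  ext w
  have := Forest.extend_congr (fun x => if x = w.reverse then (1 : ℝ) else 0) h
  simp only [extend_eq, List.reverse_inj] at this
  have key : ∀ M : Multiset (List A),
      (M.map fun x => if x = w then (1 : ℝ) else 0).sum = (M.count w : ℝ) := fun M => by
    induction M using Multiset.induction_on with
    | empty => simp
    | cons x M ih => rw [Multiset.map_cons, Multiset.sum_cons, ih, Multiset.count_cons]; simp [eq_comm, add_comm]
  rw [key, key] at this
  exact_mod_cast this

end PForest

/-! ### Linear extensions of forests up to isomorphism -/

namespace Forest

variable {A : Type}

/-- The words of the linear extensions of a forest, read increasingly (roots first). -/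
def lin : Forest A → Multiset (List A) :=
  Quotient.lift PForest.lin fun _ _ h => PForest.Rel.lin_eq h

theorem lin_mk (u : PForest A) : lin (Quotient.mk _ u) = PForest.lin u := rfl

@[simp] theorem lin_one : lin (1 : Forest A) = {[]} := rfl

theorem lin_mul (u v : Forest A) : lin (u * v) = shuffleM (lin u) (lin v) := by
  induction u using Quotient.inductionOn
  induction v using Quotient.inductionOn
  exact PForest.lin_append _ _

theorem lin_graft (a : A) (u : Forest A) : lin (graft a u) = (lin u).map (a :: ·) := by
  induction u using Quotient.inductionOn
  exact shuffleM_one_right _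

theorem extend_eq (α : List A → ℝ) (u : Forest A) :
    extend α u = ((lin u).map fun w => α w.reverse).sum := by
  induction u using Quotient.inductionOn
  exact PForest.extend_eq _ _

theorem length_of_mem_lin {u : Forest A} {w : List A} (h : w ∈ lin u) : w.length = size u := by
  induction u using Quotient.inductionOn
  exact PForest.length_of_mem_lin h

end Forest

end

end HallFrame

namespace HallFrame

noncomputable section

/-! ## Convolution of extended functions -/

open Classical in
-- Enumerations of a lower set and of its complement concatenate to an enumeration of all vertices,
-- and every cut of such an enumeration arises in this way exactly once.
theorem sum_linExts_cuts {V M : Type*} [Fintype V] [DecidableEq V] [AddCommMonoid M] (le : V → V → Prop)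
    (F : List V → List V → M) :
    (∑ S : V → Bool, if (∀ x y, le y x → S x = true → S y = true) then
      ∑ l₁ ∈ linExts le {x | S x = true}, ∑ l₂ ∈ linExts le {x | (!(S x)) = true}, F l₁ l₂ else 0) =
    ∑ l ∈ linExts le Finset.univ, ∑ i ∈ Finset.range (l.length + 1), F (l.take i) (l.drop i) := by
  have hprod : ∀ S : V → Bool, ∑ l₁ ∈ linExts le {x | S x = true},
      ∑ l₂ ∈ linExts le {x | (!(S x)) = true}, F l₁ l₂ =
      ∑ p ∈ linExts le {x | S x = true} ×ˢ linExts le {x | (!(S x)) = true}, F p.1 p.2 :=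
    fun S => (Finset.sum_product' _ _ _).symm
  simp only [hprod]
  rw [← Finset.sum_filter, Finset.sum_sigma', Finset.sum_sigma']
  refine Finset.sum_bij (fun p _ => ⟨p.2.1 ++ p.2.2, p.2.1.length⟩) ?_ ?_ ?_ ?_
  · rintro ⟨S, l₁, l₂⟩ h
    simp only [Finset.mem_sigma, Finset.mem_filter, Finset.mem_univ, true_and, Finset.mem_product,
      mem_linExts_iff, Bool.not_eq_true', Finset.mem_range, List.length_append] at h ⊢
    obtain ⟨hS, ⟨n₁, m₁, p₁⟩, n₂, m₂, p₂⟩ := h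
    refine ⟨⟨?_, fun x => ?_, ?_⟩, by omega⟩
    · rw [List.nodup_append]
      refine ⟨n₁, n₂, fun x hx y hy hxy => ?_⟩
      subst hxy
      rw [m₁] at hx
      rw [m₂, hx] at hy
      exact absurd hy (by simp)
    · rw [List.mem_append, m₁, m₂]
      cases S x <;> simp
    · rw [List.pairwise_append]
      refine ⟨p₁, p₂, fun x hx y hy hle => ?_⟩
      have := hS x y hle ((m₁ x).1 hx)
      rw [m₂, this] at hy
      exact absurd hy (by simp)
  · rintro ⟨S, l₁, l₂⟩ h ⟨S', l₁', l₂'⟩ h' heq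
    simp only [Sigma.mk.injEq, heq_eq_eq] at heq
    obtain ⟨rfl, rfl⟩ := List.append_inj heq.1 heq.2
    simp only [Finset.mem_sigma, Finset.mem_filter, Finset.mem_univ, true_and, Finset.mem_product,
      mem_linExts_iff] at h h'
    have : S = S' := funext fun x => by
      rw [Bool.eq_iff_iff, ← h.2.1.2.1, ← h'.2.1.2.1]
    rw [this]
  · rintro ⟨l, i⟩ h
    simp only [Finset.mem_sigma, mem_linExts_iff, Finset.mem_univ, iff_true, Finset.mem_range] at h
    obtain ⟨⟨hn, hm, hp⟩, hi⟩ := h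
    rw [← List.take_append_drop i l, List.pairwise_append] at hp
    rw [← List.take_append_drop i l, List.nodup_append] at hn
    have hdrop : ∀ x, x ∈ l.drop i ↔ x ∉ l.take i := fun x => by
      refine ⟨fun h h' => hn.2.2 x h' x h rfl, fun h => ?_⟩
      have := hm x
      rw [← List.take_append_drop i l, List.mem_append] at this
      exact this.resolve_left h
    -- The lower set consists of the first `i` vertices: nothing below one of them can come later in
    -- an increasing enumeration.
    refine ⟨⟨fun x => decide (x ∈ l.take i), l.take i, l.drop i⟩, ?_, ?_⟩
    · simp only [Finset.mem_sigma, Finset.mem_filter, Finset.mem_univ, true_and,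
        Finset.mem_product, mem_linExts_iff, decide_eq_true_eq, Bool.not_eq_true',
        decide_eq_false_iff_not]
      refine ⟨fun x y hle hx => ?_, ⟨hn.1, by simp, hp.1⟩, hn.2.1, hdrop, hp.2.1⟩
      by_contra hy
      exact hp.2.2 x hx y ((hdrop y).2 hy) hle
    · simp only [List.take_append_drop, List.length_take, Sigma.mk.injEq, heq_eq_eq, true_and]
      omega
  · rintro ⟨S, l₁, l₂⟩ h
    simp

theorem seriesMul_reverse (f g : List ℕ+ → ℝ) (w : List ℕ+) :
    seriesMul f g w.reverse =
      ∑ i ∈ Finset.range (w.length + 1), f (w.drop i).reverse * g (w.take i).reverse := by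
  rw [seriesMul, List.length_reverse, ← Finset.sum_range_reflect]
  refine Finset.sum_congr rfl fun i hi => ?_
  have hi : i ≤ w.length := by simpa [Nat.lt_succ_iff] using hi
  rw [List.take_reverse, List.drop_reverse]
  congr 4 <;> omega

/-! ### From concatenation of words to convolution on forests -/

namespace Forest

/-- Cuts of linear extensions are lower sets together with linear extensions of both parts. As words
are read from the top, the lower set gives the suffix, which is the argument of `g`. -/
theorem conv_extend (f g : List ℕ+ → ℝ) :
    conv (extend f) (extend g) = extend (seriesMul f g) := by
  classical
  funext u
  induction u using Quotient.inductionOn with | _ u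
  change pconv (extend f) (extend g) u = extend (seriesMul f g) (Quotient.mk _ u)
  have key : ∀ (h : List ℕ+ → ℝ) (S : PForest.Vert u → Bool),
      extend h (Quotient.mk _ (PForest.restrict u S)) =
        ∑ l ∈ linExts (PForest.le u) {x | S x = true}, h (l.map (PForest.label u)).reverse := by
    intro h S
    refine (extend_eq h (Quotient.mk _ (PForest.restrict u S))).trans ?_
    rw [lin_mk, ← PForest.linWords_filter, linWords, multiset_map_sum,
      ← Multiset.coe_sumAddMonoidHom, map_sum]
    simp
  have hL : extend (seriesMul f g) (Quotient.mk _ u) =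
      ∑ l ∈ linExts (PForest.le u) Finset.univ,
        seriesMul f g (l.map (PForest.label u)).reverse := by
    have := key (seriesMul f g) fun _ => true
    rw [PForest.restrict_true] at this
    simpa using this
  rw [hL, pconv]
  have := sum_linExts_cuts (PForest.le u) fun l₁ l₂ =>
    f (l₂.map (PForest.label u)).reverse * g (l₁.map (PForest.label u)).reverse
  simp only [seriesMul_reverse, List.length_map, ← List.map_take, ← List.map_drop]
  rw [← this]
  refine Finset.sum_congr rfl fun S _ => ?_
  by_cases hS : PForest.IsLower u S
  · refine (if_pos hS).trans (Eq.trans ?_ (if_pos hS).symm)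
    rw [key, key, Finset.sum_mul_sum, Finset.sum_comm]
  · exact (if_neg hS).trans (if_neg hS).symm

theorem size_eq_zero_iff {A : Type} (u : Forest A) : size u = 0 ↔ u = 1 := by
  induction u using Quotient.inductionOn with | _ u
  cases u with
  | nil => exact ⟨fun _ => rfl, fun _ => rfl⟩
  | cons a c r =>
    constructor
    · intro h
      exact ((Fintype.card_eq_zero_iff (α := PForest.Vert (PForest.cons a c r))).1 h).elim
        (Sum.inl none)
    · intro h
      have := congrArg lin h
      rw [lin_one, lin_mk] at this
      have hm : [] ∈ PForest.lin (PForest.cons a c r) := by rw [this]; simp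
      exact (PForest.length_of_mem_lin hm).symm

/-- The zeroth power does not depend on the base, so `seriesPow 0 0` serves as the unit series from
here on. -/
theorem counit_eq_extend : counit = extend (seriesPow (0 : List ℕ+ → ℝ) 0) := by
  funext u
  rw [extend_eq, counit]
  split_ifs with h
  · simp [h, seriesPow]
  · rw [← size_eq_zero_iff] at h
    symm
    apply Multiset.sum_eq_zero
    intro x hx
    obtain ⟨w, hw, rfl⟩ := Multiset.mem_map.1 hx
    have := length_of_mem_lin hw
    have : w ≠ [] := by rintro rfl; exact h (by simpa using this.symm)
    simp [seriesPow, this]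

theorem convPow_extend (f : List ℕ+ → ℝ) (k : ℕ) :
    convPow (extend f) k = extend (seriesPow f k) := by
  induction k with
  | zero => exact counit_eq_extend
  | succ k ih => rw [convPow, ih, conv_extend]; rfl

theorem extend_congr_of_length {f g : List ℕ+ → ℝ} (u : Forest ℕ+)
    (h : ∀ w : List ℕ+, w.length = size u → f w = g w) : extend f u = extend g u := by
  rw [extend_eq, extend_eq]
  congr 1
  refine Multiset.map_congr rfl fun w hw => h _ ?_
  rw [List.length_reverse, length_of_mem_lin hw]

theorem extend_sum {ι : Type*} (s : Finset ι) (c : ι → ℝ) (f : ι → List ℕ+ → ℝ) (u : Forest ℕ+) :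
    extend (fun w => ∑ i ∈ s, c i * f i w) u = ∑ i ∈ s, c i * extend (f i) u := by
  simp only [extend_eq]
  induction lin u using Multiset.induction_on with
  | empty => simp
  | cons w M ih => simp only [Multiset.map_cons, Multiset.sum_cons, ih, mul_add,
      Finset.sum_add_distrib]

end Forest

/-- The logarithm of a formal series with constant term `1`. -/
def seriesLog (S : List ℕ+ → ℝ) (w : List ℕ+) : ℝ :=
  ∑ k ∈ Finset.Icc 1 w.length,
    ((-1 : ℝ) ^ (k + 1) / (k : ℝ)) * seriesPow (S - seriesPow 0 0) k w

namespace Forest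

/-- All words in `lin u` have length `size u`, so the truncations of the two logarithms agree. -/
theorem logMap_extend (f : List ℕ+ → ℝ) : logMap (extend f) = extend (seriesLog f) := by
  funext u
  have hsub : extend f - counit = extend (f - seriesPow 0 0) := by
    rw [counit_eq_extend]
    funext u
    simp [extend_eq]
  rw [logMap, hsub]
  split_ifs with h
  · simp [h, extend_eq, seriesLog]
  · simp only [convPow_extend]
    rw [← extend_sum]
    refine extend_congr_of_length u fun w hw => ?_
    rw [seriesLog, hw]

theorem expMap_extend (f : List ℕ+ → ℝ) : expMap (extend f) = extend (seriesExp f) := by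
  funext u
  rw [expMap]
  split_ifs with h
  · simp [h, extend_eq, seriesExp, seriesPow]
  · simp only [convPow_extend]
    rw [← extend_sum]
    refine extend_congr_of_length u fun w hw => ?_
    have hw' : w ≠ [] := by
      rintro rfl
      exact h ((size_eq_zero_iff u).1 hw.symm)
    -- The series sum starts at `k = 0`, the forest sum at `k = 1`; the extra term is the unit
    -- series, which vanishes at a non-empty word.
    rw [seriesExp, hw, Finset.range_eq_Ico, Finset.sum_eq_sum_Ico_succ_bot (Nat.succ_pos _)]
    simp only [seriesPow, if_neg hw', mul_zero, zero_add]
    refine Finset.sum_congr ?_ fun _ _ => rfl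
    ext k
    simp only [Finset.mem_Icc, Finset.mem_Ico]
    omega

end Forest

end

end HallFrame

namespace HallFrame

noncomputable section

/-! ## The algebra of formal series -/

section Cuts

variable {M : Type*} [AddCommMonoid M]

/-- The sum of `F` over the decompositions of a word into a prefix and a suffix. -/
def cutSum {A : Type*} (F : List A → List A → M) (w : List A) : M :=
  ∑ i ∈ Finset.range (w.length + 1), F (w.take i) (w.drop i)

variable {A : Type*}

@[simp] theorem cutSum_nil (F : List A → List A → M) : cutSum F [] = F [] [] := by
  simp [cutSum]

theorem cutSum_cons (F : List A → List A → M) (a : A) (w : List A) :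
    cutSum F (a :: w) = F [] (a :: w) + cutSum (fun p q => F (a :: p) q) w := by
  rw [cutSum, List.length_cons, Finset.sum_range_succ', add_comm]
  rfl

theorem cutSum_add (F G : List A → List A → M) (w : List A) :
    cutSum (fun p q => F p q + G p q) w = cutSum F w + cutSum G w :=
  Finset.sum_add_distrib

/-- Deconcatenation is multiplicative for the shuffle product: to cut a shuffle of `x` and `y` is to
cut both words and to shuffle the first parts and the second parts separately. -/
theorem shuffle_cutSum (x y : List A) (F : List A → List A → M) :
    ((shuffle x y).map (cutSum F)).sum =
      cutSum (fun x₁ x₂ => cutSum (fun y₁ y₂ =>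
        ((shuffle x₁ y₁).map fun p => ((shuffle x₂ y₂).map fun q => F p q).sum).sum) y) x := by
  induction x generalizing y F with
  | nil => simp
  | cons a x ihx =>
    induction y generalizing F with
    | nil => simp
    | cons b y ihy =>
      have h₁ := ihx (b :: y) fun p q => F (a :: p) q
      have h₂ := ihy fun p q => F (b :: p) q
      have e₁ : ∀ w, cutSum F (a :: w) = F [] (a :: w) + cutSum (fun p q => F (a :: p) q) w :=
        cutSum_cons F a
      have e₂ : ∀ w, cutSum F (b :: w) = F [] (b :: w) + cutSum (fun p q => F (b :: p) q) w :=
        cutSum_cons F b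
      rw [shuffle_cons_cons, Multiset.map_add, Multiset.sum_add, Multiset.map_map, Multiset.map_map]
      simp only [Function.comp_def, e₁, e₂, Multiset.sum_map_add]
      rw [h₁, h₂]
      simp only [cutSum_cons, shuffle_cons_cons, shuffle_nil_left, shuffle_nil_right,
        Multiset.map_add, Multiset.sum_add, Multiset.map_map, Function.comp_def,
        Multiset.map_singleton, Multiset.sum_singleton, cutSum_add]
      abel

end Cuts

/-! ### Products, powers and substitution of formal series -/

theorem seriesMul_eq (f g : List ℕ+ → ℝ) (w : List ℕ+) :
    seriesMul f g w = cutSum (fun p q => f p * g q) w := rfl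

theorem seriesMul_nil (f g : List ℕ+ → ℝ) : seriesMul f g [] = f [] * g [] := by
  simp [seriesMul_eq]

theorem seriesMul_cons (f g : List ℕ+ → ℝ) (a : ℕ+) (w : List ℕ+) :
    seriesMul f g (a :: w) = f [] * g (a :: w) + seriesMul (fun v => f (a :: v)) g w :=
  cutSum_cons (fun p q => f p * g q) a w

theorem seriesMul_add_smul_left (f f' g : List ℕ+ → ℝ) (c : ℝ) (w : List ℕ+) :
    seriesMul (fun v => c * f v + f' v) g w = c * seriesMul f g w + seriesMul f' g w := by
  simp only [seriesMul, add_mul, Finset.sum_add_distrib, Finset.mul_sum, mul_assoc]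

theorem seriesMul_assoc (f g h : List ℕ+ → ℝ) :
    seriesMul (seriesMul f g) h = seriesMul f (seriesMul g h) := by
  funext w
  induction w generalizing f g with
  | nil => simp [seriesMul_nil, mul_assoc]
  | cons a w ih =>
    rw [seriesMul_cons, seriesMul_cons]
    simp only [seriesMul_cons f g, seriesMul_nil, seriesMul_add_smul_left, ih]
    rw [seriesMul_cons g h]
    ring

theorem seriesPow_zero_mul (f g : List ℕ+ → ℝ) : seriesMul (seriesPow f 0) g = g := by
  funext w
  cases w with
  | nil => simp [seriesMul_nil, seriesPow]
  | cons a w =>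
    rw [seriesMul_cons, seriesMul]
    simp [seriesPow]

theorem seriesPow_add (f : List ℕ+ → ℝ) (i j : ℕ) :
    seriesPow f (i + j) = seriesMul (seriesPow f i) (seriesPow f j) := by
  induction i with
  | zero => rw [seriesPow_zero_mul, zero_add]
  | succ i ih => rw [Nat.succ_add, seriesPow, ih, seriesPow, seriesMul_assoc]

theorem seriesPow_one (f : List ℕ+ → ℝ) : seriesPow f 1 = f := by
  funext w
  rw [seriesPow]
  induction w generalizing f with
  | nil => simp [seriesMul_nil, seriesPow]
  | cons a w ih =>
    have := ih (fun v => f (a :: v))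
    rw [seriesMul_cons]
    simp only [seriesPow] at this ⊢
    simp [this]

theorem seriesPow_succ' (f : List ℕ+ → ℝ) (k : ℕ) :
    seriesPow f (k + 1) = seriesMul (seriesPow f k) f := by
  rw [seriesPow_add, seriesPow_one]

theorem seriesPow_eq_zero {f : List ℕ+ → ℝ} (hf : f [] = 0) {k : ℕ} {w : List ℕ+}
    (h : w.length < k) : seriesPow f k w = 0 := by
  induction k generalizing w with
  | zero => omega
  | succ k ih =>
    rw [seriesPow, seriesMul]
    refine Finset.sum_eq_zero fun i hi => ?_
    rcases Nat.eq_zero_or_pos i with rfl | hi'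
    · simp [hf]
    · rw [ih (by rw [List.length_drop]; simp at hi; omega), mul_zero]

/-- Substitution of a formal series without constant term into a power series. -/
def seriesEval (g : List ℕ+ → ℝ) (p : PowerSeries ℝ) (w : List ℕ+) : ℝ :=
  ∑ k ∈ Finset.range (w.length + 1), PowerSeries.coeff k p * seriesPow g k w

/-- Powers beyond `|w|` vanish at `w`, so one truncation bound can be used for all prefixes and
suffixes of a word. -/
theorem seriesEval_eq {g : List ℕ+ → ℝ} (hg : g [] = 0) (p : PowerSeries ℝ)
    {w : List ℕ+} {n : ℕ} (hn : w.length < n) :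
    seriesEval g p w = ∑ k ∈ Finset.range n, PowerSeries.coeff k p * seriesPow g k w := by
  refine Finset.sum_subset (Finset.range_subset_range.2 hn) fun k _ hk => ?_
  rw [seriesPow_eq_zero hg (by simpa using hk), mul_zero]

theorem seriesEval_mul {g : List ℕ+ → ℝ} (hg : g [] = 0) (p q : PowerSeries ℝ) :
    seriesEval g (p * q) = seriesMul (seriesEval g p) (seriesEval g q) := by
  funext w
  set n := w.length + 1 with hn
  have h₁ : seriesMul (seriesEval g p) (seriesEval g q) w =
      ∑ a ∈ Finset.range n, ∑ b ∈ Finset.range n,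
        PowerSeries.coeff a p * PowerSeries.coeff b q * seriesPow g (a + b) w := by
    have : ∀ i ∈ Finset.range (w.length + 1),
        seriesEval g p (w.take i) * seriesEval g q (w.drop i) =
        ∑ a ∈ Finset.range n, ∑ b ∈ Finset.range n, PowerSeries.coeff a p * PowerSeries.coeff b q *
          (seriesPow g a (w.take i) * seriesPow g b (w.drop i)) := by
      intro i hi
      rw [seriesEval_eq hg p (n := n) (by rw [List.length_take]; omega),
        seriesEval_eq hg q (n := n) (by rw [List.length_drop]; omega), Finset.sum_mul_sum]
      refine Finset.sum_congr rfl fun a _ => Finset.sum_congr rfl fun b _ => ?_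
      ring
    rw [seriesMul, Finset.sum_congr rfl this, Finset.sum_comm]
    refine Finset.sum_congr rfl fun a _ => ?_
    rw [Finset.sum_comm]
    refine Finset.sum_congr rfl fun b _ => ?_
    rw [seriesPow_add, seriesMul, Finset.mul_sum]
  rw [h₁, seriesEval, ← Finset.sum_product']
  -- Terms with `x.1 + x.2 > |w|` vanish at `w`, so only the antidiagonals below `n` remain, and
  -- these give the coefficients of `p * q`.
  have h₂ : ∑ x ∈ Finset.range n ×ˢ Finset.range n,
      PowerSeries.coeff x.1 p * PowerSeries.coeff x.2 q * seriesPow g (x.1 + x.2) w =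
      ∑ x ∈ Finset.range n ×ˢ Finset.range n with x.1 + x.2 ∈ Finset.range n,
      PowerSeries.coeff x.1 p * PowerSeries.coeff x.2 q * seriesPow g (x.1 + x.2) w := by
    symm
    refine Finset.sum_filter_of_ne fun x _ hx => ?_
    by_contra h
    rw [seriesPow_eq_zero hg (by simp at h; omega), mul_zero] at hx
    exact hx rfl
  rw [h₂, ← Finset.sum_fiberwise_of_maps_to (g := fun x : ℕ × ℕ => x.1 + x.2)
    (t := Finset.range n) (fun x hx => (Finset.mem_filter.1 hx).2)]
  refine Finset.sum_congr rfl fun k hk => ?_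
  rw [PowerSeries.coeff_mul, Finset.sum_mul]
  refine Finset.sum_congr ?_ fun x hx => ?_
  · ext x
    simp only [Finset.HasAntidiagonal.mem_antidiagonal, Finset.mem_filter, Finset.mem_product,
      Finset.mem_range] at hk ⊢
    omega
  · rw [(Finset.mem_filter.1 hx).2]

theorem seriesEval_one (g : List ℕ+ → ℝ) : seriesEval g 1 = seriesPow g 0 := by
  funext w
  rw [seriesEval, Finset.sum_eq_single 0]
  · simp
  · intro k _ hk
    simp [PowerSeries.coeff_one, hk]
  · simp

theorem seriesEval_pow {g : List ℕ+ → ℝ} (hg : g [] = 0) (p : PowerSeries ℝ) (k : ℕ) :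
    seriesEval g (p ^ k) = seriesPow (seriesEval g p) k := by
  induction k with
  | zero => rw [pow_zero, seriesEval_one g]; rfl
  | succ k ih => rw [pow_succ', seriesEval_mul hg, ih, seriesPow]

theorem seriesEval_one_add_X {g : List ℕ+ → ℝ} (hg : g [] = 0) (w : List ℕ+) :
    seriesEval g (1 + PowerSeries.X) w = seriesPow g 0 w + g w := by
  rw [seriesEval_eq hg _ (n := w.length + 2) (by omega), Finset.sum_range_succ',
    Finset.sum_range_succ', Finset.sum_eq_zero fun k _ => ?_]
  · simp [seriesPow_one, PowerSeries.coeff_X, add_comm]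
  · simp [PowerSeries.coeff_X, PowerSeries.coeff_one]

/-- The composite `F` satisfies `(1 + X) F' = F` and `F(0) = 1`. Comparing coefficients gives `F_1 =
1` and then `F_n = 0` for `n ≥ 2`. -/
theorem exp_subst_log :
    (PowerSeries.exp ℝ).subst (PowerSeries.log ℝ) = (1 + PowerSeries.X : PowerSeries ℝ) := by
  set F : PowerSeries ℝ := (PowerSeries.exp ℝ).subst (PowerSeries.log ℝ) with hF
  have hd : PowerSeries.derivative ℝ F = F * PowerSeries.derivative ℝ (PowerSeries.log ℝ) := by
    rw [hF, PowerSeries.derivative_subst PowerSeries.HasSubst.log, PowerSeries.derivative_exp]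
  have hl : PowerSeries.derivative ℝ (PowerSeries.log ℝ) * (1 + PowerSeries.X) = 1 := by
    rw [PowerSeries.deriv_log]
    ext n
    rw [mul_add, mul_one, map_add]
    cases n with
    | zero => simp
    | succ n => simp [PowerSeries.coeff_succ_mul_X, PowerSeries.coeff_one, pow_succ]
  have hF' : PowerSeries.derivative ℝ F * (1 + PowerSeries.X) = F := by
    rw [hd, mul_assoc, hl, mul_one]
  have h0 : PowerSeries.coeff 0 F = 1 := by
    rw [hF, PowerSeries.coeff_subst' PowerSeries.HasSubst.log, finsum_eq_single _ 0]
    · simp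
    · intro k hk
      simp [hk]
  have hrec : ∀ n, PowerSeries.coeff (n + 1) F * (n + 1) + PowerSeries.coeff n F * n =
      PowerSeries.coeff n F := by
    intro n
    conv_rhs => rw [← hF', mul_add, mul_one, map_add, PowerSeries.coeff_derivative]
    cases n with
    | zero => simp
    | succ n => rw [PowerSeries.coeff_succ_mul_X, PowerSeries.coeff_derivative]; push_cast; ring
  have h1 : PowerSeries.coeff 1 F = 1 := by
    have := hrec 0
    simp only [Nat.cast_zero, zero_add, mul_one, mul_zero, add_zero] at this
    rw [this, h0]
  have h2 : ∀ n, PowerSeries.coeff (n + 2) F = 0 := by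
    intro n
    induction n with
    | zero =>
      have := hrec 1
      simp only [h1] at this
      norm_num at this ⊢
      exact this
    | succ n ih =>
      have := hrec (n + 2)
      rw [ih, zero_mul, add_zero] at this
      rcases mul_eq_zero.1 this with h | h
      · exact h
      · exact absurd h (by positivity)
  ext n
  match n with
  | 0 => simp [h0]
  | 1 => simp [h1, PowerSeries.coeff_one]
  | n + 2 => simp [h2, PowerSeries.coeff_one, PowerSeries.coeff_X]

theorem seriesLog_eq_eval (f : List ℕ+ → ℝ) :
    seriesLog f = seriesEval (f - seriesPow 0 0) (PowerSeries.log ℝ) := by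
  funext w
  rw [seriesLog, seriesEval, Finset.range_eq_Ico,
    Finset.sum_eq_sum_Ico_succ_bot (Nat.succ_pos _)]
  simp only [PowerSeries.coeff_log, if_true, zero_mul, zero_add]
  refine Finset.sum_congr (by ext k; simp only [Finset.mem_Icc, Finset.mem_Ico]; omega)
    fun k hk => ?_
  have : k ≠ 0 := by simp at hk; omega
  simp [this]

/-- The power series identity `exp_subst_log` is evaluated at `f - 1`, a series without constant
term. -/
theorem seriesExp_seriesLog {f : List ℕ+ → ℝ} (hf : f [] = 1) : seriesExp (seriesLog f) = f := by
  have hg : (f - seriesPow 0 0) [] = 0 := by simp [hf, seriesPow]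
  funext w
  have hw : seriesEval (f - seriesPow 0 0) (1 + PowerSeries.X) w = f w := by
    rw [seriesEval_one_add_X hg]
    simp [seriesPow]
  rw [← hw, seriesExp, seriesLog_eq_eval]
  simp only [← seriesEval_pow hg]
  simp only [seriesEval, Finset.mul_sum]
  rw [Finset.sum_comm]
  refine Finset.sum_congr rfl fun j hj => ?_
  simp only [← mul_assoc]
  rw [← Finset.sum_mul, ← exp_subst_log, PowerSeries.coeff_subst' PowerSeries.HasSubst.log,
    finsum_eq_sum_of_support_subset (s := Finset.range (w.length + 1))]
  · simp
  · intro k hk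
    rw [Finset.coe_range, Set.mem_Iio]
    by_contra hlt
    refine hk ?_
    -- The power series `log` has order 1, so its `k`-th power has no coefficient below `k`; this
    -- truncates the sum over `k` at `|w|`.
    have : PowerSeries.coeff j (PowerSeries.log ℝ ^ k) = 0 := by
      refine PowerSeries.coeff_of_lt_order _ ?_
      have h1 : (k : ℕ∞) ≤ (PowerSeries.log ℝ ^ k).order := by
        refine le_trans ?_ (PowerSeries.le_order_pow _ _)
        rw [PowerSeries.order_log]
        simp
      refine lt_of_lt_of_le ?_ h1
      simp at hj
      exact_mod_cast (by omega : j < k)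
    simp [this]

end

end HallFrame

namespace HallFrame

noncomputable section

/-! ## Shuffle characters and their logarithms -/

/-- The linear extension of a formal series to shuffles of two words. -/
def shuffleSum (f : List ℕ+ → ℝ) (x y : List ℕ+) : ℝ := ((shuffle x y).map f).sum

/-- Formal series which are multiplicative for the shuffle product. -/
def IsShuffleChar (f : List ℕ+ → ℝ) : Prop := ∀ x y, shuffleSum f x y = f x * f y

theorem IsShuffleChar.mul {f g : List ℕ+ → ℝ} (hf : IsShuffleChar f) (hg : IsShuffleChar g) :
    IsShuffleChar (seriesMul f g) := by
  intro x y
  have h := shuffle_cutSum x y fun p q => f p * g q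
  have e : ∀ x₁ x₂ y₁ y₂ : List ℕ+,
      ((shuffle x₁ y₁).map fun p => ((shuffle x₂ y₂).map fun q => f p * g q).sum).sum =
        (f x₁ * g x₂) * (f y₁ * g y₂) := by
    intro x₁ x₂ y₁ y₂
    simp only [Multiset.sum_map_mul_left, Multiset.sum_map_mul_right]
    have h₁ := hf x₁ y₁
    have h₂ := hg x₂ y₂
    rw [shuffleSum] at h₁ h₂
    rw [h₁, h₂]
    ring
  simp only [e] at h
  refine h.trans ?_
  simp only [cutSum, seriesMul, ← Finset.mul_sum, ← Finset.sum_mul]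

theorem isShuffleChar_one : IsShuffleChar (seriesPow 0 0) := by
  intro x y
  cases x with
  | nil => simp [shuffleSum, seriesPow]
  | cons a x =>
    have : ∀ w ∈ shuffle (a :: x) y, seriesPow 0 0 w = 0 := by
      intro w hw
      have := (shuffle_perm hw).length_eq
      have : w ≠ [] := by rintro rfl; simp at this
      simp [seriesPow, this]
    rw [shuffleSum, Multiset.map_congr rfl this]
    simp [seriesPow]

theorem IsShuffleChar.pow {f : List ℕ+ → ℝ} (hf : IsShuffleChar f) (k : ℕ) :
    IsShuffleChar (seriesPow f k) := by
  induction k with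
  | zero => exact isShuffleChar_one
  | succ k ih => exact hf.mul ih

/-- The powers `f ^ m` of a formal series with constant term `1`, as polynomials in `m`. -/
def powerPoly (f : List ℕ+ → ℝ) (w : List ℕ+) : Polynomial ℝ :=
  ∑ k ∈ Finset.range (w.length + 1),
    Polynomial.C (seriesPow (f - seriesPow 0 0) k w / k.factorial) * descPochhammer ℝ k

/-- This is the binomial series of `f = 1 + g`: the falling factorial of `m` divided by `k!` is the
binomial coefficient in front of `g ^ k`. -/
theorem powerPoly_eval {f : List ℕ+ → ℝ} (hf : f [] = 1) (w : List ℕ+) (m : ℕ) :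
    (powerPoly f w).eval (m : ℝ) = seriesPow f m w := by
  have hg : (f - seriesPow 0 0) [] = 0 := by simp [hf, seriesPow]
  have h : seriesEval (f - seriesPow 0 0) (1 + PowerSeries.X) = f := by
    funext w
    rw [seriesEval_one_add_X hg]
    simp [seriesPow]
  conv_rhs => rw [← h, ← seriesEval_pow hg]
  rw [seriesEval, powerPoly, Polynomial.eval_finsetSum]
  refine Finset.sum_congr rfl fun k _ => ?_
  have hc : PowerSeries.coeff k ((1 + PowerSeries.X : PowerSeries ℝ) ^ m) = m.choose k := by
    have := Polynomial.coeff_one_add_X_pow ℝ m k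
    rw [← this, ← Polynomial.coeff_coe]
    simp
  rw [hc, Polynomial.eval_mul, Polynomial.eval_C, descPochhammer_eval_eq_descFactorial,
    Nat.descFactorial_eq_factorial_mul_choose]
  have : (k.factorial : ℝ) ≠ 0 := by exact_mod_cast k.factorial_ne_zero
  push_cast
  field_simp

theorem descPochhammer_derivative_zero (k : ℕ) :
    (Polynomial.derivative (descPochhammer ℝ (k + 1))).eval 0 = (-1) ^ k * (k.factorial : ℝ) := by
  rw [descPochhammer_succ_left, Polynomial.derivative_mul, Polynomial.derivative_X]
  simp only [Polynomial.eval_add, Polynomial.eval_mul, Polynomial.eval_one, Polynomial.eval_X,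
    one_mul, zero_mul, add_zero, Polynomial.eval_comp, Polynomial.eval_sub, zero_sub]
  induction k with
  | zero => simp
  | succ k ih =>
    rw [descPochhammer_succ_right, Polynomial.eval_mul, ih, Nat.factorial_succ]
    simp
    ring

/-- As a polynomial in `m`, the binomial coefficient "m over k" has linear coefficient `(-1)^(k+1) /
k`. Thus the logarithm is the derivative of `f ^ m` at `m = 0`. -/
theorem powerPoly_derivative_eval (f : List ℕ+ → ℝ) (w : List ℕ+) :
    (Polynomial.derivative (powerPoly f w)).eval 0 = seriesLog f w := by
  rw [powerPoly, seriesLog, Finset.range_eq_Ico,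
    Finset.sum_eq_sum_Ico_succ_bot (Nat.succ_pos _), Polynomial.derivative_add,
    Polynomial.derivative_sum, Polynomial.eval_add, Polynomial.eval_finsetSum]
  simp only [descPochhammer_zero, mul_one, Polynomial.derivative_C, Polynomial.eval_zero, zero_add]
  refine Finset.sum_congr (by ext k; simp only [Finset.mem_Icc, Finset.mem_Ico]; omega)
    fun k hk => ?_
  obtain ⟨k, rfl⟩ : ∃ j, k = j + 1 := ⟨k - 1, by simp at hk; omega⟩
  rw [Polynomial.derivative_C_mul, Polynomial.eval_mul, Polynomial.eval_C,
    descPochhammer_derivative_zero, Nat.factorial_succ]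
  have : (k.factorial : ℝ) ≠ 0 := by exact_mod_cast k.factorial_ne_zero
  push_cast
  field_simp
  ring

theorem powerPoly_eval_zero {f : List ℕ+ → ℝ} (hf : f [] = 1) {w : List ℕ+} (hw : w ≠ []) :
    (powerPoly f w).eval 0 = 0 := by
  have := powerPoly_eval hf w 0
  simpa [seriesPow, hw] using this

/-- The logarithm of a shuffle character vanishes on proper shuffles. -/
theorem IsShuffleChar.shuffleSum_seriesLog {f : List ℕ+ → ℝ} (hf : IsShuffleChar f)
    (hf₁ : f [] = 1) {x y : List ℕ+} (hx : x ≠ []) (hy : y ≠ []) :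
    shuffleSum (seriesLog f) x y = 0 := by
  have hev : ∀ (M : Multiset (List ℕ+)) (t : ℝ), (M.map (powerPoly f)).sum.eval t =
      (M.map fun w => (powerPoly f w).eval t).sum := by
    intro M t
    induction M using Multiset.induction_on with
    | empty => simp
    | cons w M ih => simp [ih]
  have hder : ∀ M : Multiset (List ℕ+),
      (Polynomial.derivative (M.map (powerPoly f)).sum).eval 0 = (M.map (seriesLog f)).sum := by
    intro M
    induction M using Multiset.induction_on with
    | empty => simp
    | cons w M ih => simp [ih, powerPoly_derivative_eval]
  -- At every natural number `m` this says that `f ^ m` is a shuffle character; polynomials that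
  -- agree at all natural numbers are equal.
  have key : ((shuffle x y).map (powerPoly f)).sum = powerPoly f x * powerPoly f y := by
    refine Polynomial.eq_of_infinite_eval_eq _ _ (Set.infinite_of_injective_forall_mem
      (f := fun n : ℕ => (n : ℝ)) Nat.cast_injective fun n => ?_)
    have := hf.pow n x y
    simp only [Set.mem_ofPred_eq, hev, Polynomial.eval_mul, powerPoly_eval hf₁]
    exact this
  -- In the product rule at 0 each summand contains an undifferentiated factor, and this is zero as
  -- the words are non-empty.
  rw [shuffleSum, ← hder, key, Polynomial.derivative_mul, Polynomial.eval_add, Polynomial.eval_mul,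
    Polynomial.eval_mul, powerPoly_eval_zero hf₁ hx, powerPoly_eval_zero hf₁ hy]
  ring

/-! ## Reversal of words -/

theorem seriesMul_comp_reverse (f g : List ℕ+ → ℝ) :
    seriesMul (f ∘ List.reverse) (g ∘ List.reverse) = seriesMul g f ∘ List.reverse := by
  funext w
  rw [Function.comp, seriesMul_reverse]
  simp only [Function.comp, seriesMul, mul_comm]

/-- Reversal is an anti-automorphism of the algebra of series, and powers of a single series do not
see the order of the factors. -/
theorem seriesPow_comp_reverse (f : List ℕ+ → ℝ) (k : ℕ) :
    seriesPow (f ∘ List.reverse) k = seriesPow f k ∘ List.reverse := by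
  induction k with
  | zero => funext w; simp [seriesPow]
  | succ k ih => rw [seriesPow, ih, seriesMul_comp_reverse, ← seriesPow_succ']

theorem seriesLog_comp_reverse (f : List ℕ+ → ℝ) :
    seriesLog (f ∘ List.reverse) = seriesLog f ∘ List.reverse := by
  have : f ∘ List.reverse - seriesPow 0 0 = (f - seriesPow 0 0) ∘ List.reverse := by
    funext w
    simp [seriesPow]
  funext w
  simp only [Function.comp, seriesLog, this, seriesPow_comp_reverse, List.length_reverse]

/-! ## The coefficients of the universal singular frame -/

/-- The sum of the letters of a word. -/
def weight (l : List ℕ+) : ℕ := (l.map fun k : ℕ+ => (k : ℕ)).sum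

/-- The iterated integrals in closed form, for words read from the outermost integral. -/
def alphaRev : List ℕ+ → ℝ
  | [] => 1
  | k :: l => alphaRev l / (weight (k :: l) : ℝ)

theorem iterInt_reverse (l : List ℕ+) (x : ℝ) :
    iterInt l.reverse x = alphaRev l * x ^ weight l := by
  induction l generalizing x with
  | nil => simp [iterInt, alphaRev, weight]
  | cons k l ih =>
    have : iterInt (k :: l).reverse x =
        ∫ s in (0 : ℝ)..x, iterInt l.reverse s * s ^ ((k : ℕ) - 1) := by
      simp [iterInt]
    have hk : (k : ℕ) - 1 + 1 = k := Nat.sub_add_cancel k.pos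
    have hw : weight l + ((k : ℕ) - 1) + 1 = weight (k :: l) := by
      simp only [weight, List.map_cons, List.sum_cons]
      omega
    rw [this]
    simp only [ih, mul_assoc, ← pow_add]
    rw [intervalIntegral.integral_const_mul, integral_pow, hw, alphaRev, zero_pow (by omega)]
    have hw' : ((weight l + ((k : ℕ) - 1) : ℕ) : ℝ) + 1 = weight (k :: l) := by exact_mod_cast hw
    rw [hw']
    ring

theorem alphaWord_comp_reverse : alphaWord ∘ List.reverse = alphaRev := by
  funext l
  simp [alphaWord, iterInt_reverse]

/-- With `p` and `q` the weights of the two words, every shuffle has weight `p + q`. Splitting by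
the first letter reduces the claim to `(1/p + 1/q) / (p + q) = 1/(p q)`. -/
theorem isShuffleChar_alphaRev : IsShuffleChar alphaRev := by
  intro x y
  induction x generalizing y with
  | nil => simp [shuffleSum, alphaRev]
  | cons a x ihx =>
    induction y with
    | nil => simp [shuffleSum, alphaRev]
    | cons b y ihy =>
      have hpos : ∀ (k : ℕ+) (l : List ℕ+), (weight (k :: l) : ℝ) ≠ 0 := by
        intro k l
        have := k.pos
        simp only [weight, List.map_cons, List.sum_cons]
        exact_mod_cast (by omega)
      have hsum : ∀ (c : ℕ+) (u v : List ℕ+) (n : ℕ),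
          (∀ w ∈ shuffle u v, weight (c :: w) = n) →
          ((shuffle u v).map fun w => alphaRev (c :: w)).sum = shuffleSum alphaRev u v / n := by
        intro c u v n h
        rw [shuffleSum, Multiset.map_congr rfl fun w hw => by rw [alphaRev, h w hw],
          Multiset.sum_map_div]
      have hw : ∀ (u v w : List ℕ+), w ∈ shuffle u v → weight w = weight u + weight v := by
        intro u v w hw
        have := ((shuffle_perm hw).map fun k : ℕ+ => (k : ℕ)).sum_eq
        rwa [List.map_append, List.sum_append] at this
      have hc : ∀ (c : ℕ+) (u : List ℕ+), weight (c :: u) = c + weight u := fun c u => by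
        simp [weight]
      have h₁ := hsum a x (b :: y) (weight (a :: x) + weight (b :: y)) fun w h => by
        rw [hc, hw _ _ _ h, hc a x]; ring
      have h₂ := hsum b (a :: x) y (weight (a :: x) + weight (b :: y)) fun w h => by
        rw [hc, hw _ _ _ h, hc b y]; ring
      rw [shuffleSum, shuffle_cons_cons, Multiset.map_add, Multiset.sum_add, Multiset.map_map,
        Multiset.map_map]
      simp only [Function.comp_def]
      rw [h₁, h₂, ihx, ihy]
      have ha : alphaRev x = alphaRev (a :: x) * weight (a :: x) := by
        rw [alphaRev, div_mul_cancel₀ _ (hpos a x)]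
      have hb : alphaRev y = alphaRev (b :: y) * weight (b :: y) := by
        rw [alphaRev, div_mul_cancel₀ _ (hpos b y)]
      have hne : ((weight (a :: x) + weight (b :: y) : ℕ) : ℝ) ≠ 0 := by
        have := hpos a x
        have h' : weight (a :: x) ≠ 0 := by exact_mod_cast this
        exact_mod_cast (by omega)
      rw [ha, hb, ← add_div, div_eq_iff hne]
      push_cast
      ring

/-- The logarithm of the series of the universal singular frame. -/
def betaWord : List ℕ+ → ℝ := seriesLog alphaWord

theorem alphaWord_nil : alphaWord [] = 1 := by simp [alphaWord, iterInt]

theorem seriesExp_betaWord : seriesExp betaWord = alphaWord := seriesExp_seriesLog alphaWord_nil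

theorem betaWord_nil : betaWord [] = 0 := by simp [betaWord, seriesLog]

theorem betaU_eq : betaU = Forest.extend betaWord := Forest.logMap_extend alphaWord

theorem alphaU_eq_expMap : alphaU = Forest.expMap betaU := by
  rw [betaU_eq, Forest.expMap_extend, seriesExp_betaWord, alphaU]

theorem shuffleSum_betaWord {x y : List ℕ+} (hx : x ≠ []) (hy : y ≠ []) :
    shuffleSum (betaWord ∘ List.reverse) x y = 0 := by
  rw [betaWord, ← seriesLog_comp_reverse, alphaWord_comp_reverse]
  exact isShuffleChar_alphaRev.shuffleSum_seriesLog rfl hx hy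

/-- A series vanishing on proper shuffles vanishes on products of non-empty forests. -/
theorem Forest.extend_mul_eq_zero {f : List ℕ+ → ℝ}
    (hf : ∀ x y, x ≠ [] → y ≠ [] → shuffleSum (f ∘ List.reverse) x y = 0) {u v : Forest ℕ+}
    (hu : u ≠ 1) (hv : v ≠ 1) : Forest.extend f (u * v) = 0 := by
  have hne : ∀ {u : Forest ℕ+}, u ≠ 1 → ∀ w ∈ Forest.lin u, w ≠ [] := by
    rintro u hu w hw rfl
    exact hu ((Forest.size_eq_zero_iff u).1 (Forest.length_of_mem_lin hw).symm)
  rw [Forest.extend_eq, Forest.lin_mul, shuffleM, Multiset.map_bind, Multiset.sum_bind]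
  refine Multiset.sum_eq_zero fun r hr => ?_
  obtain ⟨x, hx, rfl⟩ := Multiset.mem_map.1 hr
  rw [Multiset.map_bind, Multiset.sum_bind]
  refine Multiset.sum_eq_zero fun r hr => ?_
  obtain ⟨y, hy, rfl⟩ := Multiset.mem_map.1 hr
  exact hf x y (hne hu x hx) (hne hv y hy)

theorem betaU_one : betaU 1 = 0 := by
  rw [betaU_eq, Forest.extend_eq]
  simp [betaWord_nil]

theorem Forest.graft_ne_one {A : Type} (a : A) (u : Forest A) : Forest.graft a u ≠ 1 := by
  intro h
  have := congrArg Forest.lin h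
  rw [Forest.lin_graft, Forest.lin_one] at this
  have hm : ([] : List A) ∈ (Forest.lin u).map (a :: ·) := by rw [this]; simp
  simp at hm

theorem betaU_eq_zero {u : Forest ℕ+} (hu : ¬ u.IsTree) : betaU u = 0 := by
  induction u using Quotient.inductionOn with | _ u
  cases u with
  | nil => exact betaU_one
  | cons a c r =>
    let C : Forest ℕ+ := Quotient.mk _ c
    let R : Forest ℕ+ := Quotient.mk _ r
    change ¬ (Forest.graft a C * R).IsTree at hu
    change betaU (Forest.graft a C * R) = 0
    by_cases hr : R = 1
    · exact absurd ⟨a, C, by rw [hr, mul_one]⟩ hu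
    · rw [betaU_eq]
      exact Forest.extend_mul_eq_zero (fun _ _ => shuffleSum_betaWord) (Forest.graft_ne_one a _) hr

end

end HallFrame

namespace HallFrame

noncomputable section

/-! ## Lyndon words -/

section Lex

variable {α : Type*} [LinearOrder α]

theorem list_lt_append {u v : List α} (hv : v ≠ []) : u < u ++ v := by
  induction u with
  | nil => cases v with
    | nil => exact absurd rfl hv
    | cons a v => exact List.Lex.nil
  | cons a u ih => exact List.Lex.cons ih

theorem list_append_lt_append_left {u v : List α} (h : u < v) (w : List α) : w ++ u < w ++ v := by
  induction w with
  | nil => exact h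
  | cons a w ih => exact List.Lex.cons ih

/-- A word is smaller than another one if it is a proper prefix, or smaller at the first
difference; in the latter case the order is not affected by appending words. -/
theorem list_lt_cases {u v : List α} (h : u < v) :
    (∃ w, w ≠ [] ∧ v = u ++ w) ∨ ∀ x y, u ++ x < v ++ y := by
  induction h with
  | nil => exact Or.inl ⟨_, List.cons_ne_nil _ _, rfl⟩
  | cons _ ih =>
    rcases ih with ⟨w, hw, rfl⟩ | h
    · exact Or.inl ⟨w, hw, rfl⟩
    · exact Or.inr fun x y => List.Lex.cons (h x y)
  | rel h => exact Or.inr fun x y => List.Lex.rel h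

/-- Lyndon words over a linearly ordered alphabet. -/
def Lyndon (w : List α) : Prop :=
  w ≠ [] ∧ ∀ u v, u ≠ [] → v ≠ [] → w = u ++ v → w < v

/-- If `v = u w`, then `v < w` and so `u v < u w = v`; otherwise the first difference of `u` and `v`
decides. -/
theorem Lyndon.append_lt {u v : List α} (hu : u ≠ []) (hv : Lyndon v) (h : u < v) :
    u ++ v < v := by
  rcases list_lt_cases h with ⟨w, hw, rfl⟩ | h
  · exact list_append_lt_append_left (hv.2 u w hu hw rfl) u
  · simpa using h v []

/-- A proper suffix of `u v` is either a suffix of `v`, hence at least `v > u v`, or of the form `q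
v` with `q` a proper suffix of `u`. In the second case `u < q`, and `u` is too long to be a prefix
of `q`, so `u v < q v`. -/
theorem Lyndon.append {u v : List α} (hu : Lyndon u) (hv : Lyndon v) (h : u < v) :
    Lyndon (u ++ v) := by
  have huv := hv.append_lt hu.1 h
  refine ⟨by simp [hu.1], fun p w hp hw heq => ?_⟩
  rcases List.append_eq_append_iff.1 heq with ⟨q, rfl, rfl⟩ | ⟨q, rfl, rfl⟩
  · by_cases hq : q = []
    · subst hq; simpa using huv
    · exact huv.trans (hv.2 q w hq hw rfl)
  · by_cases hq : q = []
    · subst hq; simpa using huv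
    · rcases list_lt_cases (hu.2 p q hp hq rfl) with ⟨w, hw, h⟩ | h
      · have h := congrArg List.length h
        simp only [List.length_append] at h
        have := List.length_pos_iff.2 hp
        omega
      · exact h v v

/-- The longest proper Lyndon suffix is the smallest proper suffix. -/
theorem Lyndon.le_of_suffix {u v : List α} (hv : Lyndon v)
    (hlong : ∀ p x, p ≠ [] → u ++ v = p ++ x → Lyndon x → x.length ≤ v.length)
    (p x : List α) (hp : p ≠ []) (hx : x ≠ []) (h : u ++ v = p ++ x) : v ≤ x := by
  induction hn : x.length using Nat.strong_induction_on generalizing p x with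
  | _ n ih =>
    -- A Lyndon `x` is no longer than `v`, so it is a suffix of the Lyndon word `v`. Any other `x`
    -- has a proper suffix that is at most `x`, to which the induction on length applies.
    by_cases hL : Lyndon x
    · have hl := hlong p x hp h hL
      rcases List.append_eq_append_iff.1 h with ⟨q, rfl, rfl⟩ | ⟨q, rfl, rfl⟩
      · by_cases hq : q = []
        · subst hq; simp
        · exact (hv.2 q x hq hx rfl).le
      · have : q = [] := by
          rw [List.length_append] at hl
          exact List.length_eq_zero_iff.1 (by omega)
        subst this
        simp
    · simp only [Lyndon, not_and, not_forall] at hL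
      obtain ⟨q, y, hq, hy, rfl, hlt⟩ := hL hx
      have hlen := List.length_pos_iff.2 hq
      refine le_trans (ih y.length ?_ (p ++ q) y (by simp [hp]) hy (by simpa using h) rfl)
        (not_lt.1 hlt)
      rw [← hn, List.length_append]
      omega

end Lex

/-- A word as an element of the lexicographically ordered words with `f_n < f_m` for `n > m`. -/
def dualWord (w : List ℕ+) : List ℕ+ᵒᵈ := w

/-! ### Standard decompositions of Lyndon words -/

namespace Bracket

/-- The foliage as an element of the ordered set of words. -/
def key (t : Bracket) : List ℕ+ᵒᵈ := dualWord t.foliage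

theorem key_pair (s t : Bracket) : (pair s t).key = s.key ++ t.key := rfl

theorem key_ne_nil (t : Bracket) : t.key ≠ [] := by
  induction t with
  | letter n => exact List.cons_ne_nil _ _
  | pair s t ih _ => rw [key_pair]; simp [ih]

theorem isHall_pair {s t : Bracket} : (pair s t).IsHall ↔ s.IsHall ∧ t.IsHall ∧
    Lyndon (s.key ++ t.key) ∧ ∀ u v, u ≠ [] → s.key ++ t.key = u ++ v → Lyndon v →
      v.length ≤ t.key.length := Iff.rfl

theorem IsHall.lyndon {t : Bracket} (h : t.IsHall) : Lyndon t.key := by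
  cases t with
  | letter n =>
    refine ⟨key_ne_nil _, fun u v hu hv h => ?_⟩
    have h := congrArg List.length h
    rw [List.length_append] at h
    have h' : (letter n).key.length = 1 := rfl
    have := List.length_pos_iff.2 hu
    have := List.length_pos_iff.2 hv
    omega
  | pair s t => exact (isHall_pair.1 h).2.2.1

theorem IsHall.pair_lt {s t : Bracket} (h : (pair s t).IsHall) : (pair s t).key < t.key :=
  (isHall_pair.1 h).2.2.1.2 s.key t.key (key_ne_nil s) (key_ne_nil t) rfl

theorem IsHall.left_lt_pair {s t : Bracket} : s.key < (pair s t).key :=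
  list_lt_append (key_ne_nil t)

theorem IsHall.left_lt_right {s t : Bracket} (h : (pair s t).IsHall) : s.key < t.key :=
  left_lt_pair.trans h.pair_lt

/-- If `s < t`, then `s t` would be a Lyndon suffix longer than `t`. -/
theorem IsHall.le_right {r s t : Bracket} (h : (pair (pair r s) t).IsHall) : t.key ≤ s.key := by
  by_contra hlt
  obtain ⟨h₁, h₂, h₃, h₄⟩ := isHall_pair.1 h
  have hs := (isHall_pair.1 h₁).2.1.lyndon
  have := h₄ r.key (s.key ++ t.key) (key_ne_nil r) (by rw [key_pair, List.append_assoc])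
    (hs.append h₂.lyndon (not_le.1 hlt))
  rw [List.length_append] at this
  have := List.length_pos_iff.2 (key_ne_nil s)
  omega

/-- Hall trees are built from letters by pairing `s < t`, where `s` is a letter or its second part
is at least `t`. -/
theorem IsHall.pair {s t : Bracket} (hs : s.IsHall) (ht : t.IsHall) (hlt : s.key < t.key)
    (h : ∀ s₁ s₂, s = Bracket.pair s₁ s₂ → t.key ≤ s₂.key) : (Bracket.pair s t).IsHall := by
  refine isHall_pair.2 ⟨hs, ht, hs.lyndon.append ht.lyndon hlt, fun u x hu heq hx => ?_⟩
  by_contra hlen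
  rcases List.append_eq_append_iff.1 heq with ⟨q, -, hq⟩ | ⟨p, hp, rfl⟩
  · rw [hq, List.length_append] at hlen
    omega
  · have hp0 : p ≠ [] := by
      rintro rfl
      simp at hlen
    -- A Lyndon suffix longer than `t` has the form `p t`, so `p t < t`. But `p` is a suffix of the
    -- composite tree `s = (s₁, s₂)`, whence `t ≤ s₂ ≤ p < p t`.
    have hpt : p ++ t.key < t.key := hx.2 p t.key hp0 (key_ne_nil t) rfl
    have hle : t.key ≤ p := by
      cases s with
      | letter n =>
        have h := congrArg List.length hp
        rw [List.length_append] at h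
        have h' : (letter n).key.length = 1 := rfl
        have := List.length_pos_iff.2 hu
        have := List.length_pos_iff.2 hp0
        omega
      | pair s₁ s₂ =>
        obtain ⟨_, h₂, _, h₄⟩ := isHall_pair.1 hs
        exact (h s₁ s₂ rfl).trans (h₂.lyndon.le_of_suffix h₄ u p hu hp0 hp)
    exact lt_irrefl _ ((hle.trans_lt (list_lt_append (key_ne_nil t))).trans hpt)

/-- Each right factor is a Lyndon proper suffix of the common word, and each is a longest one. So
they have the same length, and the factorizations agree. -/
theorem IsHall.eq_of_key_eq {s t : Bracket} (hs : s.IsHall) (ht : t.IsHall) (h : s.key = t.key) :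
    s = t := by
  have hlen : ∀ (n : ℕ+) (s t : Bracket), (letter n).key ≠ (Bracket.pair s t).key := by
    intro n s t h
    have h := congrArg List.length h
    rw [key_pair, List.length_append] at h
    have h' : (letter n).key.length = 1 := rfl
    have := List.length_pos_iff.2 (key_ne_nil s)
    have := List.length_pos_iff.2 (key_ne_nil t)
    omega
  induction s generalizing t with
  | letter n =>
    cases t with
    | letter m =>
      have h : [n] = [m] := h
      rw [List.singleton_inj.1 h]
    | pair t₁ t₂ => exact absurd h (hlen _ _ _)
  | pair s₁ s₂ ih₁ ih₂ =>
    cases t with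
    | letter m => exact absurd h.symm (hlen _ _ _)
    | pair t₁ t₂ =>
      rw [key_pair, key_pair] at h
      obtain ⟨a₁, a₂, a₃, a₄⟩ := isHall_pair.1 hs
      obtain ⟨b₁, b₂, b₃, b₄⟩ := isHall_pair.1 ht
      have l₁ := b₄ s₁.key s₂.key (key_ne_nil _) h.symm a₂.lyndon
      have l₂ := a₄ t₁.key t₂.key (key_ne_nil _) h b₂.lyndon
      obtain ⟨e₁, e₂⟩ := List.append_inj' h (le_antisymm l₁ l₂)
      rw [ih₁ a₁ b₁ e₁, ih₂ a₂ b₂ e₂]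

end Bracket

/-! ## The ordered set of Hall trees -/

namespace HallTree

instance instLinearOrder : LinearOrder HallTree where
  le s t := s.1.key ≤ t.1.key
  lt s t := s.1.key < t.1.key
  le_refl _ := le_rfl
  le_trans _ _ _ := le_trans
  lt_iff_le_not_ge _ _ := lt_iff_le_not_ge
  le_antisymm s t h h' := Subtype.ext (s.2.eq_of_key_eq t.2 (le_antisymm h h'))
  le_total s t := le_total s.1.key t.1.key
  toDecidableLE s t := inferInstanceAs (Decidable (s.1.key ≤ t.1.key))
  toDecidableLT s t := inferInstanceAs (Decidable (s.1.key < t.1.key))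
  toDecidableEq := inferInstance

theorem lt_iff {s t : HallTree} : s < t ↔ s.1.key < t.1.key := Iff.rfl

theorem le_iff {s t : HallTree} : s ≤ t ↔ s.1.key ≤ t.1.key := Iff.rfl

theorem not_wordLT_iff {s t : HallTree} : ¬ wordLT s.1.foliage t.1.foliage ↔ t ≤ s :=
  not_lt (α := List ℕ+ᵒᵈ)

/-- The letters of a Hall tree. -/
def content (t : HallTree) : Multiset ℕ+ := t.1.foliage

theorem content_ne_zero (t : HallTree) : t.content ≠ 0 :=
  fun h => t.1.key_ne_nil (Multiset.coe_eq_zero _ |>.1 h)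

/-- Neither the order of Hall trees nor its reverse is well founded. Among the trees with letters in
`M` induction is possible in both directions. -/
theorem finite_setOf_content_le (M : Multiset ℕ+) : {t : HallTree | t.content ≤ M}.Finite := by
  have hfin : {l : List ℕ+ | (l : Multiset ℕ+) ≤ M}.Finite := by
    refine (M.powerset.bind fun N => N.lists).toFinset.finite_toSet.subset fun l hl => ?_
    simp only [Finset.mem_coe, Multiset.mem_toFinset, Multiset.mem_bind, Multiset.mem_powerset,
      Multiset.mem_lists_iff]
    exact ⟨l, hl, rfl⟩
  refine Set.Finite.of_finite_image (f := fun t : HallTree => t.1.foliage)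
    (hfin.subset ?_) fun s _ t _ h => Subtype.ext (s.2.eq_of_key_eq t.2 h)
  rintro _ ⟨t, ht, rfl⟩
  exact ht

/-- The Hall tree of a letter. -/
def letter (n : ℕ+) : HallTree := ⟨Bracket.letter n, trivial⟩

/-- The first part of a composite Hall tree. -/
def left {s t : Bracket} (h : (Bracket.pair s t).IsHall) : HallTree :=
  ⟨s, (Bracket.isHall_pair.1 h).1⟩

/-- The second part of a composite Hall tree. -/
def right {s t : Bracket} (h : (Bracket.pair s t).IsHall) : HallTree :=
  ⟨t, (Bracket.isHall_pair.1 h).2.1⟩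

theorem content_pair {s t : Bracket} (h : (Bracket.pair s t).IsHall) :
    content ⟨Bracket.pair s t, h⟩ = content (left h) + content (right h) :=
  (Multiset.coe_add _ _).symm

/-! ### Hall polynomials span the free Lie algebra -/

variable (K : Type*) [Field K]

/-- The elements `E(t)` of the free Lie algebra. -/
def lie (t : HallTree) : FreeLieAlgebra K ℕ+ := t.1.hallPoly K

theorem lie_pair {s t : Bracket} (h : (Bracket.pair s t).IsHall) :
    lie K ⟨Bracket.pair s t, h⟩ = ⁅lie K (right h), lie K (left h)⁆ := rfl

/-- The span of the `E(h)` for the Hall trees `h < t` with letters `M`. -/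
def spanLT (M : Multiset ℕ+) (t : HallTree) : Submodule K (FreeLieAlgebra K ℕ+) :=
  Submodule.span K (lie K '' {h | h < t ∧ h.content = M})

theorem spanLT_mono {M : Multiset ℕ+} {s t : HallTree} (h : s ≤ t) : spanLT K M s ≤ spanLT K M t :=
  Submodule.span_mono (Set.image_mono fun _ hx => ⟨hx.1.trans_le h, hx.2⟩)

theorem lie_mem_of_mem_span {L : Type*} [LieRing L] [LieAlgebra K L] {S : Set L}
    {N : Submodule K L} {x y : L} (hx : x ∈ Submodule.span K S) (h : ∀ s ∈ S, ⁅s, y⁆ ∈ N) :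
    ⁅x, y⁆ ∈ N := by
  induction hx using Submodule.span_induction with
  | mem x hx => exact h x hx
  | zero => simp
  | add x x' _ _ hx hx' => rw [add_lie]; exact N.add_mem hx hx'
  | smul c x _ hx => rw [smul_lie]; exact N.smul_mem c hx

/-- Straightening in the free Lie algebra. -/
theorem lie_mem_spanLT {s t : HallTree} (hst : s < t) :
    ⁅lie K t, lie K s⁆ ∈ spanLT K (s.content + t.content) t := by
  generalize hM : s.content + t.content = M
  -- Outer induction on the number of letters, inner induction on the larger tree `t` among the
  -- finitely many trees with letters in `M`.
  induction hn : Multiset.card M using Nat.strong_induction_on generalizing M s t with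
  | _ n ihn =>
    have htM : t ∈ {t : HallTree | t.content ≤ M} := by
      rw [← hM]; exact Set.mem_ofPred.2 (Multiset.le_add_left _ _)
    revert s
    refine (finite_setOf_content_le M).wellFoundedOn.induction (r := (· < ·))
      (P := fun t => ∀ {s : HallTree}, s < t → s.content + t.content = M →
        ⁅lie K t, lie K s⁆ ∈ spanLT K M t) htM fun t _ iht s hst hM => ?_
    -- A bracket of two trees below `t` is covered by the inner induction at the larger of the two,
    -- up to sign.
    have key : ∀ x y : HallTree, x < t → y < t → x.content + y.content = M →
        ⁅lie K x, lie K y⁆ ∈ spanLT K M t := by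
      intro x y hx hy hxy
      rcases lt_trichotomy x y with h | rfl | h
      · rw [← lie_skew]
        exact Submodule.neg_mem _ (spanLT_mono K hy.le
          (iht y (by rw [← hxy]; exact Set.mem_ofPred.2 (Multiset.le_add_left _ _)) hy h hxy))
      · simp
      · exact spanLT_mono K hx.le (iht x (by rw [← hxy]; exact Set.mem_ofPred.2 (Multiset.le_add_right _ _)) hx h
          (by rw [add_comm, hxy]))
    by_cases hH : (Bracket.pair s.1 t.1).IsHall
    · exact Submodule.subset_span ⟨⟨_, hH⟩, ⟨hH.pair_lt, by rw [content_pair]; exact hM⟩, rfl⟩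
    · have hs : ∃ s₁ s₂, s.1 = Bracket.pair s₁ s₂ ∧ s₂.key < t.1.key := by
        by_contra hcon
        push Not at hcon
        exact hH (Bracket.IsHall.pair s.2 t.2 hst hcon)
      obtain ⟨⟨_, hsH⟩, s₁, s₂, rfl, hs₂⟩ : ∃ s' : HallTree, ∃ s₁ s₂, s'.1 = Bracket.pair s₁ s₂ ∧
        s₂.key < t.1.key ∧ s' = s := by
          obtain ⟨s₁, s₂, h₁, h₂⟩ := hs
          exact ⟨s, s₁, s₂, h₁, h₂, rfl⟩
      obtain ⟨hs₂, rfl⟩ := hs₂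
      set a := left hsH
      set b := right hsH
      have hbt : b < t := hs₂
      have hab : a < b := hsH.left_lt_right
      have hat := hab.trans hbt
      rw [content_pair] at hM
      have ha := Multiset.card_pos.2 a.content_ne_zero
      have hb := Multiset.card_pos.2 b.content_ne_zero
      have hn' : Multiset.card a.content + Multiset.card b.content + Multiset.card t.content = n := by
        rw [← hn, ← hM, Multiset.card_add, Multiset.card_add]
      have h₁ := ihn _ (by rw [Multiset.card_add]; omega) hbt _ rfl rfl
      have h₂ := ihn _ (by rw [Multiset.card_add]; omega) hat _ rfl rfl
      -- Here `s = (a, b)` with `a < b < t`, and Jacobi gives `[t,[b,a]] = [[t,b],a] + [b,[t,a]]`.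
      -- By the outer induction `[t,b]` and `[t,a]` are combinations of `E(h)` with `h < t`, so
      -- `key` applies to what remains.
      rw [lie_pair, leibniz_lie]
      refine Submodule.add_mem _ (lie_mem_of_mem_span K h₁ ?_) ?_
      · rintro _ ⟨h, ⟨hht, hhc⟩, rfl⟩
        exact key h a hht hat (by rw [hhc, ← hM]; abel)
      · rw [← lie_skew]
        refine Submodule.neg_mem _ (lie_mem_of_mem_span K h₂ ?_)
        rintro _ ⟨h, ⟨hht, hhc⟩, rfl⟩
        exact key h b hht hbt (by rw [hhc, ← hM]; abel)

theorem lie_mem_span (s t : HallTree) :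
    ⁅lie K s, lie K t⁆ ∈ Submodule.span K (Set.range (lie K)) := by
  have h : ∀ (M : Multiset ℕ+) (t : HallTree), spanLT K M t ≤ Submodule.span K (Set.range (lie K)) :=
    fun M t => Submodule.span_mono (Set.image_subset_range _ _)
  rcases lt_trichotomy s t with hst | rfl | hst
  · rw [← lie_skew]
    exact Submodule.neg_mem _ (h _ _ (lie_mem_spanLT K hst))
  · simp
  · exact h _ _ (lie_mem_spanLT K hst)

/-- By `lie_mem_span` the span is a Lie subalgebra. It contains the generators, so freeness provides
a map into it whose composition with the inclusion is the identity. -/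
theorem span_range_lie : Submodule.span K (Set.range (lie K)) = ⊤ := by
  set N := Submodule.span K (Set.range (lie K)) with hN
  have hlie : ∀ {x y : FreeLieAlgebra K ℕ+}, x ∈ N → y ∈ N → ⁅x, y⁆ ∈ N := by
    intro x y hx hy
    refine lie_mem_of_mem_span K hx ?_
    rintro _ ⟨s, rfl⟩
    rw [← lie_skew]
    refine Submodule.neg_mem _ (lie_mem_of_mem_span K hy ?_)
    rintro _ ⟨t, rfl⟩
    exact lie_mem_span K t s
  let B : LieSubalgebra K (FreeLieAlgebra K ℕ+) := { N with lie_mem' := hlie }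
  let f : FreeLieAlgebra K ℕ+ →ₗ⁅K⁆ B :=
    FreeLieAlgebra.lift K fun n => ⟨FreeLieAlgebra.of K n, Submodule.subset_span ⟨letter n, rfl⟩⟩
  have hf : B.incl.comp f = LieHom.id := by
    refine FreeLieAlgebra.hom_ext fun n => ?_
    simp [f]
  rw [eq_top_iff]
  intro x _
  have := LieHom.congr_fun hf x
  rw [LieHom.id_apply] at this
  rw [← this]
  exact (f x).2

end HallTree

end

end HallFrame

namespace HallFrame

noncomputable section

attribute [local instance] LieRing.ofAssociativeRing

namespace HallTree

variable (K : Type*) [Field K]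

/-! ## Straightening in the free associative algebra -/

/-- The Hall polynomials `E(t)` in the free associative algebra. -/
def assoc (t : HallTree) : FreeAlgebra K ℕ+ := lieToAssoc K (t.lie K)

theorem assoc_letter (n : ℕ+) : assoc K (letter n) = FreeAlgebra.ι K n :=
  FreeLieAlgebra.lift_of_apply _ _

theorem assoc_pair {s t : Bracket} (h : (Bracket.pair s t).IsHall) :
    assoc K ⟨Bracket.pair s t, h⟩ =
      assoc K (right h) * assoc K (left h) - assoc K (left h) * assoc K (right h) := by
  rw [assoc, lie_pair, LieHom.map_lie, LieRing.of_associative_ring_bracket]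
  rfl

/-- The product of the `E(t)` over a list of Hall trees, from right to left. -/
def polyL (l : List HallTree) : FreeAlgebra K ℕ+ := (l.reverse.map (assoc K)).prod

@[simp] theorem polyL_nil : polyL K [] = 1 := rfl

theorem polyL_cons (t : HallTree) (l : List HallTree) :
    polyL K (t :: l) = polyL K l * assoc K t := by
  simp [polyL]

/-- The letters of a list of Hall trees. -/
def listContent (l : List HallTree) : Multiset ℕ+ := (l.map content).sum

@[simp] theorem listContent_nil : listContent [] = 0 := rfl

@[simp] theorem listContent_cons (t : HallTree) (l : List HallTree) :
    listContent (t :: l) = t.content + listContent l := by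
  simp [listContent]

theorem listContent_perm {l l' : List HallTree} (h : l.Perm l') : listContent l = listContent l' :=
  (h.map content).sum_eq

/-- Products of fewer than `n` Hall polynomials of trees in `Q`. -/
def spanLength (Q : HallTree → Prop) (M : Multiset ℕ+) (n : ℕ) : Submodule K (FreeAlgebra K ℕ+) :=
  Submodule.span K (polyL K '' {l | (∀ t ∈ l, Q t) ∧ listContent l = M ∧ l.length < n})

/-- Products of Hall polynomials of non-increasing sequences of trees in `Q`. -/
def spanSorted (Q : HallTree → Prop) (M : Multiset ℕ+) : Submodule K (FreeAlgebra K ℕ+) :=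
  Submodule.span K (polyL K '' {l | l.Pairwise (· ≥ ·) ∧ (∀ t ∈ l, Q t) ∧ listContent l = M})

theorem map_mem_of_mem_span {V W : Type*} [AddCommGroup V] [Module K V] [AddCommGroup W]
    [Module K W] (f : V →ₗ[K] W) {S : Set V} {N : Submodule K W} {x : V}
    (hx : x ∈ Submodule.span K S) (h : ∀ s ∈ S, f s ∈ N) : f x ∈ N :=
  (Submodule.span_le (p := N.comap f)).2 h hx

variable {Q : HallTree → Prop}

theorem mul_assoc_mem_spanLength {M : Multiset ℕ+} {n : ℕ} {p : FreeAlgebra K ℕ+} {t : HallTree}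
    (ht : Q t) (hp : p ∈ spanLength K Q M n) :
    p * assoc K t ∈ spanLength K Q (t.content + M) (n + 1) := by
  refine map_mem_of_mem_span K (LinearMap.mulRight K (assoc K t)) hp ?_
  rintro _ ⟨l, hl, rfl⟩
  obtain ⟨h₁, h₂, h₃⟩ := Set.mem_ofPred.1 hl
  refine Submodule.subset_span ⟨t :: l, Set.mem_ofPred.2 ⟨?_, ?_, ?_⟩, polyL_cons K t l⟩
  · exact List.forall_mem_cons.2 ⟨ht, h₁⟩
  · simp [h₂]
  · simpa using h₃

/-- By `lie_mem_spanLT` a commutator is a combination of single Hall polynomials of trees below the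
larger of the two, so two factors are replaced by one. It is for these smaller trees that `Q` has to
be closed downwards. -/
theorem mul_commutator_mem_spanLength (hQ : ∀ s t, s ≤ t → Q t → Q s)
    {l : List HallTree} {s t : HallTree} (hl : ∀ t ∈ l, Q t)
    (hs : Q s) (ht : Q t) : polyL K l * (assoc K t * assoc K s - assoc K s * assoc K t) ∈
      spanLength K Q (s.content + t.content + listContent l) (l.length + 2) := by
  have key : ∀ s t : HallTree, s < t → Q t →
      polyL K l * (assoc K t * assoc K s - assoc K s * assoc K t) ∈
      spanLength K Q (s.content + t.content + listContent l) (l.length + 2) := by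
    intro s t hst ht
    have h := map_mem_of_mem_span K
      ((LinearMap.mulLeft K (polyL K l)).comp (lieToAssoc K : _ →ₗ[K] _)) (lie_mem_spanLT K hst)
      (N := spanLength K Q (s.content + t.content + listContent l) (l.length + 2)) ?_
    · have e : lieToAssoc K ⁅lie K t, lie K s⁆ = assoc K t * assoc K s - assoc K s * assoc K t := by
        rw [LieHom.map_lie, LieRing.of_associative_ring_bracket]; rfl
      rw [← e]
      exact h
    · rintro _ ⟨h, hh, rfl⟩
      obtain ⟨h₁, h₂⟩ := Set.mem_ofPred.1 hh
      refine Submodule.subset_span ⟨h :: l, Set.mem_ofPred.2 ⟨?_, ?_, ?_⟩, polyL_cons K h l⟩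
      · exact List.forall_mem_cons.2 ⟨hQ h t h₁.le ht, hl⟩
      · rw [listContent_cons, h₂]
      · simp
  rcases lt_trichotomy s t with h | rfl | h
  · exact key s t h ht
  · simp
  · have := key t s h hs
    rw [add_comm t.content, ← neg_mem_iff, ← mul_neg, neg_sub] at this
    exact this

theorem sub_mem_spanLength_of_perm (hQ : ∀ s t, s ≤ t → Q t → Q s)
    {l l' : List HallTree} (h : l.Perm l') (hl : ∀ t ∈ l, Q t) :
    polyL K l - polyL K l' ∈ spanLength K Q (listContent l) l.length := by
  induction h with
  | nil => simp
  | cons t _ ih =>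
    rw [List.forall_mem_cons] at hl
    rw [polyL_cons, polyL_cons, ← sub_mul, listContent_cons, List.length_cons]
    exact mul_assoc_mem_spanLength K hl.1 (ih hl.2)
  | swap s t l =>
    rw [List.forall_mem_cons, List.forall_mem_cons] at hl
    simp only [polyL_cons, listContent_cons, List.length_cons, mul_assoc, ← mul_sub, ← add_assoc]
    exact mul_commutator_mem_spanLength K hQ hl.2.2 hl.1 hl.2.1
  | trans h₁ h₂ ih₁ ih₂ =>
    have := ih₂ fun t ht => hl t (h₁.mem_iff.2 ht)
    rw [← listContent_perm h₁, ← h₁.length_eq] at this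
    have := Submodule.add_mem _ (ih₁ hl) this
    rwa [sub_add_sub_cancel] at this

/-- Sorting the factors changes the product by products of fewer factors, which the induction on
length covers. The predicate `Q` keeps track of an upper bound for the trees. -/
theorem polyL_mem_spanSorted (hQ : ∀ s t, s ≤ t → Q t → Q s)
    {l : List HallTree} (hl : ∀ t ∈ l, Q t) :
    polyL K l ∈ spanSorted K Q (listContent l) := by
  induction hn : l.length using Nat.strong_induction_on generalizing l with
  | _ n ih =>
    subst hn
    have hperm := (l.perm_insertionSort (· ≥ ·)).symm
    have h₁ : polyL K (l.insertionSort (· ≥ ·)) ∈ spanSorted K Q (listContent l) :=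
      Submodule.subset_span ⟨_, Set.mem_ofPred.2 ⟨l.pairwise_insertionSort (· ≥ ·),
        fun t ht => hl t (hperm.mem_iff.2 ht), (listContent_perm hperm).symm⟩, rfl⟩
    have h₂ : spanLength K Q (listContent l) l.length ≤ spanSorted K Q (listContent l) := by
      refine Submodule.span_le.2 ?_
      rintro _ ⟨l', hl', rfl⟩
      obtain ⟨h₁, h₂, h₃⟩ := Set.mem_ofPred.1 hl'
      rw [← h₂]
      exact ih _ h₃ h₁ rfl
    have := Submodule.add_mem _ (h₂ (sub_mem_spanLength_of_perm K hQ hperm hl)) h₁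
    rwa [sub_add_cancel] at this

end HallTree

end

end HallFrame

namespace HallFrame

noncomputable section

attribute [local instance] LieRing.ofAssociativeRing

/-! ## Coefficients of noncommutative polynomials -/

section Coeff

variable (K : Type*) [Field K]

/-- The monomial of a word read from right to left. -/
def monoRev (w : List ℕ+) : FreeAlgebra K ℕ+ := (w.reverse.map (FreeAlgebra.ι K)).prod

@[simp] theorem monoRev_nil : monoRev K [] = 1 := rfl

theorem monoRev_cons (a : ℕ+) (w : List ℕ+) :
    monoRev K (a :: w) = monoRev K w * FreeAlgebra.ι K a := by
  simp [monoRev]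

theorem basisFreeMonoid_apply (w : List ℕ+) :
    FreeAlgebra.basisFreeMonoid K ℕ+ (FreeMonoid.ofList w) = monoRev K w.reverse := by
  have h : ∀ w : List ℕ+, FreeAlgebra.equivMonoidAlgebraFreeMonoid (w.map (FreeAlgebra.ι K)).prod =
      MonoidAlgebra.single (FreeMonoid.ofList w) (1 : K) := by
    intro w
    induction w with
    | nil => simp [MonoidAlgebra.one_def]
    | cons a w ih =>
      rw [List.map_cons, List.prod_cons, map_mul, ih, FreeMonoid.ofList_cons]
      simp [FreeAlgebra.equivMonoidAlgebraFreeMonoid, MonoidAlgebra.single_mul_single]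
  simp only [FreeAlgebra.basisFreeMonoid, Module.Basis.map_apply, Finsupp.coe_basisSingleOne]
  rw [LinearEquiv.symm_apply_eq, monoRev, List.reverse_reverse, LinearEquiv.trans_apply]
  have := congrArg MonoidAlgebra.coeff (h w)
  rw [MonoidAlgebra.coeff_single] at this
  exact this.symm

/-- The coefficient of a word read from right to left, as a linear form. -/
def coeffRev (w : List ℕ+) : FreeAlgebra K ℕ+ →ₗ[K] K :=
  (FreeAlgebra.basisFreeMonoid K ℕ+).coord (FreeMonoid.ofList w.reverse)

theorem coeffRev_apply (w : List ℕ+) (p : FreeAlgebra K ℕ+) :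
    coeffRev K w p = coeff w.reverse p := rfl

theorem coeffRev_monoRev (w v : List ℕ+) :
    coeffRev K w (monoRev K v) = if w = v then 1 else 0 := by
  rw [← List.reverse_reverse v, ← basisFreeMonoid_apply, coeffRev, Module.Basis.coord_apply,
    Module.Basis.repr_self, List.reverse_reverse]
  by_cases h : w = v
  · subst h; simp
  · rw [if_neg h, Finsupp.single_eq_of_ne]
    exact fun h' => h (List.reverse_injective (FreeMonoid.ofList.injective h'))

theorem coeffRev_one (w : List ℕ+) : coeffRev K w 1 = if w = [] then 1 else 0 :=
  coeffRev_monoRev K w []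

variable {K} in
theorem linearMap_ext_monoRev {W : Type*} [AddCommGroup W] [Module K W]
    {f g : FreeAlgebra K ℕ+ →ₗ[K] W} (h : ∀ w, f (monoRev K w) = g (monoRev K w)) : f = g := by
  refine (FreeAlgebra.basisFreeMonoid K ℕ+).ext fun w => ?_
  have := basisFreeMonoid_apply K w.toList
  rw [FreeMonoid.ofList_toList] at this
  rw [this]
  exact h _

theorem coeffRev_nil_mul (a : ℕ+) (p : FreeAlgebra K ℕ+) :
    coeffRev K [] (p * FreeAlgebra.ι K a) = 0 := by
  have : (coeffRev K []).comp (LinearMap.mulRight K (FreeAlgebra.ι K a)) = 0 := by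
    refine linearMap_ext_monoRev fun w => ?_
    rw [LinearMap.comp_apply, LinearMap.mulRight_apply, ← monoRev_cons, coeffRev_monoRev]
    simp
  exact LinearMap.congr_fun this p

theorem coeffRev_cons_mul (a b : ℕ+) (w : List ℕ+) (p : FreeAlgebra K ℕ+) :
    coeffRev K (a :: w) (p * FreeAlgebra.ι K b) = if a = b then coeffRev K w p else 0 := by
  have : (coeffRev K (a :: w)).comp (LinearMap.mulRight K (FreeAlgebra.ι K b)) =
      if a = b then coeffRev K w else 0 := by
    refine linearMap_ext_monoRev fun v => ?_
    rw [LinearMap.comp_apply, LinearMap.mulRight_apply, ← monoRev_cons, coeffRev_monoRev]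
    by_cases h : a = b <;> simp [h, coeffRev_monoRev]
  rw [← LinearMap.mulRight_apply (R := K), ← LinearMap.comp_apply, this]
  split_ifs <;> rfl

/-- The pairing of polynomials with sums of words, read from right to left. -/
def pairing (M : Multiset (List ℕ+)) : FreeAlgebra K ℕ+ →ₗ[K] K := (M.map (coeffRev K)).sum

theorem pairing_add (M N : Multiset (List ℕ+)) : pairing K (M + N) = pairing K M + pairing K N := by
  simp [pairing]

theorem pairing_nsmul (n : ℕ) (M : Multiset (List ℕ+)) : pairing K (n • M) = n • pairing K M := by
  simp [pairing, Multiset.map_nsmul, Multiset.sum_nsmul]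

theorem pairing_apply (M : Multiset (List ℕ+)) (p : FreeAlgebra K ℕ+) :
    pairing K M p = (M.map fun w => coeffRev K w p).sum := by
  induction M using Multiset.induction_on with
  | empty => simp [pairing]
  | cons w M ih =>
    rw [← Multiset.singleton_add, pairing_add, LinearMap.add_apply, ih]
    simp [pairing]

theorem pairing_map_cons_mul (a b : ℕ+) (M : Multiset (List ℕ+)) (p : FreeAlgebra K ℕ+) :
    pairing K (M.map (a :: ·)) (p * FreeAlgebra.ι K b) = if a = b then pairing K M p else 0 := by
  rw [pairing_apply, pairing_apply, Multiset.map_map]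
  simp only [Function.comp_def, coeffRev_cons_mul]
  split_ifs <;> simp

theorem pairing_map_cons_one (a : ℕ+) (M : Multiset (List ℕ+)) :
    pairing K (M.map (a :: ·)) 1 = 0 := by
  rw [pairing_apply, Multiset.map_map]
  refine Multiset.sum_eq_zero fun x hx => ?_
  obtain ⟨w, _, rfl⟩ := Multiset.mem_map.1 hx
  simp only [Function.comp]
  rw [← monoRev_nil, coeffRev_monoRev, if_neg (List.cons_ne_nil _ _)]

/-! ## The coproduct dual to the shuffle product -/

open scoped TensorProduct

/-- The coproduct for which the generators are primitive. -/
def comul : FreeAlgebra K ℕ+ →ₐ[K] FreeAlgebra K ℕ+ ⊗[K] FreeAlgebra K ℕ+ :=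
  FreeAlgebra.lift K fun a => FreeAlgebra.ι K a ⊗ₜ 1 + 1 ⊗ₜ FreeAlgebra.ι K a

/-- The product of two linear forms, on the tensor square. -/
def pairing₂ (f g : FreeAlgebra K ℕ+ →ₗ[K] K) : FreeAlgebra K ℕ+ ⊗[K] FreeAlgebra K ℕ+ →ₗ[K] K :=
  (LinearMap.mul' K K).comp (TensorProduct.map f g)

@[simp] theorem pairing₂_tmul (f g : FreeAlgebra K ℕ+ →ₗ[K] K) (p q : FreeAlgebra K ℕ+) :
    pairing₂ K f g (p ⊗ₜ q) = f p * g q := by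
  simp [pairing₂]

theorem pairing₂_mul_left (f f' g : FreeAlgebra K ℕ+ →ₗ[K] K) (q : FreeAlgebra K ℕ+) (c : K)
    (h : ∀ p, f (p * q) = c * f' p) (T : FreeAlgebra K ℕ+ ⊗[K] FreeAlgebra K ℕ+) :
    pairing₂ K f g (T * (q ⊗ₜ 1)) = c * pairing₂ K f' g T := by
  induction T using TensorProduct.induction_on with
  | zero => simp
  | tmul x y => simp [h, mul_assoc]
  | add x y hx hy => rw [add_mul, map_add, map_add, hx, hy, mul_add]

theorem pairing₂_mul_right (f g g' : FreeAlgebra K ℕ+ →ₗ[K] K) (q : FreeAlgebra K ℕ+) (c : K)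
    (h : ∀ p, g (p * q) = c * g' p) (T : FreeAlgebra K ℕ+ ⊗[K] FreeAlgebra K ℕ+) :
    pairing₂ K f g (T * (1 ⊗ₜ q)) = c * pairing₂ K f g' T := by
  induction T using TensorProduct.induction_on with
  | zero => simp
  | tmul x y => simp [h, mul_left_comm]
  | add x y hx hy => rw [add_mul, map_add, map_add, hx, hy, mul_add]

theorem coeffRev_nil_mul' (a : ℕ+) (f : FreeAlgebra K ℕ+ →ₗ[K] K) (p : FreeAlgebra K ℕ+) :
    coeffRev K [] (p * FreeAlgebra.ι K a) = 0 * f p := by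
  rw [coeffRev_nil_mul, zero_mul]

theorem coeffRev_cons_mul' (a b : ℕ+) (w : List ℕ+) (p : FreeAlgebra K ℕ+) :
    coeffRev K (a :: w) (p * FreeAlgebra.ι K b) = (if a = b then 1 else 0) * coeffRev K w p := by
  rw [coeffRev_cons_mul]
  split_ifs <;> simp

theorem pairing_singleton (w : List ℕ+) : pairing K {w} = coeffRev K w := by
  simp [pairing]

/-- The last generator `c` of the monomial contributes `c ⊗ 1 + 1 ⊗ c`, which removes the letter `c`
from the front of `x` or of `y`: the recursion of the shuffle. -/
theorem pairing₂_comul_monoRev (x y v : List ℕ+) :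
    pairing₂ K (coeffRev K x) (coeffRev K y) (comul K (monoRev K v)) =
      pairing K (shuffle x y) (monoRev K v) := by
  induction v generalizing x y with
  | nil =>
    rw [monoRev_nil, map_one, Algebra.TensorProduct.one_def, pairing₂_tmul, ← monoRev_nil,
      coeffRev_monoRev, coeffRev_monoRev]
    cases x with
    | nil => simp [pairing_singleton, coeffRev_one]
    | cons a x =>
      cases y with
      | nil => simp [pairing_singleton, coeffRev_one]
      | cons b y =>
        rw [shuffle_cons_cons, pairing_add, LinearMap.add_apply, monoRev_nil, pairing_map_cons_one,
          pairing_map_cons_one]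
        simp
  | cons c v ih =>
    have hc : comul K (FreeAlgebra.ι K c) =
        FreeAlgebra.ι K c ⊗ₜ 1 + 1 ⊗ₜ FreeAlgebra.ι K c := FreeAlgebra.lift_ι_apply _ _
    rw [monoRev_cons, map_mul, hc, mul_add, map_add]
    cases x with
    | nil =>
      rw [pairing₂_mul_left K _ 0 _ _ 0 (coeffRev_nil_mul' K c 0), zero_mul, zero_add,
        shuffle_nil_left, pairing_singleton]
      cases y with
      | nil =>
        rw [pairing₂_mul_right K _ _ 0 _ 0 (coeffRev_nil_mul' K c 0), zero_mul, coeffRev_nil_mul]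
      | cons b y =>
        rw [pairing₂_mul_right K _ _ _ _ _ (coeffRev_cons_mul' K b c y), ih, coeffRev_cons_mul',
          shuffle_nil_left, pairing_singleton]
    | cons a x =>
      rw [pairing₂_mul_left K _ _ _ _ _ (coeffRev_cons_mul' K a c x), ih]
      cases y with
      | nil =>
        rw [pairing₂_mul_right K _ _ 0 _ 0 (coeffRev_nil_mul' K c 0), zero_mul, add_zero,
          shuffle_nil_right, shuffle_nil_right, pairing_singleton, pairing_singleton,
          coeffRev_cons_mul']
      | cons b y =>
        rw [pairing₂_mul_right K _ _ _ _ _ (coeffRev_cons_mul' K b c y), ih, shuffle_cons_cons,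
          pairing_add, LinearMap.add_apply, pairing_map_cons_mul, pairing_map_cons_mul]
        simp

theorem pairing₂_comul (M N : Multiset (List ℕ+)) (p : FreeAlgebra K ℕ+) :
    pairing₂ K (pairing K M) (pairing K N) (comul K p) = pairing K (shuffleM M N) p := by
  have h₀ : ∀ x y, (pairing₂ K (coeffRev K x) (coeffRev K y)).comp (comul K).toLinearMap =
      pairing K (shuffle x y) := fun x y =>
    linearMap_ext_monoRev fun w => pairing₂_comul_monoRev K x y w
  have hl : ∀ f f' g, pairing₂ K (f + f') g = pairing₂ K f g + pairing₂ K f' g := fun f f' g => by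
    simp [pairing₂, TensorProduct.map_add_left, LinearMap.comp_add]
  have hr : ∀ f g g', pairing₂ K f (g + g') = pairing₂ K f g + pairing₂ K f g' := fun f g g' => by
    simp [pairing₂, TensorProduct.map_add_right, LinearMap.comp_add]
  have hz : pairing K 0 = 0 := by simp [pairing]
  have hzl : ∀ g, pairing₂ K 0 g = 0 := fun g => by simp [pairing₂]
  have hzr : ∀ g, pairing₂ K g 0 = 0 := fun g => by simp [pairing₂]
  have hx : ∀ x, pairing₂ K (pairing K {x}) (pairing K N) (comul K p) =
      pairing K (shuffleM {x} N) p := by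
    intro x
    induction N using Multiset.induction_on with
    | empty => simp [hz, hzr, shuffleM]
    | cons y N ihN =>
      rw [← Multiset.singleton_add, pairing_add, hr, LinearMap.add_apply, ihN, shuffleM_add_right,
        pairing_add, LinearMap.add_apply]
      congr 1
      have := LinearMap.congr_fun (h₀ x y) p
      simpa [shuffleM, pairing_singleton] using this
  induction M using Multiset.induction_on with
  | empty => simp [hz, hzl, shuffleM]
  | cons x M ihM =>
    rw [← Multiset.singleton_add, pairing_add, hl, LinearMap.add_apply, ihM, shuffleM_add_left,
      pairing_add, LinearMap.add_apply, hx]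

end Coeff

/-! ### Coproducts of products of Hall polynomials -/

namespace HallTree

variable (K : Type*) [Field K]

open scoped TensorProduct

/-- The generators are primitive, and commutators of primitive elements are primitive. -/
theorem comul_assoc (t : HallTree) : comul K (assoc K t) = assoc K t ⊗ₜ 1 + 1 ⊗ₜ assoc K t := by
  obtain ⟨t, ht⟩ := t
  induction t with
  | letter n =>
    have := assoc_letter K n
    rw [letter] at this
    rw [this]
    exact FreeAlgebra.lift_ι_apply _ _
  | pair s t ihs iht =>
    rw [assoc_pair, map_sub, map_mul, map_mul]
    rw [show comul K (assoc K (left ht)) = _ from ihs _,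
      show comul K (assoc K (right ht)) = _ from iht _]
    simp only [left, right, mul_add, add_mul, Algebra.TensorProduct.tmul_mul_tmul, one_mul, mul_one,
      TensorProduct.sub_tmul, TensorProduct.tmul_sub]
    abel

/-- The pairs of complementary subsequences of a list. -/
def splits {α : Type*} : List α → List (List α × List α)
  | [] => [([], [])]
  | z :: u => (splits u).map (fun p => (z :: p.1, p.2)) ++ (splits u).map fun p => (p.1, z :: p.2)

theorem sublist_of_mem_splits {α : Type*} {u : List α} {p : List α × List α} (h : p ∈ splits u) :
    p.1.Sublist u := by
  induction u generalizing p with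
  | nil => simp [splits] at h; simp [h]
  | cons z u ih =>
    simp only [splits, List.mem_append, List.mem_map] at h
    rcases h with ⟨q, hq, rfl⟩ | ⟨q, hq, rfl⟩
    · exact (ih hq).cons_cons z
    · exact (ih hq).cons z

theorem comul_polyL (u : List HallTree) : comul K (polyL K u) =
    ((splits u).map fun p => polyL K p.1 ⊗ₜ[K] polyL K p.2).sum := by
  induction u with
  | nil => simp [splits, Algebra.TensorProduct.one_def]
  | cons z u ih =>
    rw [polyL_cons, map_mul, ih, comul_assoc, mul_add, splits, List.map_append, List.sum_append,
      ← List.sum_map_mul_right, ← List.sum_map_mul_right]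
    simp [polyL_cons, Function.comp_def]

theorem sum_splits_nil {M : Type*} [AddCommMonoid M] {α : Type*} [DecidableEq α] (u : List α)
    (F : List α → M) : ((splits u).map fun p => if p.1 = [] then F p.2 else 0).sum = F u := by
  induction u generalizing F with
  | nil => simp [splits]
  | cons z u ih =>
    have := ih fun v => F (z :: v)
    simp [splits, Function.comp_def, this]

/-- There is one split for each occurrence of `t`. As `u` is sorted, equal trees are adjacent, and
it does not matter which occurrence is removed. -/
theorem sum_splits_singleton {u : List HallTree} (hu : u.Pairwise (· ≥ ·)) (t : HallTree)
    (F : List HallTree → K) :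
    ((splits u).map fun p => if p.1 = [t] then F p.2 else 0).sum = u.count t * F (u.erase t) := by
  induction u generalizing F with
  | nil => simp [splits]
  | cons z u ih =>
    rw [List.pairwise_cons] at hu
    have h₁ := ih hu.2 fun v => F (z :: v)
    have h₂ := sum_splits_nil u F
    rw [splits, List.map_append, List.sum_append, List.map_map, List.map_map]
    simp only [Function.comp_def, List.cons.injEq]
    rw [h₁]
    by_cases hz : z = t
    · subst hz
      simp only [true_and, h₂, List.count_cons_self, List.erase_cons_head]
      -- If `z` occurs in the rest of the sorted list, it is its head, so erasing it and putting it
      -- back in front changes nothing.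
      have : (u.count z : K) * F (z :: u.erase z) = u.count z * F u := by
        by_cases hm : z ∈ u
        · cases u with
          | nil => simp at hm
          | cons y u =>
            have : z = y := by
              rcases List.mem_cons.1 hm with h | h
              · exact h
              · exact le_antisymm ((List.pairwise_cons.1 hu.2).1 z h) (hu.1 y (by simp))
            subst this
            simp
        · simp [List.count_eq_zero_of_not_mem hm]
      rw [this]
      push_cast
      ring
    · have hz' : ¬ z.1 = t.1 := fun h => hz (Subtype.ext h)
      simp [hz, hz']

/-- The pairing with a shuffle is computed on the coproduct. By `hM` only the splits whose first
part is `[t]` contribute. -/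
theorem pairing_mul_polyL {M : Multiset (List ℕ+)} {t : HallTree}
    (hM : ∀ l : List HallTree, l.Pairwise (· ≥ ·) →
      pairing K M (polyL K l) = if l = [t] then 1 else 0)
    (N : Multiset (List ℕ+)) {u : List HallTree} (hu : u.Pairwise (· ≥ ·)) :
    pairing K (shuffleM M N) (polyL K u) = u.count t * pairing K N (polyL K (u.erase t)) := by
  rw [← pairing₂_comul, comul_polyL, map_list_sum, List.map_map,
    ← sum_splits_singleton K hu t fun l => pairing K N (polyL K l)]
  congr 1
  refine List.map_congr_left fun p hp => ?_
  rw [Function.comp_apply, pairing₂_tmul, hM _ (hu.sublist (sublist_of_mem_splits hp))]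
  split_ifs <;> simp

end HallTree

end

end HallFrame

namespace HallFrame

noncomputable section

attribute [local instance] LieRing.ofAssociativeRing

/-! ## Hall forests and divided powers -/

theorem Forest.lin_graft_mul_graft {A : Type} (a b : A) (u v : Forest A) :
    Forest.lin (Forest.graft a u * Forest.graft b v) =
      (Forest.lin (u * Forest.graft b v)).map (a :: ·) +
        (Forest.lin (Forest.graft a u * v)).map (b :: ·) := by
  simp only [Forest.lin_mul, Forest.lin_graft, shuffleM_cons_cons]

/-- The two roots of `t · t^{∘(r+1)}` carry the same label, and removing either one leaves a copy of
`v` beside another factor. Removing the root of `t` contributes `v · t^{∘(r+1)}` once, removing the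
other contributes it `r + 1` times by induction. -/
theorem lin_mul_circPow (a : ℕ+) (v : Forest ℕ+) (r : ℕ) :
    Forest.lin (Forest.graft a v * circPow a v r) = (r + 1) • Forest.lin (circPow a v (r + 1)) := by
  induction r with
  | zero => simp [circPow]
  | succ r ih =>
    have h : Forest.lin (Forest.graft a v * (v * circPow a v r)) =
        (r + 1) • Forest.lin (v * circPow a v (r + 1)) := by
      rw [mul_left_comm, Forest.lin_mul, ih, shuffleM_nsmul_right, ← Forest.lin_mul]
    have h₁ : circPow a v (r + 1) = Forest.graft a (v * circPow a v r) := rfl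
    have h₂ : circPow a v (r + 2) = Forest.graft a (v * circPow a v (r + 1)) := rfl
    rw [h₁, Forest.lin_graft_mul_graft, h, ← h₁, h₂, Forest.lin_graft, Multiset.map_nsmul,
      succ_nsmul' _ (r + 1)]

namespace HallTree

/-- The rooted tree of a Hall tree. -/
def tree (t : HallTree) : Forest ℕ+ := t.1.toTree

/-- The forest `t_1^{∘r_1} ... t_m^{∘r_m}` of a list in which `t_i` occurs `r_i` times. -/
def treeProd (l : List HallTree) : Forest ℕ+ :=
  ∏ t ∈ l.toFinset, circPow t.1.rootLabel t.1.branches (l.count t)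

@[simp] theorem treeProd_nil : treeProd [] = 1 := rfl

theorem treeProd_eq {s : Finset HallTree} {l : List HallTree} (h : l.toFinset ⊆ s) :
    treeProd l = ∏ t ∈ s, circPow t.1.rootLabel t.1.branches (l.count t) := by
  refine Finset.prod_subset h fun t _ ht => ?_
  rw [List.count_eq_zero_of_not_mem (by simpa using ht)]
  rfl

theorem lin_tree_mul_treeProd (t : HallTree) (l : List HallTree) :
    Forest.lin (tree t * treeProd l) = (t :: l).count t • Forest.lin (treeProd (t :: l)) := by
  have hs : l.toFinset ⊆ (t :: l).toFinset := by simp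
  have ht : t ∈ (t :: l).toFinset := by simp
  rw [treeProd_eq hs, treeProd, ← Finset.mul_prod_erase _ _ ht, ← Finset.mul_prod_erase _ _ ht,
    ← mul_assoc, tree, Bracket.toTree, Forest.lin_mul, lin_mul_circPow, List.count_cons_self,
    Forest.lin_mul]
  have h : ∏ x ∈ (t :: l).toFinset.erase t, circPow x.1.rootLabel x.1.branches ((t :: l).count x) =
      ∏ x ∈ (t :: l).toFinset.erase t, circPow x.1.rootLabel x.1.branches (l.count x) := by
    refine Finset.prod_congr rfl fun x hx => ?_
    rw [List.count_cons_of_ne (Finset.ne_of_mem_erase hx).symm]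
  rw [h, shuffleM_nsmul_left]

/-! ## The parts of a Hall tree -/

/-- The parts of a Hall tree, as a list of Hall trees. -/
def hallParts : (t : Bracket) → t.IsHall → List HallTree
  | Bracket.letter _, _ => []
  | Bracket.pair s _, h => hallParts s (Bracket.isHall_pair.1 h).1 ++ [right h]

/-- The parts of a Hall tree, as a list of Hall trees. -/
def partsL (t : HallTree) : List HallTree := hallParts t.1 t.2

theorem partsL_letter (n : ℕ+) (h : (Bracket.letter n).IsHall) :
    partsL ⟨Bracket.letter n, h⟩ = [] := rfl

theorem partsL_pair {s t : Bracket} (h : (Bracket.pair s t).IsHall) :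
    partsL ⟨Bracket.pair s t, h⟩ = partsL (left h) ++ [right h] := rfl

theorem map_partsL (t : HallTree) : (partsL t).map Subtype.val = t.1.parts := by
  obtain ⟨t, ht⟩ := t
  induction t with
  | letter n => rfl
  | pair s t ihs _ =>
    rw [partsL_pair, List.map_append, show (partsL (left ht)).map Subtype.val = s.parts from ihs _]
    rfl

theorem branches_eq_treeProd (t : HallTree) : t.1.branches = treeProd (partsL t) := by
  have h : t.1.parts.toFinset = (partsL t).toFinset.image Subtype.val := by
    rw [← map_partsL]
    ext x
    simp
  rw [Bracket.branches_eq, h, Finset.prod_image fun x _ y _ h => Subtype.ext h]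
  refine Finset.prod_congr rfl fun x _ => ?_
  rw [← map_partsL, List.count_map_of_injective _ _ Subtype.val_injective]

theorem right_le_of_mem_partsL {s t : Bracket} (h : (Bracket.pair s t).IsHall) {y : HallTree}
    (hy : y ∈ partsL ⟨Bracket.pair s t, h⟩) : right h ≤ y := by
  induction s generalizing t with
  | letter n =>
    have : y = right h := by simpa [partsL_pair, left, partsL_letter] using hy
    exact this ▸ le_rfl
  | pair s₁ s₂ ih₁ _ =>
    rw [partsL_pair, List.mem_append, List.mem_singleton] at hy
    rcases hy with hy | rfl
    · exact le_trans (show right h ≤ right (left h).2 from le_iff.2 h.le_right) (ih₁ (left h).2 hy)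
    · exact le_rfl

theorem lt_of_mem_partsL {t y : HallTree} (hy : y ∈ partsL t) : t < y := by
  obtain ⟨t, ht⟩ := t
  cases t with
  | letter n => simp [partsL_letter] at hy
  | pair s t => exact lt_of_lt_of_le (lt_iff.2 ht.pair_lt) (right_le_of_mem_partsL ht hy)

theorem pairwise_partsL (t : HallTree) : (partsL t).Pairwise (· ≥ ·) := by
  obtain ⟨t, ht⟩ := t
  induction t with
  | letter n => exact List.Pairwise.nil
  | pair s t ihs _ =>
    rw [partsL_pair, List.pairwise_append]
    refine ⟨ihs _, List.pairwise_singleton _ _, fun x hx y hy => ?_⟩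
    rw [List.mem_singleton] at hy
    subst hy
    refine right_le_of_mem_partsL ht ?_
    rw [partsL_pair]
    exact List.mem_append_left _ hx

theorem length_lt_of_mem_partsL {t y : HallTree} (hy : y ∈ partsL t) : y.1.length < t.1.length :=
  Bracket.length_lt_of_mem_parts (by rw [← map_partsL]; exact List.mem_map_of_mem hy)

theorem eq_of_partsL_eq {s t : HallTree} (h₁ : s.1.rootLabel = t.1.rootLabel)
    (h₂ : partsL s = partsL t) : s = t := by
  obtain ⟨s, hs⟩ := s
  obtain ⟨t, ht⟩ := t
  induction s generalizing t with
  | letter n =>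
    cases t with
    | letter m =>
      have h₁ : n = m := h₁
      subst h₁; rfl
    | pair t₁ t₂ => simp [partsL_letter, partsL_pair] at h₂
  | pair s₁ s₂ ih _ =>
    cases t with
    | letter m => simp [partsL_letter, partsL_pair] at h₂
    | pair t₁ t₂ =>
      rw [partsL_pair, partsL_pair] at h₂
      obtain ⟨e₁, e₂⟩ := List.append_inj' h₂ rfl
      have h := congrArg Subtype.val (ih (left hs).2 t₁ (left ht).2 h₁ e₁)
      have h' := congrArg Subtype.val (List.singleton_inj.1 e₂)
      have h : s₁ = t₁ := h
      have h' : s₂ = t₂ := h'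
      subst h h'
      rfl

/-- If the parts of `x` followed by `z` begin the parts of a Hall tree, then `x < z`. -/
theorem lt_of_partsL_eq_append {t x z : HallTree} {l : List HallTree}
    (h₁ : t.1.rootLabel = x.1.rootLabel) (h₂ : partsL t = partsL x ++ z :: l) : x < z := by
  obtain ⟨t, ht⟩ := t
  induction t generalizing l with
  | letter n => simp [partsL_letter] at h₂
  | pair s t ih _ =>
    rw [partsL_pair] at h₂
    -- Parts are peeled off from the end until `z` is the last one; then `x` and `z` are the two
    -- standard factors.
    rcases List.eq_nil_or_concat l with rfl | ⟨l', y, rfl⟩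
    · obtain ⟨e₁, e₂⟩ := List.append_inj' h₂ rfl
      rw [← eq_of_partsL_eq (s := left ht) h₁ e₁, ← List.singleton_inj.1 e₂]
      exact lt_iff.2 ht.left_lt_right
    · rw [List.concat_eq_append, ← List.cons_append, ← List.append_assoc] at h₂
      obtain ⟨e₁, e₂⟩ := List.append_inj' h₂ rfl
      exact ih (left ht).2 h₁ e₁

/-! ## Duality -/

variable (K : Type*) [Field K]

/-- The linear form given by a rooted tree detects the Hall polynomial of this tree. -/
def TreeDual (t : HallTree) : Prop := ∀ l : List HallTree, l.Pairwise (· ≥ ·) →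
  pairing K (Forest.lin (tree t)) (polyL K l) = if l = [t] then 1 else 0

/-- The constant term is an algebra homomorphism that kills the generators, hence every `E(t)`. -/
theorem coeffRev_nil_polyL (l : List HallTree) :
    coeffRev K [] (polyL K l) = if l = [] then 1 else 0 := by
  have hmul : ∀ p q, coeffRev K [] (p * q) = coeffRev K [] p * coeffRev K [] q := by
    intro p q
    have h : ∀ p, coeffRev K [] p = FreeAlgebra.lift K (fun _ : ℕ+ => (0 : K)) p := by
      intro p
      have : coeffRev K [] = (FreeAlgebra.lift K (fun _ : ℕ+ => (0 : K))).toLinearMap := by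
        refine linearMap_ext_monoRev fun w => ?_
        cases w with
        | nil => simp [coeffRev_one]
        | cons a w => rw [monoRev_cons, coeffRev_nil_mul]; simp
      exact LinearMap.congr_fun this p
    rw [h, h, h, map_mul]
  have ht : ∀ t : HallTree, coeffRev K [] (assoc K t) = 0 := by
    rintro ⟨t, ht⟩
    cases t with
    | letter n =>
      rw [show assoc K ⟨Bracket.letter n, ht⟩ = 1 * FreeAlgebra.ι K n by
        rw [one_mul]; exact assoc_letter K n]
      exact coeffRev_nil_mul K n 1
    | pair s t => rw [assoc_pair, map_sub, hmul, hmul]; ring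
  cases l with
  | nil => simp [coeffRev_one]
  | cons t l => rw [polyL_cons, hmul, ht]; simp

/-- One copy of `t` is removed from both sides. The multiplicity produced by `lin_tree_mul_treeProd`
cancels the one from the coproduct, for which characteristic 0 is needed. -/
theorem pairing_treeProd [CharZero K] {v : List HallTree} (hv : v.Pairwise (· ≥ ·))
    (hdual : ∀ t ∈ v, TreeDual K t) {u : List HallTree} (hu : u.Pairwise (· ≥ ·)) :
    pairing K (Forest.lin (treeProd v)) (polyL K u) = if u = v then 1 else 0 := by
  induction v generalizing u with
  | nil => rw [treeProd_nil, Forest.lin_one, pairing_singleton, coeffRev_nil_polyL]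
  | cons t v ih =>
    have hv' := List.pairwise_cons.1 hv
    have h₁ := pairing_mul_polyL K (hdual t (by simp)) (Forest.lin (treeProd v)) hu
    rw [← Forest.lin_mul, lin_tree_mul_treeProd, pairing_nsmul, LinearMap.smul_apply,
      ih hv'.2 (fun s hs => hdual s (List.mem_cons_of_mem _ hs)) (hu.sublist List.erase_sublist),
      nsmul_eq_mul] at h₁
    have hne : ((t :: v).count t : K) ≠ 0 := by
      rw [List.count_cons_self]
      exact Nat.cast_ne_zero.2 (Nat.succ_ne_zero _)
    by_cases h : u = t :: v
    · subst h
      rw [List.erase_cons_head, if_pos rfl] at h₁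
      rw [if_pos rfl]
      exact mul_left_cancel₀ hne h₁
    · rw [if_neg h]
      -- If `t ∈ u` and `u.erase t = v`, then `u` and `t :: v` are sorted permutations of each
      -- other, hence equal.
      have h₂ : (u.count t : K) * (if u.erase t = v then 1 else 0) = 0 := by
        by_cases ht : t ∈ u
        · rw [if_neg, mul_zero]
          rintro rfl
          exact h ((List.perm_cons_erase ht).eq_of_pairwise' hu hv)
        · simp [List.count_eq_zero_of_not_mem ht]
      rw [h₂] at h₁
      exact (mul_eq_zero.1 h₁).resolve_left hne

/-! ### Hall trees are dual to Hall polynomials -/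

section TreeDuality

variable {K} {T : HallTree}

/-- The induction step for the duality of a Hall tree `T`: products starting with `x`, where the
parts of `x` are larger than `x₀`, are reduced to products starting with trees larger than `x₀`. -/
theorem pairing_tree_of_forall_gt
    (hT : ∀ u : List HallTree, u.Pairwise (· ≥ ·) →
      pairing K (Forest.lin (treeProd (partsL T))) (polyL K u) = if u = partsL T then 1 else 0)
    {M : Multiset ℕ+} {x₀ : HallTree}
    (hgt : ∀ z l, x₀ < z → l ≠ [] → (z :: l).Pairwise (· ≥ ·) → listContent (z :: l) = M →
      pairing K (Forest.lin (tree T)) (polyL K (z :: l)) = 0)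
    (x : HallTree) (l : List HallTree) (hx : ∀ y ∈ partsL x, x₀ < y) (hl : l.Pairwise (· ≥ ·))
    (hxl : ∀ (s t : Bracket) (h : (Bracket.pair s t).IsHall), x = ⟨Bracket.pair s t, h⟩ →
      ∀ z ∈ l, z ≤ right h)
    (hM : listContent (x :: l) = M) :
    pairing K (Forest.lin (tree T)) (polyL K (x :: l)) =
      if x.1.rootLabel = T.1.rootLabel ∧ partsL x ++ l = partsL T then 1 else 0 := by
  obtain ⟨x, hxH⟩ := x
  induction x generalizing l with
  | letter n =>
    rw [polyL_cons, show assoc K ⟨Bracket.letter n, hxH⟩ = FreeAlgebra.ι K n from assoc_letter K n,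
      tree, Bracket.toTree, Forest.lin_graft, branches_eq_treeProd, pairing_map_cons_mul, hT l hl,
      partsL_letter, List.nil_append]
    have : (⟨Bracket.letter n, hxH⟩ : HallTree).1.rootLabel = n := rfl
    rw [this]
    by_cases h₁ : n = T.1.rootLabel <;> by_cases h₂ : l = partsL T <;> simp [h₁, h₂, eq_comm]
  | pair s y ihs _ =>
    set a := left hxH with ha
    set b := right hxH with hb
    have hlb : ∀ z ∈ l, z ≤ b := hxl s y hxH rfl
    have hx₀b : x₀ < b := hx b (by rw [partsL_pair]; simp [hb])
    have hab : a < b := lt_iff.2 hxH.left_lt_right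
    have hcon : a.content + b.content + listContent l = M := by
      rw [← hM, listContent_cons, content_pair]
    -- Lists are multiplied from right to left, so in `polyL l * (E(b) E(a) - E(a) E(b))` the
    -- product ending in `E(a)` belongs to `a :: b :: l`.
    have hpoly : polyL K (⟨Bracket.pair s y, hxH⟩ :: l) =
        polyL K (a :: b :: l) - polyL K (b :: a :: l) := by
      simp only [polyL_cons, assoc_pair, ← ha, ← hb, mul_sub, mul_assoc]
    have h₁ : pairing K (Forest.lin (tree T)) (polyL K (a :: b :: l)) =
        if a.1.rootLabel = T.1.rootLabel ∧ partsL a ++ b :: l = partsL T then 1 else 0 := by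
      -- The recursion opens `a` and moves `b` to the front of the list, which stays sorted. At the
      -- end the root letter of `x` is isolated, followed by the parts of `x` and then `l`.
      refine ihs (b :: l) (List.pairwise_cons.2 ⟨hlb, hl⟩) a.2 (fun z hz => hx z ?_) ?_ ?_
      · rw [partsL_pair]
        exact List.mem_append_left _ hz
      · intro s₁ s₂ h heq z hz
        have heq : s = Bracket.pair s₁ s₂ := congrArg Subtype.val heq
        subst heq
        have hle : b ≤ right h := le_iff.2 hxH.le_right
        rcases List.mem_cons.1 hz with rfl | hz
        · exact hle
        · exact (hlb z hz).trans hle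
      · rw [← hcon, listContent_cons, listContent_cons, add_assoc]
        rfl
    have h₂ : pairing K (Forest.lin (tree T)) (polyL K (b :: a :: l)) = 0 := by
      -- Straightening `a :: l` produces only trees at most `b`, so every product again starts with
      -- its largest tree `b > x₀` and `hgt` applies; the lists are not empty because they carry the
      -- letters of `a`.
      have hmem := polyL_mem_spanSorted K (Q := fun t => t ≤ b) (fun _ _ h h' => h.trans h')
        (l := a :: l) (List.forall_mem_cons.2 ⟨hab.le, hlb⟩)
      have := map_mem_of_mem_span K ((pairing K (Forest.lin (tree T))).comp
        (LinearMap.mulRight K (assoc K b))) hmem (N := ⊥) ?_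
      · rw [polyL_cons]
        exact this
      · rintro _ ⟨l', hl', rfl⟩
        obtain ⟨k₁, k₂, k₃⟩ := Set.mem_ofPred.1 hl'
        rw [Submodule.mem_bot, LinearMap.comp_apply, LinearMap.mulRight_apply, ← polyL_cons]
        refine hgt b l' hx₀b ?_ (List.pairwise_cons.2 ⟨k₂, k₁⟩) ?_
        · rintro rfl
          rw [listContent_nil, listContent_cons] at k₃
          exact a.content_ne_zero (add_eq_zero.1 k₃.symm).1
        · rw [listContent_cons, k₃, ← hcon, listContent_cons]
          abel
    rw [hpoly, map_sub, h₁, h₂, sub_zero, partsL_pair, List.append_assoc]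
    rfl

theorem treeDual_of_parts
    (hT : ∀ u : List HallTree, u.Pairwise (· ≥ ·) →
      pairing K (Forest.lin (treeProd (partsL T))) (polyL K u) = if u = partsL T then 1 else 0) :
    TreeDual K T := by
  have hxl : ∀ (x : HallTree) (l : List HallTree), (∀ z ∈ l, z ≤ x) →
      ∀ (s t : Bracket) (h : (Bracket.pair s t).IsHall), x = ⟨Bracket.pair s t, h⟩ →
        ∀ z ∈ l, z ≤ right h := by
    rintro x l hx s t h rfl z hz
    exact (hx z hz).trans (lt_iff.2 h.pair_lt).le
  -- Sorted products with at least two factors pair to zero, by descending induction on the first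
  -- factor among the trees with letters in `M`.
  have hgt : ∀ (M : Multiset ℕ+) (z : HallTree) (l : List HallTree), l ≠ [] →
      (z :: l).Pairwise (· ≥ ·) → listContent (z :: l) = M →
      pairing K (Forest.lin (tree T)) (polyL K (z :: l)) = 0 := by
    intro M z l hl hz hM
    have hmem : ∀ (z : HallTree) (l : List HallTree), listContent (z :: l) = M →
        z ∈ {t : HallTree | t.content ≤ M} := fun z l h => by
      rw [← h, listContent_cons]
      exact Set.mem_ofPred.2 (Multiset.le_add_right _ _)
    have hzM := hmem z l hM
    revert l
    refine (finite_setOf_content_le M).wellFoundedOn.induction (r := (· > ·))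
      (P := fun z => ∀ l : List HallTree, l ≠ [] → (z :: l).Pairwise (· ≥ ·) →
        listContent (z :: l) = M → pairing K (Forest.lin (tree T)) (polyL K (z :: l)) = 0)
      hzM fun x _ ih l hl hs hM => ?_
    have hs' := List.pairwise_cons.1 hs
    rw [pairing_tree_of_forall_gt hT (M := M) (x₀ := x)
      (fun z l' h₁ h₂ h₃ h₄ => ih z (hmem z l' h₄) h₁ l' h₂ h₃ h₄) x l
      (fun y hy => lt_of_mem_partsL hy) hs'.2 (hxl x l hs'.1) hM, if_neg]
    rintro ⟨h₁, h₂⟩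
    -- A non-zero value would make the parts of `x` followed by `z` begin the parts of `T`, which
    -- forces `x < z` and contradicts the sorting.
    obtain ⟨z, l, rfl⟩ := List.exists_cons_of_ne_nil hl
    exact absurd (lt_of_partsL_eq_append h₁.symm h₂.symm) (not_lt.2 (hs'.1 z (by simp)))
  intro l hl
  match l with
  | [] =>
    rw [tree, Bracket.toTree, Forest.lin_graft, polyL_nil, pairing_map_cons_one]
    simp
  | [x] =>
    rw [pairing_tree_of_forall_gt hT (M := listContent [x]) (x₀ := x)
      (fun z l' _ h₂ h₃ h₄ => hgt _ z l' h₂ h₃ h₄) x [] (fun y hy => lt_of_mem_partsL hy) hl.tail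
      (hxl x [] (by simp)) rfl, List.append_nil]
    by_cases h : x = T
    · simp [h]
    · rw [if_neg fun h' => h (eq_of_partsL_eq h'.1 h'.2), if_neg (by simpa using h)]
  | x :: y :: l =>
    rw [hgt _ x (y :: l) (by simp) hl rfl]
    simp

end TreeDuality

theorem treeDual [CharZero K] (t : HallTree) : TreeDual K t := by
  induction hn : t.1.length using Nat.strong_induction_on generalizing t with
  | _ n ih =>
    subst hn
    refine treeDual_of_parts fun u hu => pairing_treeProd K (pairwise_partsL t) (fun s hs => ?_) hu
    exact ih _ (length_lt_of_mem_partsL hs) s rfl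

end HallTree

end

end HallFrame

namespace HallFrame

noncomputable section

attribute [local instance] LieRing.ofAssociativeRing

/-! ## Homogeneity -/

/-- All words of the linear extensions of the forest consist of the letters `M`. -/
def Forest.HasLabels (u : Forest ℕ+) (M : Multiset ℕ+) : Prop :=
  ∀ w ∈ Forest.lin u, (w : Multiset ℕ+) = M

theorem Forest.hasLabels_one : Forest.HasLabels 1 0 := by
  intro w hw
  rw [Forest.lin_one, Multiset.mem_singleton] at hw
  rw [hw, Multiset.coe_nil]

theorem Forest.HasLabels.mul {u v : Forest ℕ+} {M N : Multiset ℕ+} (hu : u.HasLabels M)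
    (hv : v.HasLabels N) : (u * v).HasLabels (M + N) := by
  intro w hw
  rw [Forest.lin_mul, shuffleM, Multiset.mem_bind] at hw
  obtain ⟨x, hx, hw⟩ := hw
  obtain ⟨y, hy, hw⟩ := Multiset.mem_bind.1 hw
  rw [← hu x hx, ← hv y hy, Multiset.coe_add, Multiset.coe_eq_coe]
  exact shuffle_perm hw

theorem Forest.HasLabels.graft {u : Forest ℕ+} {M : Multiset ℕ+} (hu : u.HasLabels M) (a : ℕ+) :
    (Forest.graft a u).HasLabels ({a} + M) := by
  intro w hw
  rw [Forest.lin_graft, Multiset.mem_map] at hw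
  obtain ⟨x, hx, rfl⟩ := hw
  rw [← hu x hx, Multiset.singleton_add, Multiset.cons_coe]

theorem Forest.HasLabels.circPow {u : Forest ℕ+} {M : Multiset ℕ+} (hu : u.HasLabels M) (a : ℕ+)
    (r : ℕ) : (circPow a u r).HasLabels (r • ({a} + M)) := by
  induction r with
  | zero => rw [zero_nsmul]; exact Forest.hasLabels_one
  | succ r ih =>
    have := (hu.mul ih).graft a
    rwa [← add_assoc, ← succ_nsmul'] at this

theorem Forest.hasLabels_prod {ι : Type*} (s : Finset ι) (f : ι → Forest ℕ+)
    (M : ι → Multiset ℕ+) (h : ∀ i ∈ s, (f i).HasLabels (M i)) :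
    (∏ i ∈ s, f i).HasLabels (∑ i ∈ s, M i) := by
  classical
  induction s using Finset.induction_on with
  | empty => exact Forest.hasLabels_one
  | insert i s hi ih =>
    rw [Finset.prod_insert hi, Finset.sum_insert hi]
    exact (h i (by simp)).mul (ih fun j hj => h j (by simp [hj]))

/-! ### Letters of Hall trees and of Hall polynomials -/

namespace HallTree

theorem content_eq (t : HallTree) : t.content = {t.1.rootLabel} + listContent (partsL t) := by
  obtain ⟨t, ht⟩ := t
  induction t with
  | letter n => rfl
  | pair s t ihs _ =>
    have h : content (left ht) = {s.rootLabel} + listContent (partsL (left ht)) := ihs (left ht).2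
    rw [content_pair, h, partsL_pair, add_assoc]
    simp [listContent]
    rfl

theorem hasLabels_treeProd {l : List HallTree}
    (h : ∀ t ∈ l, t.1.branches.HasLabels (listContent (partsL t))) :
    (treeProd l).HasLabels (listContent l) := by
  rw [treeProd, listContent, Finset.sum_list_map_count]
  refine Forest.hasLabels_prod _ _ _ fun t ht => ?_
  rw [content_eq]
  convert (h t (by simpa using ht)).circPow t.1.rootLabel (l.count t)

theorem hasLabels_branches (t : HallTree) : t.1.branches.HasLabels (listContent (partsL t)) := by
  induction hn : t.1.length using Nat.strong_induction_on generalizing t with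
  | _ n ih =>
    subst hn
    rw [branches_eq_treeProd]
    exact hasLabels_treeProd fun s hs => ih _ (length_lt_of_mem_partsL hs) s rfl

section

variable (K : Type*) [Field K]

/-- Polynomials whose monomials consist of the letters `M`. -/
def homogeneous (M : Multiset ℕ+) : Submodule K (FreeAlgebra K ℕ+) :=
  Submodule.span K (monoRev K '' {w | (w : Multiset ℕ+) = M})

theorem monoRev_mem_homogeneous (w : List ℕ+) : monoRev K w ∈ homogeneous K w :=
  Submodule.subset_span ⟨w, Set.mem_ofPred.2 rfl, rfl⟩

theorem mul_mem_homogeneous {M N : Multiset ℕ+} {p q : FreeAlgebra K ℕ+}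
    (hp : p ∈ homogeneous K M) (hq : q ∈ homogeneous K N) : p * q ∈ homogeneous K (M + N) := by
  refine map_mem_of_mem_span K (LinearMap.mulRight K q) hp ?_
  rintro _ ⟨v, hv, rfl⟩
  refine map_mem_of_mem_span K (LinearMap.mulLeft K (monoRev K v)) hq ?_
  rintro _ ⟨w, hw, rfl⟩
  rw [Set.mem_ofPred] at hv hw
  have h : monoRev K v * monoRev K w = monoRev K (w ++ v) := by simp [monoRev]
  have := monoRev_mem_homogeneous K (w ++ v)
  rw [← Multiset.coe_add, hv, hw, add_comm] at this
  rw [LinearMap.mulLeft_apply, h]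
  exact this

theorem coeffRev_eq_zero {M : Multiset ℕ+} {p : FreeAlgebra K ℕ+} (hp : p ∈ homogeneous K M)
    {w : List ℕ+} (hw : (w : Multiset ℕ+) ≠ M) : coeffRev K w p = 0 := by
  refine (Submodule.mem_bot K).1 (map_mem_of_mem_span K (coeffRev K w) hp ?_)
  rintro _ ⟨v, hv, rfl⟩
  rw [Set.mem_ofPred] at hv
  rw [Submodule.mem_bot, coeffRev_monoRev, if_neg]
  rintro rfl
  exact hw hv

theorem assoc_mem_homogeneous (t : HallTree) : assoc K t ∈ homogeneous K t.content := by
  obtain ⟨t, ht⟩ := t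
  induction t with
  | letter n =>
    have h : assoc K ⟨Bracket.letter n, ht⟩ = monoRev K [n] := by
      rw [monoRev_cons, monoRev_nil, one_mul]
      exact assoc_letter K n
    rw [h]
    exact monoRev_mem_homogeneous K [n]
  | pair s t ihs iht =>
    have hs : assoc K (left ht) ∈ homogeneous K (left ht).content := ihs _
    have ht' : assoc K (right ht) ∈ homogeneous K (right ht).content := iht _
    rw [assoc_pair, content_pair]
    refine Submodule.sub_mem _ ?_ (mul_mem_homogeneous K hs ht')
    rw [add_comm]
    exact mul_mem_homogeneous K ht' hs

theorem polyL_mem_homogeneous (l : List HallTree) : polyL K l ∈ homogeneous K (listContent l) := by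
  induction l with
  | nil => exact monoRev_mem_homogeneous K []
  | cons t l ih =>
    rw [polyL_cons, listContent_cons, add_comm]
    exact mul_mem_homogeneous K ih (assoc_mem_homogeneous K t)

/-! ## The bases -/

theorem span_sorted_polyL :
    Submodule.span K (polyL K '' {l | l.Pairwise (· ≥ ·)}) = ⊤ := by
  rw [eq_top_iff, ← (FreeAlgebra.basisFreeMonoid K ℕ+).span_eq, Submodule.span_le]
  rintro _ ⟨w, rfl⟩
  have h : FreeAlgebra.basisFreeMonoid K ℕ+ w = polyL K (w.toList.reverse.map letter) := by
    have := basisFreeMonoid_apply K w.toList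
    rw [FreeMonoid.ofList_toList] at this
    rw [this, polyL, monoRev, ← List.map_reverse, List.map_map]
    congr 1
    refine List.map_congr_left fun a _ => (assoc_letter K a).symm
  rw [h]
  have := polyL_mem_spanSorted K (Q := fun _ => True) (fun _ _ _ _ => trivial)
    (l := w.toList.reverse.map letter) fun _ _ => trivial
  exact Submodule.span_mono (Set.image_mono fun l hl => (Set.mem_ofPred.1 hl).1) this

end

end HallTree

/-! ### Hall forests and their polynomials as dual families -/

namespace HallForest

open HallTree

theorem pairwise (u : HallForest) : u.1.Pairwise (· ≥ ·) :=
  u.2.imp fun h => not_wordLT_iff.1 h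

/-- The Hall forest of a non-increasing list of Hall trees. -/
def ofList (l : List HallTree) (h : l.Pairwise (· ≥ ·)) : HallForest :=
  ⟨l, h.imp fun h => not_wordLT_iff.2 h⟩

theorem toForest_eq (u : HallForest) : u.toForest = treeProd u.1 := rfl

theorem toForest_singleton (t : HallTree) :
    (ofList [t] (List.pairwise_singleton _ _)).toForest = t.1.toTree := by
  simp [toForest, ofList, circPow, Bracket.toTree]

variable (K : Type*) [Field K]

theorem poly_eq (u : HallForest) : u.poly K = polyL K u.1 := rfl

theorem pairing_poly [CharZero K] (u v : HallForest) :
    pairing K (Forest.lin u.toForest) (v.poly K) = if v = u then 1 else 0 := by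
  rw [toForest_eq, poly_eq, pairing_treeProd K u.pairwise (fun t _ => treeDual K t) v.pairwise]
  simp only [Subtype.ext_iff]

theorem linearIndependent_poly [CharZero K] :
    LinearIndependent K fun u : HallForest => u.poly K := by
  rw [linearIndependent_iff']
  intro s g hg u hu
  have := congrArg (pairing K (Forest.lin u.toForest)) hg
  rw [map_sum, map_zero] at this
  simpa [pairing_poly, hu] using this

theorem span_range_poly : Submodule.span K (Set.range fun u : HallForest => u.poly K) = ⊤ := by
  rw [eq_top_iff, ← span_sorted_polyL]
  refine Submodule.span_mono ?_
  rintro _ ⟨l, hl, rfl⟩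
  exact ⟨ofList l (Set.mem_ofPred.1 hl), rfl⟩

/-- The pairing depends only on the rooted forest, and by duality it distinguishes different Hall
forests. -/
theorem toForest_injective : Function.Injective toForest := by
  intro u v h
  have h₁ := pairing_poly ℝ u u
  rw [h, pairing_poly, if_pos rfl] at h₁
  by_contra hne
  simp [hne] at h₁

end HallForest

namespace HallTree

/-- A Hall tree as a Hall forest. -/
def single (t : HallTree) : HallForest := HallForest.ofList [t] (List.pairwise_singleton _ _)

theorem single_injective : Function.Injective single := fun _ _ h =>
  List.singleton_inj.1 (congrArg Subtype.val h)

theorem toTree_injective : Function.Injective fun t : HallTree => t.1.toTree := by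
  intro s t h
  refine single_injective (HallForest.toForest_injective ?_)
  rw [single, HallForest.toForest_singleton, single, HallForest.toForest_singleton]
  exact h

variable (K : Type*) [Field K]

theorem poly_single (t : HallTree) : (single t).poly K = lieToAssoc K (t.1.hallPoly K) := by
  simp [HallForest.poly, single, HallForest.ofList]

/-- The images in the associative algebra are the members `E(u)` for one-tree forests, a subfamily
of an independent one. -/
theorem linearIndependent_lie [CharZero K] :
    LinearIndependent K fun t : HallTree => t.1.hallPoly K := by
  have h := (HallForest.linearIndependent_poly K).comp single single_injective
  have e : (fun u : HallForest => u.poly K) ∘ single =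
      fun t : HallTree => lieToAssoc K (t.1.hallPoly K) := funext (poly_single K)
  rw [e] at h
  exact LinearIndependent.of_comp
    ({ toFun := lieToAssoc K, map_add' := map_add _, map_smul' := map_smul _ } :
      FreeLieAlgebra K ℕ+ →ₗ[K] FreeAlgebra K ℕ+) h

end HallTree

/-! ## The series of the universal singular frame in the Hall basis -/

open HallTree

theorem support_hallTerm_finite (w : List ℕ+) :
    (Function.support fun t => hallTerm t w).Finite := by
  refine (finite_setOf_content_le (w.reverse : Multiset ℕ+)).subset fun t ht => ?_
  rw [Set.mem_ofPred]
  by_contra hle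
  refine ht ?_
  have := coeffRev_eq_zero ℝ (assoc_mem_homogeneous ℝ t) (w := w.reverse)
    fun h => hle (le_of_eq h.symm)
  rw [coeffRev_apply, List.reverse_reverse] at this
  change _ * coeff w (assoc ℝ t) = 0
  rw [this, mul_zero]

theorem treeProd_ne_one {t : HallTree} {l : List HallTree} : treeProd (t :: l) ≠ 1 := by
  intro h
  have := hasLabels_treeProd (l := t :: l) fun t _ => hasLabels_branches t
  have := this [] (by rw [h]; simp)
  rw [listContent_cons] at this
  exact t.content_ne_zero (add_eq_zero.1 this.symm).1

/-- Vanishing off trees is not enough, as `t^{∘r}` is itself a rooted tree. But a positive multiple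
of `lin u` is that of a product of two non-empty forests, on which `β^U` vanishes. -/
theorem betaU_toForest_eq_zero {u : HallForest} (hu : u ∉ Set.range single) :
    betaU u.toForest = 0 := by
  obtain ⟨l, hl⟩ := u
  match l with
  | [] => exact betaU_one
  | [t] => exact absurd ⟨t, rfl⟩ hu
  | t :: s :: l =>
    rw [HallForest.toForest_eq, betaU_eq]
    have ht : tree t ≠ 1 := Forest.graft_ne_one _ _
    have h : Forest.extend betaWord (tree t * treeProd (s :: l)) = 0 :=
      Forest.extend_mul_eq_zero (fun _ _ => shuffleSum_betaWord) ht treeProd_ne_one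
    rw [Forest.extend_eq, lin_tree_mul_treeProd, Multiset.map_nsmul, Multiset.sum_nsmul,
      ← Forest.extend_eq, nsmul_eq_mul] at h
    refine (mul_eq_zero.1 h).resolve_left ?_
    rw [List.count_cons_self]
    exact Nat.cast_ne_zero.2 (Nat.succ_ne_zero _)

/-- In the basis of the `E(u)` the coordinates are pairings with the dual Hall forests, and pairing
`β` with a forest `u` gives `β^U(u)` by definition. Only single trees survive. -/
theorem betaWord_eq_hallSeries : betaWord = hallSeries := by
  classical
  funext w
  set M : Multiset ℕ+ := (w.reverse : Multiset ℕ+) with hM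
  -- The series is not a polynomial, so only its part in the rearrangements of `w` is expanded.
  let p : FreeAlgebra ℝ ℕ+ := ∑ x ∈ M.lists.toFinset, betaWord x.reverse • monoRev ℝ x
  have hp : ∀ x : List ℕ+, (x : Multiset ℕ+) = M → coeffRev ℝ x p = betaWord x.reverse := by
    intro x hx
    have hx : x ∈ M.lists.toFinset := by
      rw [Multiset.mem_toFinset, Multiset.mem_lists_iff, ← hx]; rfl
    simp only [p, map_sum, map_smul, coeffRev_monoRev, smul_eq_mul, mul_ite, mul_one, mul_zero]
    rw [Finset.sum_ite_eq, if_pos hx]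
  let b : Module.Basis HallForest ℝ (FreeAlgebra ℝ ℕ+) :=
    Module.Basis.mk (HallForest.linearIndependent_poly ℝ) (HallForest.span_range_poly ℝ).ge
  have hb : ∀ u, b u = u.poly ℝ := fun u => Module.Basis.mk_apply _ _ u
  have hrepr : ∀ u, b.repr p u = pairing ℝ (Forest.lin u.toForest) p := by
    intro u
    have : b.coord u = pairing ℝ (Forest.lin u.toForest) := by
      refine b.ext fun v => ?_
      rw [Module.Basis.coord_apply, Module.Basis.repr_self, hb, HallForest.pairing_poly,
        Finsupp.single_apply]
    exact LinearMap.congr_fun this p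
  -- If `u` has other letters than `w`, the coordinate of `p` need not be `β^U(u)`, but then `E(u)`
  -- has no coefficient at `w`.
  have hterm : ∀ u : HallForest, b.repr p u * coeff w (u.poly ℝ) =
      betaU u.toForest * coeff w (u.poly ℝ) := by
    intro u
    by_cases hc : listContent u.1 = M
    · congr 1
      rw [hrepr, pairing_apply, betaU_eq, Forest.extend_eq]
      refine congrArg _ (Multiset.map_congr rfl fun x hx => hp x ?_)
      rw [← hc]
      exact hasLabels_treeProd (fun t _ => hasLabels_branches t) x hx
    · have : coeff w (u.poly ℝ) = 0 := by
        have := coeffRev_eq_zero ℝ (polyL_mem_homogeneous ℝ u.1) (w := w.reverse) (Ne.symm hc)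
        rwa [coeffRev_apply, List.reverse_reverse] at this
      rw [this, mul_zero, mul_zero]
  have hcoeff : betaWord w = ∑ u ∈ (b.repr p).support, b.repr p u * coeff w (u.poly ℝ) := by
    have h₁ := hp w.reverse hM.symm
    rw [List.reverse_reverse] at h₁
    rw [← h₁]
    conv_lhs => rw [← b.linearCombination_repr p, Finsupp.linearCombination_apply, Finsupp.sum,
      map_sum]
    refine Finset.sum_congr rfl fun u _ => ?_
    rw [map_smul, hb, coeffRev_apply, List.reverse_reverse, smul_eq_mul]
  have hfin : betaWord w = ∑ᶠ u : HallForest, betaU u.toForest * coeff w (u.poly ℝ) := by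
    rw [hcoeff, finsum_eq_sum_of_support_subset (s := (b.repr p).support)]
    · exact Finset.sum_congr rfl fun u _ => hterm u
    · intro u hu
      rw [Function.mem_support, ← hterm] at hu
      exact Finsupp.mem_support_iff.2 (left_ne_zero_of_mul hu)
  have hsupp : (Function.support fun u : HallForest => betaU u.toForest * coeff w (u.poly ℝ)) ⊆
      Set.range single := by
    intro u hu
    by_contra h
    exact hu (by simp [betaU_toForest_eq_zero h])
  rw [hfin, ← finsum_mem_univ, ← finsum_mem_inter_support_eq' _ (Set.range single) Set.univ
    fun u hu => by simp [hsupp hu], finsum_mem_range single_injective, hallSeries]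
  refine finsum_congr fun t => ?_
  rw [poly_single, single, HallForest.toForest_singleton, hallTerm]

theorem alphaWord_eq_seriesExp : alphaWord = seriesExp hallSeries := by
  rw [← betaWord_eq_hallSeries, seriesExp_betaWord]

end

end HallFrame

theorem proposition5p53 (K : Type*) [Field K] [CharZero K] :
    -- `t` and `u` are rooted trees and forests: the coding of Hall trees and forests is faithful
    Function.Injective (fun t : HallFrame.HallTree => t.1.toTree) ∧
    Function.Injective HallFrame.HallForest.toForest ∧
    -- `α^U = exp β^U`, and `β^U` is supported on trees
    HallFrame.betaU 1 = 0 ∧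
    HallFrame.alphaU = HallFrame.Forest.expMap HallFrame.betaU ∧
    (∀ u : HallFrame.Forest ℕ+, ¬ u.IsTree → HallFrame.betaU u = 0) ∧
    -- `∑_w α^U_w w = exp (∑_t β^U(t) E(t))`, the inner sum being finite in each coefficient
    (∀ w : List ℕ+, (Function.support fun t => HallFrame.hallTerm t w).Finite) ∧
    HallFrame.alphaWord = HallFrame.seriesExp HallFrame.hallSeries ∧
    -- the `E(t)` form a basis of the free Lie algebra
    (LinearIndependent K (fun t : HallFrame.HallTree => t.1.hallPoly K) ∧
      Submodule.span K (Set.range fun t : HallFrame.HallTree => t.1.hallPoly K) = ⊤) ∧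
    -- the `E(u)` form a basis of the free associative algebra
    (LinearIndependent K (fun u : HallFrame.HallForest => u.poly K) ∧
      Submodule.span K (Set.range fun u : HallFrame.HallForest => u.poly K) = ⊤) :=
  ⟨HallFrame.HallTree.toTree_injective, HallFrame.HallForest.toForest_injective,
    HallFrame.betaU_one, HallFrame.alphaU_eq_expMap, fun _ => HallFrame.betaU_eq_zero,
    HallFrame.support_hallTerm_finite, HallFrame.alphaWord_eq_seriesExp,
    ⟨HallFrame.HallTree.linearIndependent_lie K, HallFrame.HallTree.span_range_lie K⟩,
    HallFrame.HallForest.linearIndependent_poly K, HallFrame.HallForest.span_range_poly K⟩
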